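/- Let $X$, $D$, $Y$ be (real or complex) Banach spaces such that $D$ is continuously and densely embedded into $X$, and let $\tau>0$. For $p\in(1,\infty)$ and $a<b$ put $\mathrm{MR}_p(a,b)=W^{1,p}(a,b;X)\cap L^p(a,b;D)$ and $\mathrm{Tr}_p=\{u(0):u\in \mathrm{MR}_p(0,1)\}$. An operator $B\in\mathcal L(D,X)$ has maximal $L^p$-regularity if for all bounded intervals $(a,b)$ and all $f\in L^p(a,b;X)$ there is a unique $u\in \mathrm{MR}_p(a,b)$ with $\dot u+Bu=f$ a.e. on $(a,b)$ and $u(a)=0$; $B$ has maximal regularity if it has maximal $L^p$-regularity for some $p\in(1,\infty)$. Let $A,P:[0,\tau]\to\mathcal L(D,X)$ be bounded and strongly measurable (that is, $t\mapsto A(t)x$ and $t\mapsto P(t)x$ are strongly measurable for every $x\in D$). An evolution family on $X$ is a family $U=(U(t,s))_{0\le s\le t\le\tau}\subset\mathcal L(X)$, strongly continuous in $(t,s)$, with $U(s,s)=I$ and $U(t,s)=U(t,r)U(r,s)$ for $0\le s\le r\le t\le\tau$. It is associated with $A(\cdot)$ if for some $q\in(1,\infty)$, all $s\in[0,\tau)$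 and all $x\in\mathrm{Tr}_q$, the function $u=U(\cdot,s)x$ belongs to $\mathrm{MR}_q(s,\tau)$ and satisfies $\dot u(t)+A(t)u(t)=0$ for a.e. $t\in(s,\tau)$ (and $u(s)=x$). The same definition is used for $A^P(\cdot):=A(\cdot)+P(\cdot)$. Assume: (H1) $A(t)$ has maximal regularity for every $t\in[0,\tau]$, and $A(\cdot)$ satisfies the relative $\nu$-Dini condition for some $\nu\in(1,\infty)$: there are $\eta\ge0$ and a continuous $\omega:[0,\tau]\to[0,\infty)$ with $\omega(0)=0$ and $\int_0^\tau(\omega(t)/t)^\nu\,dt<\infty$ such that $\|A(t)x-A(s)x\|\le\omega(|t-s|)\|x\|_D+\eta\|x\|$ for all $x\in D$ and $s,t\in[0,\tau]$. (H2) With $U$ the evolution family on $X$ associated with $A(\cdot)$, there are $\mu\in(1,\infty)$ and $c>0$ such that for all $0\le s<\tau'<\tau$ and all $x\in D$, $$\Big(\int_s^{\tau'}\|P(t)U(t,s)x\|^\mu\,dt\Big)^{1/\mu}\le c\|x\|.$$ Then $A(\cdot)$ and $A^P(\cdot)$ each have exactly one associated evolution family on $X$, denoted $U$ and $V$ respectively,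 and $$\mathscr O^\theta_Y(A(\cdot))=\mathscr O^\theta_Y(A^P(\cdot))\qquad\text{for every }1<\theta\le\mu .$$ Here $\mathscr O^\theta_Y(A(\cdot))$ is the set of $L^\theta$-admissible observation operators for $A(\cdot)$, i.e. of all $C\in\mathcal L(D,Y)$ for which there are constants $\gamma,\alpha>0$ such that for all $s\in[0,\tau)$ and $x\in D$, $$\Big(\int_s^{\min\{s+\alpha,\tau\}}\|CU(t,s)x\|_Y^\theta\,dt\Big)^{1/\theta}\le\gamma\|x\|,$$ and $\mathscr O^\theta_Y(A^P(\cdot))$ is defined in the same way with $V$ in place of $U$. -/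

import Mathlib

open MeasureTheory Set
open scoped ENNReal

noncomputable section

namespace NonAutonomous

variable {𝕜 X D Y : Type*} [RCLike 𝕜]
  [NormedAddCommGroup X] [NormedSpace 𝕜 X] [NormedSpace ℝ X]
  [NormedAddCommGroup D] [NormedSpace 𝕜 D]
  [NormedAddCommGroup Y] [NormedSpace 𝕜 Y]

/-- Throughout, `ι : D →L[𝕜] X` is the (injective) embedding of `D` into `X`.  `toD ι y` is the
vector `y : X` regarded as an element of `D`; it is meaningful exactly for `y ∈ range ι`. -/
def toD (ι : D →L[𝕜] X) (y : X) : D := Function.invFun ι y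

/-- `w` is (the continuous representative of) an element of `W^{1,p}(a,b;X)`, and `v` is its weak
derivative: `v ∈ L^p(a,b;X)` and `w` is a primitive of `v` on `[a,b]`. -/
def HasSobolevDeriv (p a b : ℝ) (w v : ℝ → X) : Prop :=
  MemLp v (ENNReal.ofReal p) (volume.restrict (Ioo a b)) ∧
    ∀ t ∈ Icc a b, w t = w a + ∫ r in a..t, v r

/-- `w ∈ L^p(a,b;D)`, for an `X`-valued function `w`. -/
def MemLpD (ι : D →L[𝕜] X) (p a b : ℝ) (w : ℝ → X) : Prop :=
  (∀ᵐ t ∂(volume.restrict (Ioo a b)), w t ∈ range ι) ∧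
    MemLp (fun t => toD ι (w t)) (ENNReal.ofReal p) (volume.restrict (Ioo a b))

/-- The space of maximal regularity `MR_p(a,b) = W^{1,p}(a,b;X) ∩ L^p(a,b;D)`. -/
def MRSpace (ι : D →L[𝕜] X) (p a b : ℝ) : Set (ℝ → X) :=
  {w | (∃ v, HasSobolevDeriv p a b w v) ∧ MemLpD ι p a b w}

/-- The trace space `Tr_p = {w(a) : w ∈ MR_p(a,b)}` (it does not depend on the interval). -/
def traceSpace (ι : D →L[𝕜] X) (p : ℝ) : Set X :=
  {x | ∃ w ∈ MRSpace ι p 0 1, w 0 = x}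

/-- `w ∈ MR_p(a,b)` and `w'(t) + A(t) w(t) = f(t)` for almost every `t ∈ (a,b)`. -/
def IsSolution (ι : D →L[𝕜] X) (A : ℝ → D →L[𝕜] X) (p a b : ℝ) (f w : ℝ → X) : Prop :=
  MemLpD ι p a b w ∧ ∃ v, HasSobolevDeriv p a b w v ∧
    ∀ᵐ t ∂(volume.restrict (Ioo a b)), v t + A t (toD ι (w t)) = f t

/-- Maximal `L^p`-regularity of a single operator `A ∈ L(D,X)`: on every bounded interval and for
every `f ∈ L^p(a,b;X)` the problem `w' + A w = f`, `w(a) = 0`, has a unique solution in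
`MR_p(a,b)`. -/
def HasMaxRegLp (ι : D →L[𝕜] X) (A : D →L[𝕜] X) (p : ℝ) : Prop :=
  ∀ a b : ℝ, a < b → ∀ f : ℝ → X, MemLp f (ENNReal.ofReal p) (volume.restrict (Ioo a b)) →
    ∃ w, (IsSolution ι (fun _ => A) p a b f w ∧ w a = 0) ∧
      ∀ w', IsSolution ι (fun _ => A) p a b f w' → w' a = 0 → EqOn w' w (Icc a b)

/-- Maximal regularity: maximal `L^p`-regularity for some `p ∈ (1,∞)`. -/
def HasMaxReg (ι : D →L[𝕜] X) (A : D →L[𝕜] X) : Prop :=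
  ∃ p : ℝ, 1 < p ∧ HasMaxRegLp ι A p

/-- A strongly measurable and bounded operator function on `[0,τ]` (measurability is that of the
orbits `t ↦ A(t)x`). -/
def IsStronglyMeasBdd (τ : ℝ) (A : ℝ → D →L[𝕜] X) : Prop :=
  (∀ x : D, AEStronglyMeasurable (fun t => A t x) (volume.restrict (Icc 0 τ))) ∧
    ∃ M : ℝ, ∀ t ∈ Icc 0 τ, ‖A t‖ ≤ M

/-- The relative `ν`-Dini condition on `[0,τ]`. -/
def RelativeDini (ι : D →L[𝕜] X) (τ : ℝ) (A : ℝ → D →L[𝕜] X) (ν : ℝ) : Prop :=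
  ∃ (η : ℝ) (ω : ℝ → ℝ), 0 ≤ η ∧ ContinuousOn ω (Icc 0 τ) ∧ (∀ t ∈ Icc 0 τ, 0 ≤ ω t) ∧
    ω 0 = 0 ∧ IntegrableOn (fun t => (ω t / t) ^ ν) (Ioc 0 τ) ∧
    ∀ x : D, ∀ s ∈ Icc 0 τ, ∀ t ∈ Icc 0 τ,
      ‖A t x - A s x‖ ≤ ω |t - s| * ‖x‖ + η * ‖ι x‖

/-- Condition (H1): every `A(t)` has maximal regularity, and `A(·)` satisfies the relative
`ν`-Dini condition for some `ν ∈ (1,∞)`. -/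
def CondH1 (ι : D →L[𝕜] X) (τ : ℝ) (A : ℝ → D →L[𝕜] X) : Prop :=
  (∀ t ∈ Icc 0 τ, HasMaxReg ι (A t)) ∧ ∃ ν : ℝ, 1 < ν ∧ RelativeDini ι τ A ν

/-- A (strongly continuous) evolution family `(U(t,s))_{0 ≤ s ≤ t ≤ τ}` on `X`. -/
structure IsEvolutionFamily (τ : ℝ) (U : ℝ → ℝ → X →L[𝕜] X) : Prop where
  refl : ∀ s ∈ Icc 0 τ, U s s = ContinuousLinearMap.id 𝕜 X
  comp : ∀ s r t, 0 ≤ s → s ≤ r → r ≤ t → t ≤ τ → U t s = (U t r).comp (U r s)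
  cont : ∀ x : X, ContinuousOn (fun z : ℝ × ℝ => U z.1 z.2 x) {z | 0 ≤ z.2 ∧ z.2 ≤ z.1 ∧ z.1 ≤ τ}

/-- `U` is an evolution family on `X` associated with `A(·)`: for some `q ∈ (1,∞)`, its orbits
starting in `Tr_q` lie in `MR_q(s,τ)` and solve `w' + A(t)w = 0` (and `w(s) = x`, as
`U(s,s) = I`). That is, `U` extends the evolution family on `Tr_q` that solves this problem. -/
def IsAssociated (ι : D →L[𝕜] X) (τ : ℝ) (A : ℝ → D →L[𝕜] X) (U : ℝ → ℝ → X →L[𝕜] X) : Prop :=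
  IsEvolutionFamily τ U ∧ ∃ q : ℝ, 1 < q ∧ ∀ s ∈ Ico 0 τ, ∀ x ∈ traceSpace ι q,
    IsSolution ι A q s τ (fun _ => 0) (fun t => U t s x)

/-- There is exactly one evolution family on `X` associated with `A(·)` (equality is required on
the triangle `0 ≤ s ≤ t ≤ τ`, the only place where evolution families are considered). -/
def HasUniqueEvolutionFamily (ι : D →L[𝕜] X) (τ : ℝ) (A : ℝ → D →L[𝕜] X) : Prop :=
  ∃ U, IsAssociated ι τ A U ∧
    ∀ U', IsAssociated ι τ A U' → ∀ s t, 0 ≤ s → s ≤ t → t ≤ τ → U' t s = U t s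

/-- The Miyadera–Voigt estimate of condition (H2), with exponent `μ`, for the evolution family `U`
associated with `A(·)`. -/
def MiyaderaVoigt (ι : D →L[𝕜] X) (τ : ℝ) (A P : ℝ → D →L[𝕜] X) (μ : ℝ) : Prop :=
  ∀ U, IsAssociated ι τ A U → ∃ c : ℝ, 0 < c ∧ ∀ s τ', 0 ≤ s → s < τ' → τ' < τ → ∀ x : D,
    eLpNorm (fun t => P t (toD ι (U t s (ι x)))) (ENNReal.ofReal μ) (volume.restrict (Ioo s τ'))
      ≤ ENNReal.ofReal (c * ‖ι x‖)

/-- The set of `L^θ`-admissible observation operators `C ∈ L(D,Y)` for `A(·)`: there are constants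
`γ, α > 0` such that `(∫_s^{s+α} ‖C U(t,s)x‖^θ dt)^{1/θ} ≤ γ ‖x‖` for all `s ∈ [0,τ)` and
`x ∈ D`, the integral being cut off at `τ`. -/
def admissibleObs (Y : Type*) [NormedAddCommGroup Y] [NormedSpace 𝕜 Y]
    (ι : D →L[𝕜] X) (τ : ℝ) (A : ℝ → D →L[𝕜] X) (θ : ℝ) : Set (D →L[𝕜] Y) :=
  {C | ∃ U, IsAssociated ι τ A U ∧ ∃ γ α : ℝ, 0 < γ ∧ 0 < α ∧ ∀ s ∈ Ico 0 τ, ∀ x : D,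
    eLpNorm (fun t => C (toD ι (U t s (ι x)))) (ENNReal.ofReal θ)
        (volume.restrict (Ioo s (min (s + α) τ)))
      ≤ ENNReal.ofReal (γ * ‖ι x‖)}

end NonAutonomous

end

/-! Work with one exponent p slightly above 1, unrelated to θ. For a problem w' + B(t)w = f on
subintervals of [0,τ] two facts suffice: maximal L^p-regularity with a uniform constant, and a bound
‖w(t)‖ ≤ K‖w(a)‖ in X for homogeneous orbits. `EvolWP` packages them. Since D is dense in X, they
produce the evolution family (`EvolWP.exists_propagator`). Having them for all exponents in a range
(1,q] gives uniqueness, because an associated family may use any exponent of its own.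

For A(·), freeze the coefficients. The operators A(s) may have maximal regularity with different
exponents, so the exponent is first lowered by a Calderón–Zygmund argument (`AutWP.exists_of_lt`),
and compactness of [0,τ] then gives a common one. The Hörmander condition needs no kernel: for f
with mean zero on (c,d), integrating in time turns the solution beyond d into an orbit with small
initial value, and weights t - d give the decay of its derivatives (`Sol.lintegral_tail_le`).
Well-posedness of A(·) on short intervals follows by perturbing A(s), and on long ones by gluing.
For the orbit bound, compare with the frozen orbit u₀ started at a: it satisfies (t-a)‖u₀(t)‖_D ≤
K‖x‖, so the error (A(a)-A(t))u₀ is controlled by ω(t-a)/(t-a), which lies in L^p by the Dini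
condition if p ≤ ν (`RelCont.exists_orbit_bound`).

The bridge to the perturbed problem is the convolution estimate `ObsBdd.eLpNorm_le`: the solution
with right-hand side f and zero initial value is a superposition of orbits, so an observation
bounded by γ‖x‖ in L^Θ along orbits is bounded by γ‖f‖ in terms of the L¹-norm of f alone. Applied
to the observation P(·), Hölder's inequality on an interval of length h gives a factor h^(1-1/p), so
P(·) is a small perturbation on short intervals and A^P(·) inherits both facts
(`EvolWP.exists_perturb`). Applied to C, it gives the admissibility statement: an orbit of V is the
orbit of U plus the solution for A(·) with right-hand side -P(·)V(·,s)x, whose L¹-norm is at most a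
constant times ‖x‖ (`ObsBdd.of_perturb`). Since P(·) satisfies the Miyadera–Voigt estimate on the
orbits of both families, U and V can be exchanged, and the two sets of observations coincide. -/

namespace NonAutonomous

/-! ### L^p estimates on intervals, and bounded operator functions. -/

section Basic

set_option linter.unusedSectionVars false

open Filter Topology
open scoped NNReal

/-- Lebesgue measure on the interval `(a,b)`. -/
noncomputable abbrev iv (a b : ℝ) : Measure ℝ := volume.restrict (Ioo a b)

lemma iv_univ (a b : ℝ) : iv a b univ = ENNReal.ofReal (b - a) := by simp [iv]

lemma iv_mono {a b c d : ℝ} (hac : a ≤ c) (hdb : d ≤ b) : iv c d ≤ iv a b :=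
  Measure.restrict_mono (Ioo_subset_Ioo hac hdb) le_rfl

lemma ae_iv_mono {a b c d : ℝ} (hac : a ≤ c) (hdb : d ≤ b) {P : ℝ → Prop}
    (h : ∀ᵐ t ∂(iv a b), P t) : ∀ᵐ t ∂(iv c d), P t :=
  ae_mono (iv_mono hac hdb) h

lemma ae_iv_mem (a b : ℝ) : ∀ᵐ t ∂(iv a b), t ∈ Ioo a b := ae_restrict_mem measurableSet_Ioo

lemma ae_iv_of_forall {a b : ℝ} {P : ℝ → Prop} (h : ∀ t ∈ Ioo a b, P t) : ∀ᵐ t ∂(iv a b), P t := by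
  filter_upwards [ae_iv_mem a b] with t ht using h t ht

lemma ae_iv_split {a b c : ℝ} {P : ℝ → Prop} (h1 : ∀ᵐ t ∂(iv a c), P t)
    (h2 : ∀ᵐ t ∂(iv c b), P t) : ∀ᵐ t ∂(iv a b), P t := by
  rw [iv, ae_restrict_iff' measurableSet_Ioo] at *
  have h3 : ∀ᵐ t : ℝ, t ≠ c := by simp [ae_iff, measure_singleton]
  filter_upwards [h1, h2, h3] with t h1 h2 h3 ht
  rcases lt_or_gt_of_ne h3 with h | h
  · exact h1 ⟨ht.1, h⟩
  · exact h2 ⟨h, ht.2⟩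

lemma exists_of_ae_iv {a b : ℝ} (hab : a < b) {P : ℝ → Prop} (h : ∀ᵐ t ∂(iv a b), P t) :
    ∃ t ∈ Ioo a b, P t := by
  have : NeBot (ae (iv a b)) := by
    rw [ae_neBot, iv, Ne, Measure.restrict_eq_zero]; simp [hab]
  obtain ⟨t, h1, h2⟩ := (h.and (ae_iv_mem a b)).exists
  exact ⟨t, h2, h1⟩

variable {X D Y : Type*} [NormedAddCommGroup X] [NormedAddCommGroup D] [NormedAddCommGroup Y]

lemma memLp_iv_mono {p : ℝ≥0∞} {v : ℝ → X} {a b c d : ℝ} (h : MemLp v p (iv a b))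
    (hac : a ≤ c) (hdb : d ≤ b) : MemLp v p (iv c d) :=
  h.mono_measure (iv_mono hac hdb)

lemma eLpNorm_iv_mono {p : ℝ≥0∞} (v : ℝ → X) {a b c d : ℝ}
    (hac : a ≤ c) (hdb : d ≤ b) : eLpNorm v p (iv c d) ≤ eLpNorm v p (iv a b) :=
  eLpNorm_mono_measure _ (iv_mono hac hdb)

lemma memLp_piecewise_iv {p : ℝ≥0∞} {v v' : ℝ → X} {a b c : ℝ} (h : MemLp v p (iv a c))
    (h' : MemLp v' p (iv c b)) : MemLp (fun t => if t ≤ c then v t else v' t) p (iv a b) := by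
  have : (fun t => if t ≤ c then v t else v' t) = (Iic c).piecewise v v' := by
    ext t; simp [piecewise]
  rw [this]
  refine MemLp.piecewise measurableSet_Iic ?_ ?_
  · refine h.mono_measure ?_
    rw [iv, Measure.restrict_restrict measurableSet_Iic]
    have h1 : iv a c = volume.restrict (Ioc a c) := Measure.restrict_congr_set Ioo_ae_eq_Ioc
    rw [h1]
    refine Measure.restrict_mono ?_ le_rfl
    rintro t ⟨h1, h2⟩
    exact ⟨h2.1, h1⟩
  · refine h'.mono_measure ?_
    rw [iv, Measure.restrict_restrict measurableSet_Iic.compl]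
    refine Measure.restrict_mono ?_ le_rfl
    rintro t ⟨h1, h2⟩
    exact ⟨by simpa using h1, h2.2⟩

lemma memLp_extend_zero {p : ℝ≥0∞} {v : ℝ → X} {a b c d : ℝ} (h : MemLp v p (iv c d)) :
    MemLp ((Ioo c d).indicator v) p (iv a b) := by
  refine MemLp.mono_measure (μ := (volume : Measure ℝ)) Measure.restrict_le_self ?_
  exact (memLp_indicator_iff_restrict measurableSet_Ioo).2 h

lemma eLpNorm_extend_zero_le {p : ℝ≥0∞} (v : ℝ → X) {a b c d : ℝ} :
    eLpNorm ((Ioo c d).indicator v) p (iv a b) ≤ eLpNorm v p (iv c d) := by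
  refine (eLpNorm_mono_measure (μ := (volume : Measure ℝ)) _ Measure.restrict_le_self).trans ?_
  rw [eLpNorm_indicator_eq_eLpNorm_restrict measurableSet_Ioo]

variable [NormedSpace ℝ X]

lemma intervalIntegrable_of_memLp {p : ℝ≥0∞} (hp : 1 ≤ p) {v : ℝ → X} {a b c d : ℝ}
    (h : MemLp v p (iv a b)) (hc : c ∈ Icc a b) (hd : d ∈ Icc a b) :
    IntervalIntegrable v volume c d := by
  have h1 : IntegrableOn v (Ioc a b) :=
    (integrableOn_Ioc_iff_integrableOn_Ioo).2 (h.integrable hp)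
  rw [intervalIntegrable_iff]
  refine h1.mono_set fun t ht => ?_
  rw [mem_uIoc] at ht
  rcases ht with ht | ht
  · exact ⟨hc.1.trans_lt ht.1, ht.2.trans hd.2⟩
  · exact ⟨hd.1.trans_lt ht.1, ht.2.trans hc.2⟩

lemma continuousOn_primitive {p : ℝ≥0∞} (hp : 1 ≤ p) {v : ℝ → X} {a b : ℝ} (hab : a ≤ b)
    (h : MemLp v p (iv a b)) : ContinuousOn (fun t => ∫ r in a..t, v r) (Icc a b) := by
  have := intervalIntegral.continuousOn_primitive_interval'
    (intervalIntegrable_of_memLp hp h (left_mem_Icc.2 hab) (right_mem_Icc.2 hab)) left_mem_uIcc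
  rwa [uIcc_of_le hab] at this

lemma enorm_integral_le_eLpNorm_one (v : ℝ → X) {c d : ℝ} (hcd : c ≤ d) :
    ‖∫ r in c..d, v r‖ₑ ≤ eLpNorm v 1 (iv c d) := by
  rw [intervalIntegral.integral_of_le hcd, eLpNorm_one_eq_lintegral_enorm, iv,
    Measure.restrict_congr_set Ioo_ae_eq_Ioc]
  exact enorm_integral_le_lintegral_enorm _

lemma eLpNorm_one_le_iv {p : ℝ≥0∞} (hp : 1 ≤ p) {v : ℝ → X} {c d : ℝ}
    (hv : AEStronglyMeasurable v (iv c d)) :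
    eLpNorm v 1 (iv c d) ≤ eLpNorm v p (iv c d) * ENNReal.ofReal (d - c) ^ (1 - 1 / p.toReal) := by
  have := eLpNorm_le_eLpNorm_mul_rpow_measure_univ hp hv
  simpa [iv_univ] using this

lemma eLpNorm_const_iv_le {p : ℝ≥0∞} {v : ℝ → Y} {c d : ℝ} {K : ℝ≥0∞}
    (h : ∀ᵐ t ∂(iv c d), ‖v t‖ₑ ≤ K) :
    eLpNorm v p (iv c d) ≤ K * ENNReal.ofReal (d - c) ^ (1 / p.toReal) := by
  refine (eLpNorm_le_of_ae_enorm_bound h).trans ?_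
  rw [iv_univ, one_div, smul_eq_mul]

lemma rpow_mul_rpow_conj {p : ℝ≥0∞} (hp : 1 ≤ p) (hp' : p ≠ ∞) (x : ℝ) :
    ENNReal.ofReal x ^ (1 - 1 / p.toReal) * ENNReal.ofReal x ^ (1 / p.toReal)
      = ENNReal.ofReal x := by
  have h1 : 1 ≤ p.toReal := by simpa using (ENNReal.toReal_le_toReal (by simp) hp').2 hp
  rw [← ENNReal.rpow_add_of_nonneg _ _ (by rw [sub_nonneg, div_le_one] <;> linarith) (by positivity)]
  simp

lemma eLpNorm_primitive_le {p : ℝ≥0∞} (hp : 1 ≤ p) (hp' : p ≠ ∞) {v : ℝ → X} {a b : ℝ}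
    (hv : AEStronglyMeasurable v (iv a b)) :
    eLpNorm (fun t => ∫ r in a..t, v r) p (iv a b)
      ≤ ENNReal.ofReal (b - a) * eLpNorm v p (iv a b) := by
  have h1 : ∀ᵐ t ∂(iv a b), ‖∫ r in a..t, v r‖ₑ
      ≤ eLpNorm v p (iv a b) * ENNReal.ofReal (b - a) ^ (1 - 1 / p.toReal) := by
    refine ae_iv_of_forall fun t ht => ?_
    exact (enorm_integral_le_eLpNorm_one v ht.1.le).trans
      ((eLpNorm_iv_mono v le_rfl ht.2.le).trans (eLpNorm_one_le_iv hp hv))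
  refine (eLpNorm_const_iv_le h1).trans ?_
  rw [mul_assoc, rpow_mul_rpow_conj hp hp', mul_comm]

lemma memLp_of_continuousOn {p : ℝ≥0∞} {w : ℝ → X} {a b : ℝ} (h : ContinuousOn w (Icc a b)) :
    MemLp w p (iv a b) := by
  obtain ⟨K, hK⟩ := isCompact_Icc.exists_bound_of_continuousOn h
  refine MemLp.of_bound ?_ K (ae_iv_of_forall fun t ht => hK t (Ioo_subset_Icc_self ht))
  exact (h.mono Ioo_subset_Icc_self).aestronglyMeasurable measurableSet_Ioo

variable [NormedSpace ℝ D] [NormedSpace ℝ Y]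

/-- A bounded, strongly measurable operator function on `(a,b)`. -/
structure OpBdd (B : ℝ → D →L[ℝ] Y) (M : ℝ≥0) (a b : ℝ) : Prop where
  meas : ∀ x, AEStronglyMeasurable (fun t => B t x) (iv a b)
  bdd : ∀ t ∈ Ioo a b, ‖B t‖ ≤ M

lemma OpBdd.mono {B : ℝ → D →L[ℝ] Y} {M : ℝ≥0} {a b c d : ℝ} (h : OpBdd B M a b)
    (hac : a ≤ c) (hdb : d ≤ b) : OpBdd B M c d :=
  ⟨fun x => (h.meas x).mono_measure (iv_mono hac hdb),
    fun t ht => h.bdd t ⟨hac.trans_lt ht.1, ht.2.trans_le hdb⟩⟩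

lemma OpBdd.const (B : D →L[ℝ] Y) (a b : ℝ) : OpBdd (fun _ => B) ‖B‖₊ a b :=
  ⟨fun _ => aestronglyMeasurable_const, fun _ _ => le_rfl⟩

lemma OpBdd.add {B B' : ℝ → D →L[ℝ] Y} {M M' : ℝ≥0} {a b : ℝ} (h : OpBdd B M a b)
    (h' : OpBdd B' M' a b) : OpBdd (fun t => B t + B' t) (M + M') a b :=
  ⟨fun x => (h.meas x).add (h'.meas x),
    fun t ht => (norm_add_le _ _).trans (add_le_add (h.bdd t ht) (h'.bdd t ht))⟩

lemma OpBdd.sub {B B' : ℝ → D →L[ℝ] Y} {M M' : ℝ≥0} {a b : ℝ} (h : OpBdd B M a b)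
    (h' : OpBdd B' M' a b) : OpBdd (fun t => B t - B' t) (M + M') a b :=
  ⟨fun x => (h.meas x).sub (h'.meas x),
    fun t ht => (norm_sub_le _ _).trans (add_le_add (h.bdd t ht) (h'.bdd t ht))⟩

/-- Measurability is only assumed orbit by orbit, not for B in operator norm. For simple u the
composition is a finite sum of orbits cut to measurable sets; simple approximation and continuity of
each `B t` give the general case. -/
lemma OpBdd.aestronglyMeasurable {B : ℝ → D →L[ℝ] Y} {M : ℝ≥0} {a b : ℝ} (h : OpBdd B M a b)
    {u : ℝ → D} (hu : AEStronglyMeasurable u (iv a b)) :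
    AEStronglyMeasurable (fun t => B t (u t)) (iv a b) := by
  have hs : ∀ s : SimpleFunc ℝ D, AEStronglyMeasurable (fun t => B t (s t)) (iv a b) := by
    intro s
    have : (fun t => B t (s t))
        = fun t => ∑ x ∈ s.range, (s ⁻¹' {x}).indicator (fun t => B t x) t := by
      ext t
      rw [Finset.sum_eq_single (s t)]
      · simp
      · intro x _ hx
        simp [indicator_of_notMem, Ne.symm hx]
      · intro h; simp at h
    rw [this]
    refine Finset.aestronglyMeasurable_fun_sum _ fun x _ => ?_
    exact (h.meas x).indicator (s.measurableSet_preimage _)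
  refine AEStronglyMeasurable.congr (f := fun t => B t (hu.mk u t)) ?_ ?_
  · refine aestronglyMeasurable_of_tendsto_ae atTop
      (fun n => hs (hu.stronglyMeasurable_mk.approx n)) (Eventually.of_forall fun t => ?_)
    exact ((B t).continuous.tendsto _).comp (hu.stronglyMeasurable_mk.tendsto_approx t)
  · filter_upwards [hu.ae_eq_mk] with t ht using by rw [ht]

lemma OpBdd.eLpNorm_le {B : ℝ → D →L[ℝ] Y} {M : ℝ≥0} {a b : ℝ} (h : OpBdd B M a b)
    (u : ℝ → D) (p : ℝ≥0∞) :
    eLpNorm (fun t => B t (u t)) p (iv a b) ≤ M * eLpNorm u p (iv a b) := by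
  have := eLpNorm_le_nnreal_smul_eLpNorm_of_ae_le_mul (μ := iv a b) (f := fun t => B t (u t))
    (g := u) (c := M) (ae_iv_of_forall fun t ht => ?_) p
  · simpa [ENNReal.smul_def] using this
  · have h1 := (B t).le_of_opNorm_le (h.bdd t ht) (u t)
    exact_mod_cast h1

lemma OpBdd.memLp {B : ℝ → D →L[ℝ] Y} {M : ℝ≥0} {a b : ℝ} (h : OpBdd B M a b)
    {u : ℝ → D} {p : ℝ≥0∞} (hu : MemLp u p (iv a b)) : MemLp (fun t => B t (u t)) p (iv a b) :=
  ⟨h.aestronglyMeasurable hu.1,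
    (h.eLpNorm_le u p).trans_lt (ENNReal.mul_lt_top (by simp) hu.2)⟩

end Basic

end NonAutonomous

namespace NonAutonomous

/-! ### Solutions as pairs (u, v), well-posedness, perturbation and stability. -/

section Solutions

set_option linter.unusedSectionVars false

open Filter Topology
open scoped NNReal

variable {X D : Type*} [NormedAddCommGroup X] [NormedAddCommGroup D]
  [NormedSpace ℝ X] [NormedSpace ℝ D] {ι : D →L[ℝ] X}

/-- `u ∈ L^p(a,b;D)` solves `w' + B(t)w = f`, `w(a) = x` on `(a,b)`, where `w = x + ∫ v` is the
continuous representative of `ι ∘ u` and `v ∈ L^p(a,b;X)` its derivative. -/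
structure Sol (ι : D →L[ℝ] X) (B : ℝ → D →L[ℝ] X) (p : ℝ≥0∞) (a b : ℝ) (x : X) (f : ℝ → X)
    (u : ℝ → D) (v : ℝ → X) : Prop where
  memU : MemLp u p (iv a b)
  memV : MemLp v p (iv a b)
  prim : ∀ᵐ t ∂(iv a b), ι (u t) = x + ∫ r in a..t, v r
  eqn : ∀ᵐ t ∂(iv a b), v t + B t (u t) = f t

variable {B : ℝ → D →L[ℝ] X} {p : ℝ≥0∞} {a b c : ℝ} {x x' : X} {f f' v v' : ℝ → X} {u u' : ℝ → D}

lemma Sol.congr (h : Sol ι B p a b x f u v) (hf : ∀ᵐ t ∂(iv a b), f t = f' t) :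
    Sol ι B p a b x f' u v :=
  ⟨h.memU, h.memV, h.prim, by filter_upwards [h.eqn, hf] with t h1 h2 using h1.trans h2⟩

lemma Sol.congr_op {B' : ℝ → D →L[ℝ] X} (h : Sol ι B p a b x f u v)
    (hf : ∀ᵐ t ∂(iv a b), v t + B' t (u t) = f' t) : Sol ι B' p a b x f' u v :=
  ⟨h.memU, h.memV, h.prim, hf⟩

lemma Sol.mono_exponent {q : ℝ≥0∞} (h : Sol ι B p a b x f u v) (hq : q ≤ p) :
    Sol ι B q a b x f u v :=
  ⟨h.memU.mono_exponent hq, h.memV.mono_exponent hq, h.prim, h.eqn⟩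

lemma Sol.intervalIntegrable (hp : 1 ≤ p) (h : Sol ι B p a b x f u v) {c d : ℝ}
    (hc : c ∈ Icc a b) (hd : d ∈ Icc a b) : IntervalIntegrable v volume c d :=
  intervalIntegrable_of_memLp hp h.memV hc hd

lemma Sol.continuousOn (hp : 1 ≤ p) (hab : a ≤ b) (h : Sol ι B p a b x f u v) :
    ContinuousOn (fun t => x + ∫ r in a..t, v r) (Icc a b) :=
  continuousOn_const.add (continuousOn_primitive hp hab h.memV)

lemma Sol.restrict (hp : 1 ≤ p) (h : Sol ι B p a b x f u v) {c d : ℝ} (hac : a ≤ c) (hcd : c ≤ d)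
    (hdb : d ≤ b) : Sol ι B p c d (x + ∫ r in a..c, v r) f u v := by
  refine ⟨memLp_iv_mono h.memU hac hdb, memLp_iv_mono h.memV hac hdb, ?_,
    ae_iv_mono hac hdb h.eqn⟩
  filter_upwards [ae_iv_mono hac hdb h.prim, ae_iv_mem c d] with t h1 ht
  rw [h1, add_assoc, intervalIntegral.integral_add_adjacent_intervals]
  · exact h.intervalIntegrable hp ⟨le_rfl, by linarith⟩ ⟨hac, by linarith⟩
  · exact h.intervalIntegrable hp ⟨hac, by linarith⟩ ⟨by linarith [ht.1], by linarith [ht.2]⟩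

lemma Sol.restrict_left (hp : 1 ≤ p) (h : Sol ι B p a b x f u v) {d : ℝ} (had : a ≤ d)
    (hdb : d ≤ b) : Sol ι B p a d x f u v := by
  simpa using h.restrict hp le_rfl had hdb

lemma Sol.add (hp : 1 ≤ p) (h : Sol ι B p a b x f u v) (h' : Sol ι B p a b x' f' u' v') :
    Sol ι B p a b (x + x') (fun t => f t + f' t) (fun t => u t + u' t) (fun t => v t + v' t) := by
  refine ⟨h.memU.add h'.memU, h.memV.add h'.memV, ?_, ?_⟩
  · filter_upwards [h.prim, h'.prim, ae_iv_mem a b] with t h1 h2 ht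
    have e : a ∈ Icc a b := ⟨le_rfl, by linarith [ht.1, ht.2]⟩
    rw [map_add, h1, h2, intervalIntegral.integral_add
      (h.intervalIntegrable hp e (Ioo_subset_Icc_self ht))
      (h'.intervalIntegrable hp e (Ioo_subset_Icc_self ht))]
    abel
  · filter_upwards [h.eqn, h'.eqn] with t h1 h2
    rw [← h1, ← h2, map_add]; abel

lemma Sol.smul (h : Sol ι B p a b x f u v) (k : ℝ) :
    Sol ι B p a b (k • x) (fun t => k • f t) (fun t => k • u t) (fun t => k • v t) := by
  refine ⟨h.memU.const_smul k, h.memV.const_smul k, ?_, ?_⟩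
  · filter_upwards [h.prim] with t h1
    rw [map_smul, h1, intervalIntegral.integral_smul, smul_add]
  · filter_upwards [h.eqn] with t h1
    rw [← h1, map_smul, smul_add]

lemma Sol.sub (hp : 1 ≤ p) (h : Sol ι B p a b x f u v) (h' : Sol ι B p a b x' f' u' v') :
    Sol ι B p a b (x - x') (fun t => f t - f' t) (fun t => u t - u' t) (fun t => v t - v' t) := by
  have := h.add hp (h'.smul (-1))
  simpa [sub_eq_add_neg] using this

lemma Sol.const (y : D) (f : ℝ → X) (hf : ∀ᵐ t ∂(iv a b), B t y = f t) :
    Sol ι B p a b (ι y) f (fun _ => y) (fun _ => 0) := by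
  refine ⟨memLp_const y, memLp_const 0, by simp, by simpa using hf⟩

lemma integral_piecewise_of_le {v v' : ℝ → X} {a c t : ℝ} (hat : a ≤ t) (htc : t ≤ c) :
    ∫ r in a..t, (if r ≤ c then v r else v' r) = ∫ r in a..t, v r := by
  refine intervalIntegral.integral_congr fun r hr => ?_
  rw [uIcc_of_le hat] at hr
  simp [hr.2.trans htc]

lemma integral_piecewise_of_ge (hp : 1 ≤ p) {v v' : ℝ → X} {a b c t : ℝ} (hac : a ≤ c)
    (hct : c ≤ t) (htb : t ≤ b) (h : MemLp v p (iv a c)) (h' : MemLp v' p (iv c b)) :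
    ∫ r in a..t, (if r ≤ c then v r else v' r) = (∫ r in a..c, v r) + ∫ r in c..t, v' r := by
  have h2 := memLp_piecewise_iv h h'
  have ha : a ∈ Icc a b := ⟨le_rfl, by linarith⟩
  have hc : c ∈ Icc a b := ⟨hac, by linarith⟩
  rw [← intervalIntegral.integral_add_adjacent_intervals
    (intervalIntegrable_of_memLp hp h2 ha hc)
    (intervalIntegrable_of_memLp hp h2 hc ⟨by linarith, htb⟩), integral_piecewise_of_le hac le_rfl]
  congr 1
  refine intervalIntegral.integral_congr_ae (Eventually.of_forall fun r hr => ?_)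
  rw [uIoc_of_le hct] at hr
  simp [not_le.2 hr.1]

lemma Sol.concat (hp : 1 ≤ p) (hac : a ≤ c) (h : Sol ι B p a c x f u v)
    (h' : Sol ι B p c b (x + ∫ r in a..c, v r) f u' v') :
    Sol ι B p a b x f (fun t => if t ≤ c then u t else u' t)
      (fun t => if t ≤ c then v t else v' t) := by
  refine ⟨memLp_piecewise_iv h.memU h'.memU, memLp_piecewise_iv h.memV h'.memV, ?_, ?_⟩
  · refine ae_iv_split (c := c) ?_ ?_
    · filter_upwards [h.prim, ae_iv_mem a c] with t h1 ht
      rw [integral_piecewise_of_le ht.1.le ht.2.le, if_pos ht.2.le, h1]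
    · filter_upwards [h'.prim, ae_iv_mem c b] with t h1 ht
      rw [integral_piecewise_of_ge hp hac ht.1.le ht.2.le h.memV h'.memV, if_neg (not_le.2 ht.1),
        h1, add_assoc]
  · refine ae_iv_split (c := c) ?_ ?_
    · filter_upwards [h.eqn, ae_iv_mem a c] with t h1 ht
      simpa [ht.2.le] using h1
    · filter_upwards [h'.eqn, ae_iv_mem c b] with t h1 ht
      simpa [not_le.2 ht.1] using h1

/-- The extension by zero to the left of a solution with zero initial value. -/
lemma Sol.extend_left (hp : 1 ≤ p) (hac : a ≤ c) (h : Sol ι B p c b 0 f u v) :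
    Sol ι B p a b 0 (fun t => if t ≤ c then 0 else f t) (fun t => if t ≤ c then 0 else u t)
      (fun t => if t ≤ c then 0 else v t) := by
  have h0 : Sol ι B p a c 0 (fun t => if t ≤ c then 0 else f t) (fun _ => 0) (fun _ => 0) := by
    have := Sol.const (ι := ι) (B := B) (p := p) (a := a) (b := c) (0 : D)
      (fun t => if t ≤ c then 0 else f t) (by
        filter_upwards [ae_iv_mem a c] with t ht
        simp [ht.2.le])
    simpa using this
  refine h0.concat hp hac (f := fun t => if t ≤ c then 0 else f t) ?_
  simp only [intervalIntegral.integral_zero, add_zero]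
  refine h.congr ?_
  filter_upwards [ae_iv_mem c b] with t ht
  simp [not_le.2 ht.1]

lemma Sol.memLp_prim (hp : 1 ≤ p) (h : Sol ι B p a b x f u v) (q : ℝ≥0∞) :
    MemLp (fun t => x + ∫ r in a..t, v r) q (iv a b) := by
  rcases le_or_gt b a with hab | hab
  · have : iv a b = 0 := by simp [iv, Ioo_eq_empty (not_lt.2 hab)]
    rw [this]; exact ⟨aestronglyMeasurable_zero_measure _, by simp⟩
  · exact memLp_of_continuousOn (h.continuousOn hp hab.le)

/-- Solvability of `w' + B(t)w = f`, `w(a) = 0` in `MR_p(a,b)` for all `f ∈ L^p(a,b;X)`, with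
the estimate `‖w'‖_p, ‖w‖_{L^p(D)} ≤ C ‖f‖_p`. -/
structure WP (ι : D →L[ℝ] X) (B : ℝ → D →L[ℝ] X) (p : ℝ≥0∞) (a b : ℝ) (C : ℝ≥0) : Prop where
  exists_sol : ∀ f, MemLp f p (iv a b) → ∃ u v, Sol ι B p a b 0 f u v
  boundU : ∀ f u v, Sol ι B p a b 0 f u v → eLpNorm u p (iv a b) ≤ C * eLpNorm f p (iv a b)
  boundV : ∀ f u v, Sol ι B p a b 0 f u v → eLpNorm v p (iv a b) ≤ C * eLpNorm f p (iv a b)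

variable {C M : ℝ≥0}

lemma WP.mono (h : WP ι B p a b C) {C' : ℝ≥0} (hC : C ≤ C') : WP ι B p a b C' :=
  ⟨h.exists_sol, fun f u v hs => (h.boundU f u v hs).trans (by gcongr),
    fun f u v hs => (h.boundV f u v hs).trans (by gcongr)⟩

lemma Sol.ae_zero (hp : 1 ≤ p) (h : WP ι B p a b C) (hs : Sol ι B p a b 0 f u v)
    (hf : ∀ᵐ t ∂(iv a b), f t = 0) :
    (∀ᵐ t ∂(iv a b), u t = 0) ∧ ∀ᵐ t ∂(iv a b), v t = 0 := by
  have hp0 : p ≠ 0 := (zero_lt_one.trans_le hp).ne'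
  have hf0 : eLpNorm f p (iv a b) = 0 := eLpNorm_eq_zero_of_ae_zero hf
  have h1 := h.boundU _ _ _ hs
  have h2 := h.boundV _ _ _ hs
  rw [hf0, mul_zero, nonpos_iff_eq_zero] at h1 h2
  exact ⟨(eLpNorm_eq_zero_iff hs.memU.1 hp0).1 h1, (eLpNorm_eq_zero_iff hs.memV.1 hp0).1 h2⟩

lemma WP.unique (hp : 1 ≤ p) (h : WP ι B p a b C) (hs : Sol ι B p a b x f u v)
    (hs' : Sol ι B p a b x f' u' v') (hff : ∀ᵐ t ∂(iv a b), f t = f' t) :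
    (∀ᵐ t ∂(iv a b), u t = u' t) ∧ ∀ᵐ t ∂(iv a b), v t = v' t := by
  have h1 := hs.sub hp hs'
  rw [sub_self] at h1
  have h2 := h1.ae_zero hp h (by filter_upwards [hff] with t ht using by simp [ht])
  exact ⟨by filter_upwards [h2.1] with t ht using sub_eq_zero.1 ht,
    by filter_upwards [h2.2] with t ht using sub_eq_zero.1 ht⟩

lemma integral_congr_iv {a b t : ℝ} (hat : a ≤ t) (htb : t ≤ b) (h : ∀ᵐ r ∂(iv a b), v r = v' r) :
    ∫ r in a..t, v r = ∫ r in a..t, v' r := by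
  rw [intervalIntegral.integral_of_le hat, intervalIntegral.integral_of_le hat]
  refine integral_congr_ae ?_
  have := ae_iv_mono le_rfl htb h
  rwa [iv, Measure.restrict_congr_set Ioo_ae_eq_Ioc] at this

lemma WP.exists_iv (hp : 1 ≤ p) (h : WP ι B p a b C) (hB : OpBdd B M a b) (y : D)
    (hf : MemLp f p (iv a b)) : ∃ u v, Sol ι B p a b (ι y) f u v := by
  obtain ⟨u, v, hs⟩ := h.exists_sol (fun t => f t - B t y) (hf.sub (hB.memLp (memLp_const y)))
  have := (Sol.const (ι := ι) (B := B) (p := p) (a := a) (b := b) y (fun t => B t y)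
    (by simp)).add hp hs
  exact ⟨_, _, by simpa using this⟩

lemma Sol.sub_const (hp : 1 ≤ p) {y : D} (hs : Sol ι B p a b (ι y) f u v) :
    Sol ι B p a b 0 (fun t => f t - B t y) (fun t => u t - y) v := by
  have := hs.sub hp (Sol.const (ι := ι) (B := B) (p := p) (a := a) (b := b) y (fun t => B t y)
    (by simp))
  simpa using this

lemma Sol.enorm_prim_le (hp : 1 ≤ p) (hs : Sol ι B p a b 0 f u v) {t : ℝ} (hat : a ≤ t)
    (htb : t ≤ b) : ‖∫ r in a..t, v r‖ₑ
      ≤ ENNReal.ofReal (b - a) ^ (1 - 1 / p.toReal) * eLpNorm v p (iv a b) := by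
  rw [mul_comm]
  exact (enorm_integral_le_eLpNorm_one v hat).trans
      ((eLpNorm_iv_mono v le_rfl htb).trans (eLpNorm_one_le_iv hp hs.memV.1))

lemma Sol.eLpNorm_embed_le (hp : 1 ≤ p) (hp' : p ≠ ∞) (hs : Sol ι B p a b 0 f u v) :
    eLpNorm (fun t => ι (u t)) p (iv a b) ≤ ENNReal.ofReal (b - a) * eLpNorm v p (iv a b) := by
  refine le_trans (le_of_eq (eLpNorm_congr_ae ?_)) (eLpNorm_primitive_le hp hp' hs.memV.1)
  filter_upwards [hs.prim] with t ht
  simpa using ht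

/-- The absorption step of a priori estimates; finiteness of `G` is what allows the subtraction. -/
lemma le_two_mul_of_le_add_half {G F : ℝ≥0∞} (hG : G ≠ ∞) (h : G ≤ F + 2⁻¹ * G) : G ≤ 2 * F := by
  rcases eq_or_ne F ∞ with rfl | hF
  · simp
  lift G to ℝ≥0 using hG
  lift F to ℝ≥0 using hF
  have h1 : (2⁻¹ : ℝ≥0∞) = ((2⁻¹ : ℝ≥0) : ℝ≥0∞) := by simp
  rw [h1] at h
  have h2 : G ≤ F + 2⁻¹ * G := by exact_mod_cast h
  have h3 : (G : ℝ) ≤ F + 2⁻¹ * G := by exact_mod_cast h2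
  have : (G : ℝ) ≤ 2 * F := by linarith
  exact_mod_cast this

/-- Perturbation: if `‖(B - B₀)u‖_p ≤ ½‖g‖_p` for all solutions `u` of the unperturbed problem with
right-hand side `g`, the perturbed problem is well-posed. -/
lemma WP.perturb [CompleteSpace X] (hp : 1 ≤ p) {B₀ : ℝ → D →L[ℝ] X}
    (h : WP ι B₀ p a b C) {M₀ : ℝ≥0} (hB₀ : OpBdd B₀ M₀ a b) (hB : OpBdd B M a b)
    (hpert : ∀ g u v, Sol ι B₀ p a b 0 g u v →
      eLpNorm (fun t => (B t - B₀ t) (u t)) p (iv a b) ≤ 2⁻¹ * eLpNorm g p (iv a b)) :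
    WP ι B p a b (2 * C) := by
  have hR := hB.sub hB₀
  have key : ∀ f u v, Sol ι B p a b 0 f u v →
      ∃ g, Sol ι B₀ p a b 0 g u v ∧ eLpNorm g p (iv a b) ≤ 2 * eLpNorm f p (iv a b) := by
    intro f u v hs
    -- The same pair solves the unperturbed problem with g = v + B₀u, and g = f - (B - B₀)u. The
    -- perturbation term is at most ½‖g‖ and is absorbed, which produces the factor 2 in the
    -- constant.
    have h1 : Sol ι B₀ p a b 0 (fun t => v t + B₀ t (u t)) u v := hs.congr_op (by simp)
    refine ⟨_, h1, ?_⟩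
    have h2 := hpert _ _ _ h1
    have hg : MemLp (fun t => v t + B₀ t (u t)) p (iv a b) := hs.memV.add (hB₀.memLp hs.memU)
    set G := eLpNorm (fun t => v t + B₀ t (u t)) p (iv a b) with hG
    have hGf : G ≠ ∞ := hg.2.ne
    have hf : MemLp f p (iv a b) := by
      refine (hs.memV.add (hB.memLp hs.memU)).ae_eq ?_
      filter_upwards [hs.eqn] with t ht using ht
    have h3 : G ≤ eLpNorm f p (iv a b) + 2⁻¹ * G := by
      calc G ≤ eLpNorm (f - fun t => (B t - B₀ t) (u t)) p (iv a b) := by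
            refine le_of_eq (eLpNorm_congr_ae ?_)
            filter_upwards [hs.eqn] with t ht
            simp only [Pi.sub_apply, _root_.sub_apply, ← ht]; abel
        _ ≤ _ := eLpNorm_sub_le hf.1 (hR.memLp hs.memU).1 hp
        _ ≤ _ := by gcongr
    exact le_two_mul_of_le_add_half hGf h3
  refine ⟨?_, ?_, ?_⟩
  · intro f hf
    have : Fact (1 ≤ p) := ⟨hp⟩
    choose U V hUV using fun g : Lp X p (iv a b) => h.exists_sol g (Lp.memLp g)
    have hmem : ∀ g, MemLp (fun t => f t - (B t - B₀ t) (U g t)) p (iv a b) :=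
      fun g => hf.sub (hR.memLp (hUV g).memU)
    -- A fixed point g = f - (B - B₀)U(g) makes U(g) a solution of the perturbed problem. By
    -- linearity and `hpert` the map is a contraction with constant ½.
    let Φ : Lp X p (iv a b) → Lp X p (iv a b) := fun g => (hmem g).toLp _
    have hΦ : ContractingWith 2⁻¹ Φ := by
      refine ⟨by rw [← NNReal.coe_lt_coe]; norm_num, fun g g' => ?_⟩
      rw [Lp.edist_toLp_toLp, Lp.edist_def]
      have h1 := (hUV g).sub hp (hUV g')
      rw [sub_self] at h1
      have h2 := hpert _ _ _ h1
      rw [ENNReal.coe_inv two_ne_zero]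
      refine le_trans (le_of_eq ?_) h2
      rw [← eLpNorm_neg]
      congr 1
      ext t
      simp only [Pi.neg_apply, Pi.sub_apply, _root_.sub_apply, map_sub]
      abel
    obtain ⟨g, hg⟩ : ∃ g, Φ g = g := ⟨_, hΦ.fixedPoint_isFixedPt⟩
    refine ⟨U g, V g, (hUV g).congr_op ?_⟩
    have h1 : (g : ℝ → X) =ᵐ[iv a b] fun t => f t - (B t - B₀ t) (U g t) := by
      have := (hmem g).coeFn_toLp
      rw [show (hmem g).toLp _ = g from hg] at this
      exact this
    filter_upwards [(hUV g).eqn, h1] with t h2 h3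
    have : B t (U g t) = B₀ t (U g t) + (B t - B₀ t) (U g t) := by simp
    rw [this, ← add_assoc, h2, h3, sub_add_cancel]
  · intro f u v hs
    obtain ⟨g, h1, h2⟩ := key f u v hs
    refine (h.boundU _ _ _ h1).trans ?_
    calc _ ≤ C * (2 * eLpNorm f p (iv a b)) := by gcongr
      _ = _ := by push_cast; ring
  · intro f u v hs
    obtain ⟨g, h1, h2⟩ := key f u v hs
    refine (h.boundV _ _ _ h1).trans ?_
    calc _ ≤ C * (2 * eLpNorm f p (iv a b)) := by gcongr
      _ = _ := by push_cast; ring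

/-- Solutions are stable under `L^p`-convergence of all data. -/
lemma Sol.of_tendsto [CompleteSpace X] (hp : 1 ≤ p) (hB : OpBdd B M a b) {F : ℕ → ℝ → X}
    {U : ℕ → ℝ → D} {V : ℕ → ℝ → X} (hs : ∀ n, Sol ι B p a b x (F n) (U n) (V n))
    (hu : MemLp u p (iv a b)) (hv : MemLp v p (iv a b)) (hf : MemLp f p (iv a b))
    (hU : Tendsto (fun n => eLpNorm (U n - u) p (iv a b)) atTop (𝓝 0))
    (hV : Tendsto (fun n => eLpNorm (V n - v) p (iv a b)) atTop (𝓝 0))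
    (hF : Tendsto (fun n => eLpNorm (F n - f) p (iv a b)) atTop (𝓝 0)) :
    Sol ι B p a b x f u v := by
  have hp0 : p ≠ 0 := (zero_lt_one.trans_le hp).ne'
  have hFm : ∀ n, MemLp (F n) p (iv a b) := fun n => by
    refine ((hs n).memV.add (hB.memLp (hs n).memU)).ae_eq ?_
    filter_upwards [(hs n).eqn] with t ht using ht
  -- Three nested subsequences make the D-valued parts, the derivatives and the right-hand sides
  -- converge almost everywhere, so that both identities pass to the limit pointwise.
  obtain ⟨n1, hn1, h1⟩ := (tendstoInMeasure_of_tendsto_eLpNorm hp0 (fun n => (hs n).memU.1) hu.1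
    hU).exists_seq_tendsto_ae
  obtain ⟨n2, hn2, h2⟩ := (tendstoInMeasure_of_tendsto_eLpNorm hp0 (fun n => (hs (n1 n)).memV.1)
    hv.1 (hV.comp hn1.tendsto_atTop)).exists_seq_tendsto_ae
  obtain ⟨n3, hn3, h3⟩ := (tendstoInMeasure_of_tendsto_eLpNorm hp0
    (fun n => (hFm (n1 (n2 n))).1) hf.1
    ((hF.comp hn1.tendsto_atTop).comp hn2.tendsto_atTop)).exists_seq_tendsto_ae
  have hm := (hn1.tendsto_atTop.comp hn2.tendsto_atTop).comp hn3.tendsto_atTop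
  have hall : ∀ᵐ t ∂(iv a b), ∀ n, ι (U n t) = x + ∫ r in a..t, V n r :=
    ae_all_iff.2 fun n => (hs n).prim
  have hall' : ∀ᵐ t ∂(iv a b), ∀ n, V n t + B t (U n t) = F n t :=
    ae_all_iff.2 fun n => (hs n).eqn
  refine ⟨hu, hv, ?_, ?_⟩
  · filter_upwards [hall, h1, ae_iv_mem a b] with t ht h1 hm'
    have e : a ∈ Icc a b := ⟨le_rfl, by linarith [hm'.1, hm'.2]⟩
    have l1 : Tendsto (fun n => ι (U (n1 n) t)) atTop (𝓝 (ι (u t))) :=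
      (ι.continuous.tendsto _).comp h1
    have l2 : Tendsto (fun n => ∫ r in a..t, V n r) atTop (𝓝 (∫ r in a..t, v r)) := by
      rw [tendsto_iff_edist_tendsto_0]
      refine tendsto_of_tendsto_of_tendsto_of_le_of_le tendsto_const_nhds
        (g := fun _ => 0) (h := fun n => eLpNorm (V n - v) p (iv a b)
          * ENNReal.ofReal (b - a) ^ (1 - 1 / p.toReal)) ?_ (fun _ => bot_le) fun n => ?_
      · have h1p : 1 / p.toReal ≤ 1 := by
          rcases eq_or_ne p ∞ with rfl | hp'
          · simp
          · have : 1 ≤ p.toReal := by simpa using (ENNReal.toReal_le_toReal (by simp) hp').2 hp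
            rw [div_le_one (by linarith)]; exact this
        have := ENNReal.Tendsto.mul_const hV (b := ENNReal.ofReal (b - a) ^ (1 - 1 / p.toReal))
          (Or.inr (ENNReal.rpow_ne_top_of_nonneg (by linarith) (by simp)))
        simpa using this
      · rw [edist_eq_enorm_sub, ← intervalIntegral.integral_sub
          ((hs n).intervalIntegrable hp e (Ioo_subset_Icc_self hm'))
          (intervalIntegrable_of_memLp hp hv e (Ioo_subset_Icc_self hm'))]
        exact (enorm_integral_le_eLpNorm_one _ hm'.1.le).trans ((eLpNorm_iv_mono _ le_rfl
          hm'.2.le).trans (eLpNorm_one_le_iv hp ((hs n).memV.1.sub hv.1)))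
    have l3 := (tendsto_const_nhds (x := x)).add (l2.comp hn1.tendsto_atTop)
    refine tendsto_nhds_unique l1 (l3.congr fun n => ?_)
    rw [ht]; rfl
  · filter_upwards [hall', h1, h2, h3] with t ht h1 h2 h3
    have l1 := (h2.comp hn3.tendsto_atTop).add (((B t).continuous.tendsto _).comp
      (h1.comp (hn2.tendsto_atTop.comp hn3.tendsto_atTop)))
    refine tendsto_nhds_unique (l1.congr fun n => ?_) h3
    simp [ht]

end Solutions

end NonAutonomous

namespace NonAutonomous

/-! ### A priori estimates from solvability; uniform constants in the autonomous case. -/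

section ClosedGraph

set_option linter.unusedSectionVars false

open Filter Topology
open scoped NNReal

variable {X D : Type*} [NormedAddCommGroup X] [NormedAddCommGroup D]
  [NormedSpace ℝ X] [NormedSpace ℝ D] [CompleteSpace X] [CompleteSpace D] {ι : D →L[ℝ] X}
variable {B : ℝ → D →L[ℝ] X} {p : ℝ≥0∞} {a b : ℝ} {M : ℝ≥0}

/-- Unique solvability implies the a priori estimate, by the closed graph theorem. -/
lemma exists_WP (hp : 1 ≤ p) (hB : OpBdd B M a b)
    (hex : ∀ f, MemLp f p (iv a b) → ∃ u v, Sol ι B p a b 0 f u v)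
    (huniq : ∀ u v, Sol ι B p a b 0 (fun _ => 0) u v →
      (∀ᵐ t ∂(iv a b), u t = 0) ∧ ∀ᵐ t ∂(iv a b), v t = 0) :
    ∃ C, WP ι B p a b C := by
  have : Fact (1 ≤ p) := ⟨hp⟩
  have huniq' : ∀ {f f' u u' v v'}, Sol ι B p a b 0 f u v → Sol ι B p a b 0 f' u' v' →
      (∀ᵐ t ∂(iv a b), f t = f' t) → u =ᵐ[iv a b] u' ∧ v =ᵐ[iv a b] v' := by
    intro f f' u u' v v' h h' hff
    have h1 := (h.sub hp h').congr (f' := fun _ => 0)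
      (by filter_upwards [hff] with t ht using by simp [ht])
    rw [sub_self] at h1
    obtain ⟨h2, h3⟩ := huniq _ _ h1
    exact ⟨by filter_upwards [h2] with t ht using sub_eq_zero.1 ht,
      by filter_upwards [h3] with t ht using sub_eq_zero.1 ht⟩
  choose U V hUV using fun g : Lp X p (iv a b) => hex g (Lp.memLp g)
  let T : Lp X p (iv a b) →ₗ[ℝ] Lp D p (iv a b) × Lp X p (iv a b) :=
    { toFun := fun g => ((hUV g).memU.toLp _, (hUV g).memV.toLp _)
      map_add' := by
        intro g g'
        obtain ⟨h1, h2⟩ := huniq' (hUV (g + g')) (by simpa using (hUV g).add hp (hUV g'))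
          (by filter_upwards [Lp.coeFn_add g g'] with t ht using ht)
        ext1
        · exact MemLp.toLp_congr (hUV (g + g')).memU ((hUV g).memU.add (hUV g').memU) h1
        · exact MemLp.toLp_congr (hUV (g + g')).memV ((hUV g).memV.add (hUV g').memV) h2
      map_smul' := by
        intro k g
        obtain ⟨h1, h2⟩ := huniq' (hUV (k • g)) (by simpa using (hUV g).smul k)
          (by filter_upwards [Lp.coeFn_smul k g] with t ht using ht)
        ext1
        · exact MemLp.toLp_congr (hUV (k • g)).memU ((hUV g).memU.const_smul k) h1
        · exact MemLp.toLp_congr (hUV (k • g)).memV ((hUV g).memV.const_smul k) h2 }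
  have hT : Continuous T := by
    -- A limit of graph points is again a solution, with the limiting right-hand side; uniqueness
    -- identifies it with the value of T.
    refine T.continuous_of_seq_closed_graph fun g g₀ y hg hy => ?_
    have hy1 : Tendsto (fun n => (T (g n)).1) atTop (𝓝 y.1) :=
      (continuous_fst.tendsto y).comp hy
    have hy2 : Tendsto (fun n => (T (g n)).2) atTop (𝓝 y.2) :=
      (continuous_snd.tendsto y).comp hy
    rw [Lp.tendsto_Lp_iff_tendsto_eLpNorm'] at hg hy1 hy2
    have hs : Sol ι B p a b 0 g₀ y.1 y.2 := by
      refine Sol.of_tendsto hp hB (fun n => hUV (g n)) (Lp.memLp _) (Lp.memLp _) (Lp.memLp _)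
        (hy1.congr fun n => eLpNorm_congr_ae ?_) (hy2.congr fun n => eLpNorm_congr_ae ?_) hg
      · exact ((hUV (g n)).memU.coeFn_toLp).sub (ae_eq_refl _)
      · exact ((hUV (g n)).memV.coeFn_toLp).sub (ae_eq_refl _)
    obtain ⟨h1, h2⟩ := huniq' hs (hUV g₀) (ae_eq_refl _)
    ext1
    · exact Lp.ext (h1.trans (hUV g₀).memU.coeFn_toLp.symm)
    · exact Lp.ext (h2.trans (hUV g₀).memV.coeFn_toLp.symm)
  let T' : Lp X p (iv a b) →L[ℝ] Lp D p (iv a b) × Lp X p (iv a b) := ⟨T, hT⟩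
  have main : ∀ f u v, Sol ι B p a b 0 f u v →
      eLpNorm u p (iv a b) ≤ ‖T'‖ₑ * eLpNorm f p (iv a b) ∧
      eLpNorm v p (iv a b) ≤ ‖T'‖ₑ * eLpNorm f p (iv a b) := by
    intro f u v hs
    have hf : MemLp f p (iv a b) := by
      refine (hs.memV.add (hB.memLp hs.memU)).ae_eq ?_
      filter_upwards [hs.eqn] with t ht using ht
    obtain ⟨h1, h2⟩ := huniq' hs (hUV (hf.toLp f)) hf.coeFn_toLp.symm
    have h3 := T'.le_opENorm (hf.toLp f)
    have h4 : ‖hf.toLp f‖ₑ = eLpNorm f p (iv a b) := Lp.enorm_toLp _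
    rw [h4] at h3
    have h5 : ‖(T' (hf.toLp f)).1‖ₑ = eLpNorm u p (iv a b) := by
      rw [show (T' (hf.toLp f)).1 = (hUV (hf.toLp f)).memU.toLp _ from rfl, Lp.enorm_toLp]
      exact eLpNorm_congr_ae h1.symm
    have h6 : ‖(T' (hf.toLp f)).2‖ₑ = eLpNorm v p (iv a b) := by
      rw [show (T' (hf.toLp f)).2 = (hUV (hf.toLp f)).memV.toLp _ from rfl, Lp.enorm_toLp]
      exact eLpNorm_congr_ae h2.symm
    rw [← h5, ← h6]
    have hle : ∀ z : Lp D p (iv a b) × Lp X p (iv a b), ‖z.1‖ₑ ≤ ‖z‖ₑ ∧ ‖z.2‖ₑ ≤ ‖z‖ₑ :=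
      fun z => ⟨enorm_le_iff_norm_le.2 (norm_fst_le z), enorm_le_iff_norm_le.2 (norm_snd_le z)⟩
    exact ⟨(hle _).1.trans h3, (hle _).2.trans h3⟩
  exact ⟨‖T'‖₊, hex, fun f u v hs => (main f u v hs).1, fun f u v hs => (main f u v hs).2⟩

/-- Well-posedness of the autonomous problem on all intervals of length at most `h`, with a
uniform constant. -/
def AutWP (ι : D →L[ℝ] X) (B : D →L[ℝ] X) (p : ℝ≥0∞) (h : ℝ) (C : ℝ≥0) : Prop :=
  ∀ a b, a < b → b ≤ a + h → WP ι (fun _ => B) p a b C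

lemma measurePreserving_shift (a b s : ℝ) :
    MeasurePreserving (fun t => t + s) (iv (a - s) (b - s)) (iv a b) := by
  have := (measurePreserving_add_right (volume : Measure ℝ) s).restrict_preimage
    (measurableSet_Ioo (a := a) (b := b))
  simpa using this

lemma Sol.shift {B : D →L[ℝ] X} {x : X} {f v : ℝ → X} {u : ℝ → D}
    (h : Sol ι (fun _ => B) p a b x f u v) (s : ℝ) :
    Sol ι (fun _ => B) p (a - s) (b - s) x (fun t => f (t + s)) (fun t => u (t + s))
      (fun t => v (t + s)) := by
  have hm := measurePreserving_shift a b s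
  refine ⟨h.memU.comp_measurePreserving hm, h.memV.comp_measurePreserving hm, ?_,
    hm.quasiMeasurePreserving.ae h.eqn⟩
  filter_upwards [hm.quasiMeasurePreserving.ae h.prim] with t ht
  rw [ht, intervalIntegral.integral_comp_add_right]
  simp

/-- One constant serves all intervals of length at most h: translate to start at 0, extend f by zero
to (0,h), apply the estimate there and restrict. Restriction is harmless because the solution on a
shorter interval only sees f there. -/
lemma exists_autWP (hp : 1 ≤ p) {B : D →L[ℝ] X} {h : ℝ} (hh : 0 < h)
    (hex : ∀ a b, a < b → b ≤ a + h → ∀ f, MemLp f p (iv a b) →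
      ∃ u v, Sol ι (fun _ => B) p a b 0 f u v)
    (huniq : ∀ a b, a < b → b ≤ a + h → ∀ u v, Sol ι (fun _ => B) p a b 0 (fun _ => 0) u v →
      (∀ᵐ t ∂(iv a b), u t = 0) ∧ ∀ᵐ t ∂(iv a b), v t = 0) :
    ∃ C, AutWP ι B p h C := by
  obtain ⟨C, hC⟩ := exists_WP hp (OpBdd.const B 0 h) (hex 0 h hh (by simp))
    (huniq 0 h hh (by simp))
  have main : ∀ a b, a < b → b ≤ a + h → ∀ f u v, Sol ι (fun _ => B) p a b 0 f u v →
      eLpNorm u p (iv a b) ≤ C * eLpNorm f p (iv a b) ∧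
      eLpNorm v p (iv a b) ≤ C * eLpNorm f p (iv a b) := by
    intro a b hab hbh f u v hs
    have hm := measurePreserving_shift a b a
    have h1 := hs.shift a
    have hfm : MemLp f p (iv a b) := by
      refine (hs.memV.add ((OpBdd.const B a b).memLp hs.memU)).ae_eq ?_
      filter_upwards [hs.eqn] with t ht using ht
    have hfm' := hfm.comp_measurePreserving hm
    rw [sub_self] at h1 hm hfm'
    obtain ⟨u', v', hs'⟩ := hC.exists_sol _
      (memLp_extend_zero (a := 0) (b := h) hfm')
    have h2 := hs'.restrict_left hp (d := b - a) (by linarith) (by linarith)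
    -- This interval-dependent constant only serves to invoke uniqueness; it does not enter the
    -- estimate.
    obtain ⟨C', hC'⟩ := exists_WP hp (OpBdd.const B 0 (b - a)) (hex 0 (b - a) (by linarith)
      (by linarith)) (huniq 0 (b - a) (by linarith) (by linarith))
    obtain ⟨h3, h4⟩ := hC'.unique hp h1 h2 (by
      filter_upwards [ae_iv_mem 0 (b - a)] with t ht
      simp [indicator_of_mem ht])
    have e1 : eLpNorm u p (iv a b) = eLpNorm (fun t => u (t + a)) p (iv 0 (b - a)) :=
      (eLpNorm_comp_measurePreserving hs.memU.1 hm).symm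
    have e2 : eLpNorm v p (iv a b) = eLpNorm (fun t => v (t + a)) p (iv 0 (b - a)) :=
      (eLpNorm_comp_measurePreserving hs.memV.1 hm).symm
    have e3 : eLpNorm f p (iv a b) = eLpNorm (fun t => f (t + a)) p (iv 0 (b - a)) :=
      (eLpNorm_comp_measurePreserving hfm.1 hm).symm
    rw [e1, e2, e3, eLpNorm_congr_ae h3, eLpNorm_congr_ae h4]
    constructor
    · refine (eLpNorm_iv_mono u' le_rfl (by linarith)).trans ((hC.boundU _ _ _ hs').trans ?_)
      gcongr
      exact eLpNorm_extend_zero_le _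
    · refine (eLpNorm_iv_mono v' le_rfl (by linarith)).trans ((hC.boundV _ _ _ hs').trans ?_)
      gcongr
      exact eLpNorm_extend_zero_le _
  exact ⟨C, fun a b hab hbh => ⟨hex a b hab hbh, fun f u v hs => (main a b hab hbh f u v hs).1,
    fun f u v hs => (main a b hab hbh f u v hs).2⟩⟩

end ClosedGraph

/-! ### Passage between the X-valued formulation of the statement and solution pairs. -/

section Link

set_option linter.unusedSectionVars false

open Filter Topology
open scoped NNReal

variable {𝕜 X D : Type*} [RCLike 𝕜] [NormedAddCommGroup X] [NormedAddCommGroup D]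
  [NormedSpace 𝕜 X] [NormedSpace 𝕜 D]
  [NormedSpace ℝ X] [NormedSpace ℝ D] [IsScalarTower ℝ 𝕜 X] [IsScalarTower ℝ 𝕜 D]
  {ι : D →L[𝕜] X} {A : ℝ → D →L[𝕜] X} {a b p : ℝ} {f w : ℝ → X}

lemma toD_apply (hι : Function.Injective ι) (y : D) : toD ι (ι y) = y :=
  Function.leftInverse_invFun hι y

lemma apply_toD {y : X} (hy : y ∈ range ι) : ι (toD ι y) = y :=
  Function.invFun_eq hy

lemma IsSolution.exists_sol (h : IsSolution ι A p a b f w) :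
    ∃ v, Sol (ι.restrictScalars ℝ) (fun t => (A t).restrictScalars ℝ) (ENNReal.ofReal p) a b (w a)
      f (fun t => toD ι (w t)) v ∧ ∀ t ∈ Icc a b, w t = w a + ∫ r in a..t, v r := by
  obtain ⟨⟨h1, h2⟩, v, ⟨h3, h4⟩, h5⟩ := h
  refine ⟨v, ⟨h2, h3, ?_, h5⟩, h4⟩
  filter_upwards [h1, ae_iv_mem a b] with t ht ht'
  rw [← h4 t (Ioo_subset_Icc_self ht')]
  exact apply_toD ht

lemma Sol.isSolution (hι : Function.Injective ι) {x : X} {u : ℝ → D} {v : ℝ → X}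
    (h : Sol (ι.restrictScalars ℝ) (fun t => (A t).restrictScalars ℝ) (ENNReal.ofReal p) a b x f u v)
    (hab : a ≤ b) (hw : ∀ t ∈ Icc a b, w t = x + ∫ r in a..t, v r) :
    IsSolution ι A p a b f w := by
  have h1 : ∀ᵐ t ∂(iv a b), w t = ι (u t) := by
    filter_upwards [h.prim, ae_iv_mem a b] with t h1 ht
    rw [hw t (Ioo_subset_Icc_self ht), ← h1]; rfl
  have h2 : ∀ᵐ t ∂(iv a b), toD ι (w t) = u t := by
    filter_upwards [h1] with t h1
    rw [h1, toD_apply hι]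
  have hwa : w a = x := by simpa using hw a (left_mem_Icc.2 hab)
  refine ⟨⟨?_, ?_⟩, v, ⟨h.memV, ?_⟩, ?_⟩
  · filter_upwards [h1] with t ht using ht ▸ mem_range_self _
  · refine h.memU.ae_eq ?_
    filter_upwards [h2] with t h2 using h2.symm
  · rw [hwa]; exact hw
  · filter_upwards [h.eqn, h2] with t h3 h4
    rw [h4]; exact h3

lemma HasMaxRegLp.exists_autWP [CompleteSpace X] [CompleteSpace D] (hι : Function.Injective ι)
    {B : D →L[𝕜] X} (hp : 1 < p) (h : HasMaxRegLp ι B p) {δ : ℝ} (hδ : 0 < δ) :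
    ∃ C, AutWP (ι.restrictScalars ℝ) (B.restrictScalars ℝ) (ENNReal.ofReal p) δ C := by
  have hp1 : 1 ≤ ENNReal.ofReal p := by simpa using hp.le
  refine NonAutonomous.exists_autWP hp1 hδ ?_ ?_
  · intro a b hab _ f hf
    obtain ⟨w, ⟨h1, h2⟩, -⟩ := h a b hab f hf
    obtain ⟨v, h3, -⟩ := h1.exists_sol
    rw [h2] at h3
    exact ⟨_, v, h3⟩
  · intro a b hab _ u v hs
    obtain ⟨w, -, h2⟩ := h a b hab (fun _ => 0) (memLp_const 0)
    have h3 := h2 (fun t => 0 + ∫ r in a..t, v r)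
      (Sol.isSolution (A := fun _ => B) hι hs hab.le fun _ _ => rfl) (by simp)
    have h4 := h2 (fun t => 0) (by
      refine Sol.isSolution (A := fun _ => B) (u := fun _ => 0) (v := fun _ => 0) (x := 0) hι ?_
        hab.le (by simp)
      simpa using Sol.const (ι := ι.restrictScalars ℝ) (B := fun _ => B.restrictScalars ℝ)
        (p := ENNReal.ofReal p) (a := a) (b := b) 0 (fun _ => 0) (by simp)) rfl
    have hu : ∀ᵐ t ∂(iv a b), u t = 0 := by
      filter_upwards [hs.prim, ae_iv_mem a b] with t h5 ht
      have h6 := h3 (Ioo_subset_Icc_self ht)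
      have h7 := h4 (Ioo_subset_Icc_self ht)
      refine hι ?_
      rw [map_zero]
      exact h5.trans (h6.trans h7.symm)
    refine ⟨hu, ?_⟩
    filter_upwards [hu, hs.eqn] with t h5 h6
    simpa [h5] using h6

end Link

end NonAutonomous

namespace NonAutonomous

/-! ### Smoothing of autonomous orbits, from maximal regularity alone. -/

section Orbits

set_option linter.unusedSectionVars false

open Filter Topology
open scoped NNReal

variable {X D : Type*} [NormedAddCommGroup X] [NormedAddCommGroup D]
  [NormedSpace ℝ X] [NormedSpace ℝ D] [CompleteSpace X] [CompleteSpace D] {ι : D →L[ℝ] X}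

lemma integral_integral_eq {v : ℝ → X} {a t : ℝ} (hat : a ≤ t) (hv : IntegrableOn v (Ioc a t)) :
    ∫ r in a..t, ∫ s in a..r, v s = ∫ s in a..t, (t - s) • v s := by
  set m : Measure ℝ := volume.restrict (Ioc a t) with hm
  have hint : Integrable (Function.uncurry fun r s => (Iic r).indicator v s) (m.prod m) := by
    have h1 : Integrable (fun z : ℝ × ℝ => v z.2) (m.prod m) := Integrable.comp_snd hv m
    have h2 : (Function.uncurry fun r s => (Iic r).indicator v s)
        = {z : ℝ × ℝ | z.2 ≤ z.1}.indicator fun z => v z.2 := by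
      ext z; simp [Function.uncurry, indicator]
    rw [h2]
    exact h1.indicator (measurableSet_le measurable_snd measurable_fst)
  have h1 : ∫ r in a..t, ∫ s in a..r, v s = ∫ r, ∫ s, (Iic r).indicator v s ∂m ∂m := by
    rw [intervalIntegral.integral_of_le hat]
    refine setIntegral_congr_fun measurableSet_Ioc fun r hr => ?_
    rw [intervalIntegral.integral_of_le hr.1.le, integral_indicator measurableSet_Iic, hm,
      Measure.restrict_restrict measurableSet_Iic]
    congr 2
    ext s
    simp only [mem_Ioc, mem_inter_iff, mem_Iic]
    constructor
    · rintro ⟨h1, h2⟩; exact ⟨h2, h1, h2.trans hr.2⟩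
    · rintro ⟨h1, h2, -⟩; exact ⟨h2, h1⟩
  rw [h1, integral_integral_swap hint, intervalIntegral.integral_of_le hat]
  refine setIntegral_congr_fun measurableSet_Ioc fun s hs => ?_
  have h2 : (fun r => (Iic r).indicator v s) = (Ici s).indicator fun _ => v s := by
    ext r; simp [indicator]
  rw [h2, integral_indicator measurableSet_Ici, hm, Measure.restrict_restrict measurableSet_Ici]
  have h3 : Ici s ∩ Ioc a t = Icc s t := by
    ext r
    simp only [mem_Ioc, mem_inter_iff, mem_Ici, mem_Icc]
    constructor
    · rintro ⟨h1, _, h2⟩; exact ⟨h1, h2⟩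
    · rintro ⟨h1, h2⟩; exact ⟨h1, hs.1.trans_le h1, h2⟩
  rw [h3]
  simp [hs.2]

lemma opBdd_smul_id (X : Type*) [NormedAddCommGroup X] [NormedSpace ℝ X] (a b : ℝ) :
    OpBdd (fun t => (t - a) • ContinuousLinearMap.id ℝ X) (b - a).toNNReal a b := by
  refine ⟨fun x => ?_, fun t ht => ?_⟩
  · exact (by fun_prop : Continuous fun t : ℝ =>
      ((t - a) • ContinuousLinearMap.id ℝ X) x).aestronglyMeasurable
  · refine ContinuousLinearMap.opNorm_le_bound _ (by simp) fun x => ?_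
    have : (0 : ℝ) ≤ t - a := by linarith [ht.1]
    simp only [FunLike.coe_smul, ContinuousLinearMap.coe_id', Pi.smul_apply, id_eq,
      norm_smul, Real.norm_of_nonneg this]
    gcongr
    exact (by linarith [ht.2] : t - a ≤ b - a).trans (Real.le_coe_toNNReal _)

lemma memLp_sub_smul {p : ℝ≥0∞} {v : ℝ → X} {a b : ℝ} (h : MemLp v p (iv a b)) :
    MemLp (fun t => (t - a) • v t) p (iv a b) := by
  simpa using (opBdd_smul_id X a b).memLp h

/-- The product rule for (t-a)w(t) in integrated form; w is only the primitive of an L^p function,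
so it is obtained from Fubini instead of differentiation. -/
lemma sub_smul_prim {p : ℝ≥0∞} (hp : 1 ≤ p) {v : ℝ → X} {a b t : ℝ} (h : MemLp v p (iv a b))
    (ht : t ∈ Icc a b) (x : X) :
    (t - a) • (x + ∫ r in a..t, v r)
      = ∫ r in a..t, ((x + ∫ s in a..r, v s) + (r - a) • v r) := by
  have hv := memLp_iv_mono h le_rfl ht.2
  have e : a ∈ Icc a t := ⟨le_rfl, ht.1⟩
  have e' : t ∈ Icc a t := ⟨ht.1, le_rfl⟩
  have i1 : IntervalIntegrable (fun r => x + ∫ s in a..r, v s) volume a t := by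
    refine ContinuousOn.intervalIntegrable ?_
    rw [uIcc_of_le ht.1]
    exact continuousOn_const.add (continuousOn_primitive hp ht.1 hv)
  have i2 := intervalIntegrable_of_memLp hp (memLp_sub_smul hv) e e'
  have i0 := intervalIntegrable_of_memLp hp hv e e'
  have i3 : IntervalIntegrable (fun r => (t - r) • v r) volume a t := by
    have : (fun r => (t - r) • v r) = fun r => (t - a) • v r - (r - a) • v r := by
      ext r; rw [← sub_smul]; congr 1; ring
    rw [this]
    exact (i0.smul (t - a)).sub i2
  have i4 : IntervalIntegrable (fun r => ∫ s in a..r, v s) volume a t := by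
    refine ContinuousOn.intervalIntegrable ?_
    rw [uIcc_of_le ht.1]
    exact continuousOn_primitive hp ht.1 hv
  rw [intervalIntegral.integral_add i1 i2, intervalIntegral.integral_add (by simp) i4,
    integral_integral_eq ht.1 ((intervalIntegrable_iff_integrableOn_Ioc_of_le ht.1).1 i0), add_assoc,
    ← intervalIntegral.integral_add i3 i2, smul_add, intervalIntegral.integral_const]
  congr 1
  rw [← intervalIntegral.integral_smul]
  refine intervalIntegral.integral_congr fun r _ => ?_
  rw [← add_smul]; congr 1; ring

variable {p : ℝ≥0∞} {a b c h : ℝ} {x : X} {f v : ℝ → X} {u : ℝ → D} {C : ℝ≥0}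

/-- The weight t - a kills the initial value, so that the estimates for zero initial value apply;
the price is w itself as a new term on the right. -/
lemma Sol.sub_smul {B : ℝ → D →L[ℝ] X} (hp : 1 ≤ p) (hs : Sol ι B p a b x f u v) :
    Sol ι B p a b 0 (fun t => (x + ∫ r in a..t, v r) + (t - a) • f t) (fun t => (t - a) • u t)
      (fun t => (x + ∫ r in a..t, v r) + (t - a) • v t) := by
  refine ⟨memLp_sub_smul hs.memU, (hs.memLp_prim hp p).add (memLp_sub_smul hs.memV), ?_, ?_⟩
  · filter_upwards [hs.prim, ae_iv_mem a b] with t h1 ht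
    rw [map_smul, h1, zero_add, sub_smul_prim hp hs.memV (Ioo_subset_Icc_self ht)]
  · filter_upwards [hs.eqn] with t h1
    rw [← h1, map_smul, smul_add, add_assoc]

variable {B : D →L[ℝ] X}

/-- For constant B, integration in time commutes with the equation: the initial value becomes a
constant right-hand side and the new initial value is zero. All functions involved become
continuous, so the exponent q is free; this gives uniqueness at exponents other than p. -/
lemma Sol.integrate (hp : 1 ≤ p) (hs : Sol ι (fun _ => B) p a b x f u v) (q : ℝ≥0∞) :
    Sol ι (fun _ => B) q a b 0 (fun t => x + ∫ r in a..t, f r) (fun t => ∫ r in a..t, u r)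
      (fun t => x + ∫ r in a..t, v r) := by
  rcases le_or_gt b a with hab | hab
  · have : iv a b = 0 := by simp [iv, Ioo_eq_empty (not_lt.2 hab)]
    constructor <;> simp [this]
  have e : a ∈ Icc a b := ⟨le_rfl, hab.le⟩
  refine ⟨memLp_of_continuousOn (continuousOn_primitive hp hab.le hs.memU), hs.memLp_prim hp q,
    ae_iv_of_forall fun t ht => ?_, ae_iv_of_forall fun t ht => ?_⟩
  · have hu := intervalIntegrable_of_memLp hp hs.memU e (Ioo_subset_Icc_self ht)
    rw [← ι.intervalIntegral_comp_comm hu, zero_add]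
    exact integral_congr_iv ht.1.le ht.2.le hs.prim
  · have hu := intervalIntegrable_of_memLp hp hs.memU e (Ioo_subset_Icc_self ht)
    have hv := hs.intervalIntegrable hp e (Ioo_subset_Icc_self ht)
    have hBu : IntervalIntegrable (fun r => B (u r)) volume a t :=
      intervalIntegrable_of_memLp hp ((OpBdd.const B a b).memLp hs.memU) e (Ioo_subset_Icc_self ht)
    rw [← B.intervalIntegral_comp_comm hu, add_assoc, ← intervalIntegral.integral_add hv hBu,
      integral_congr_iv ht.1.le ht.2.le hs.eqn]

lemma enorm_sub_smul_le_of_eLpNorm_le (hp : 1 ≤ p) (hp' : p ≠ ∞) (hac : a ≤ c)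
    (hv : AEStronglyMeasurable v (iv a c)) {K : ℝ≥0∞}
    (hK : eLpNorm v p (iv a c) ≤ K * ENNReal.ofReal (c - a) ^ (1 / p.toReal)) :
    ‖∫ r in a..c, v r‖ₑ ≤ K * ENNReal.ofReal (c - a) := by
  refine (enorm_integral_le_eLpNorm_one v hac).trans ((eLpNorm_one_le_iv hp hv).trans ?_)
  calc _ ≤ (K * ENNReal.ofReal (c - a) ^ (1 / p.toReal))
        * ENNReal.ofReal (c - a) ^ (1 - 1 / p.toReal) := by gcongr
    _ = _ := by rw [mul_assoc, mul_comm (_ ^ _), rpow_mul_rpow_conj hp hp']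

/-- The orbit is the derivative of its own time integral, which solves the problem with the constant
right-hand side x and zero initial value. -/
lemma Sol.orbit_eLpNorm_le (hp : 1 ≤ p) (hB : AutWP ι B p h C) (hbh : b ≤ a + h)
    (hs : Sol ι (fun _ => B) p a b x (fun _ => 0) u v) (hac : a < c) (hcb : c ≤ b) :
    eLpNorm (fun t => x + ∫ r in a..t, v r) p (iv a c)
      ≤ C * ‖x‖ₑ * ENNReal.ofReal (c - a) ^ (1 / p.toReal) := by
  have h1 := (hs.restrict_left hp hac.le hcb).integrate hp p
  refine ((hB a c hac (by linarith)).boundV _ _ _ h1).trans ?_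
  rw [mul_assoc]
  gcongr
  exact eLpNorm_const_iv_le (by simp)

lemma Sol.orbit_sub_smul (hp : 1 ≤ p) (hs : Sol ι (fun _ => B) p a b x (fun _ => 0) u v) :
    Sol ι (fun _ => B) p a b 0 (fun t => x + ∫ r in a..t, v r) (fun t => (t - a) • u t)
      (fun t => (x + ∫ r in a..t, v r) + (t - a) • v t) :=
  (hs.sub_smul hp).congr (by simp)

lemma Sol.orbit_eLpNorm_deriv_le (hp : 1 ≤ p) (hB : AutWP ι B p h C) (hbh : b ≤ a + h)
    (hs : Sol ι (fun _ => B) p a b x (fun _ => 0) u v) (hac : a < c) (hcb : c ≤ b) :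
    eLpNorm (fun t => (x + ∫ r in a..t, v r) + (t - a) • v t) p (iv a c)
      ≤ C ^ 2 * ‖x‖ₑ * ENNReal.ofReal (c - a) ^ (1 / p.toReal) := by
  have h1 := (hs.orbit_sub_smul hp).restrict_left hp hac.le hcb
  refine ((hB a c hac (by linarith)).boundV _ _ _ h1).trans ?_
  rw [pow_two, mul_assoc, mul_assoc, ← mul_assoc (C : ℝ≥0∞) (‖x‖ₑ)]
  gcongr
  exact hs.orbit_eLpNorm_le hp hB hbh hac hcb

/-- (c-a)w(c) is the integral of the derivative of (t-a)w(t), whose L^p-norm is of order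
(c-a)^(1/p)‖x‖. Hölder contributes (c-a)^(1-1/p), and the factor c - a cancels. -/
lemma Sol.orbit_enorm_le (hp : 1 ≤ p) (hp' : p ≠ ∞) (hB : AutWP ι B p h C) (hbh : b ≤ a + h)
    (hs : Sol ι (fun _ => B) p a b x (fun _ => 0) u v) (hac : a < c) (hcb : c ≤ b) :
    ‖x + ∫ r in a..c, v r‖ₑ ≤ C ^ 2 * ‖x‖ₑ := by
  have h1 := (hs.orbit_sub_smul hp).restrict_left hp hac.le hcb
  have h2 := enorm_sub_smul_le_of_eLpNorm_le hp hp' hac.le h1.memV.1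
    (hs.orbit_eLpNorm_deriv_le hp hB hbh hac hcb)
  rw [← sub_smul_prim hp hs.memV ⟨hac.le, hcb⟩, enorm_smul, mul_comm,
    Real.enorm_of_nonneg (by linarith)] at h2
  exact (ENNReal.mul_le_mul_iff_left (by simpa using hac) (by simp)).1 h2

/-- The graph norm dominates the norm of `D`. -/
lemma AutWP.enorm_le (hp : 1 ≤ p) (hp' : p ≠ ∞) (hh : 0 < h) (hB : AutWP ι B p h C) (y : D) :
    ‖y‖ₑ * ENNReal.ofReal (h / 2) ≤ 2 * C * (‖ι y‖ₑ + ENNReal.ofReal h * ‖B y‖ₑ) := by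
  have hp1 : 1 ≤ p.toReal := by simpa using (ENNReal.toReal_le_toReal (by simp) hp').2 hp
  -- Test with w(t) = ty, which solves the problem with right-hand side y + tBy and zero initial
  -- value. On (h/2,h) it is at least (h/2)‖y‖ in D.
  have h1 := (Sol.const (ι := ι) (B := fun _ => B) (p := p) (a := 0) (b := h) y (fun _ => B y)
    (by simp)).sub_smul hp
  have h2 := (hB 0 h hh (by linarith)).boundU _ _ _ h1
  have h3 : eLpNorm (fun t => (ι y + ∫ r in (0 : ℝ)..t, (0 : X)) + (t - 0) • B y) p (iv 0 h)
      ≤ (‖ι y‖ₑ + ENNReal.ofReal h * ‖B y‖ₑ) * ENNReal.ofReal (h - 0) ^ (1 / p.toReal) := by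
    refine eLpNorm_const_iv_le (ae_iv_of_forall fun t ht => ?_)
    simp only [intervalIntegral.integral_zero, add_zero, sub_zero]
    refine (enorm_add_le _ _).trans ?_
    rw [enorm_smul, Real.enorm_of_nonneg ht.1.le]
    gcongr
    exact ht.2.le
  have h4 : ENNReal.ofReal (h / 2) * ‖y‖ₑ * ENNReal.ofReal (h / 2) ^ (1 / p.toReal)
      ≤ eLpNorm (fun t => (t - 0) • y) p (iv 0 h) := by
    refine le_trans ?_ (eLpNorm_iv_mono _ (c := h / 2) (d := h) (by linarith) le_rfl)
    calc _ = eLpNorm (fun _ : ℝ => (h / 2) • y) p (iv (h / 2) h) := by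
          rw [eLpNorm_const' _ (zero_lt_one.trans_le hp).ne' hp', iv_univ, enorm_smul,
            Real.enorm_of_nonneg (by linarith)]
          congr 3; ring
      _ ≤ _ := by
          refine eLpNorm_mono_ae (ae_iv_of_forall fun t ht => ?_)
          have : 0 < t := by linarith [ht.1]
          rw [norm_smul, norm_smul, Real.norm_of_nonneg (by linarith), Real.norm_of_nonneg
            (by linarith)]
          gcongr
          linarith [ht.1]
  have h5 : ENNReal.ofReal (h - 0) ^ (1 / p.toReal)
      ≤ 2 * ENNReal.ofReal (h / 2) ^ (1 / p.toReal) := by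
    have : h - 0 = 2 * (h / 2) := by ring
    rw [this, ENNReal.ofReal_mul (by norm_num), ENNReal.mul_rpow_of_nonneg _ _ (by positivity)]
    gcongr
    have h2' : ENNReal.ofReal 2 = 2 := by simp
    rw [h2']
    calc (2 : ℝ≥0∞) ^ (1 / p.toReal) ≤ 2 ^ (1 : ℝ) :=
          ENNReal.rpow_le_rpow_of_exponent_le (by norm_num)
            (by rw [div_le_one (by linarith)]; exact hp1)
      _ = 2 := by simp
  have h6 : (‖y‖ₑ * ENNReal.ofReal (h / 2)) * ENNReal.ofReal (h / 2) ^ (1 / p.toReal)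
      ≤ (2 * C * (‖ι y‖ₑ + ENNReal.ofReal h * ‖B y‖ₑ)) *
        ENNReal.ofReal (h / 2) ^ (1 / p.toReal) := by
    rw [mul_comm ‖y‖ₑ]
    refine h4.trans (h2.trans ?_)
    calc _ ≤ (C : ℝ≥0∞) * ((‖ι y‖ₑ + ENNReal.ofReal h * ‖B y‖ₑ)
            * (2 * ENNReal.ofReal (h / 2) ^ (1 / p.toReal))) := by
          gcongr; exact h3.trans (by gcongr)
      _ = _ := by ring
  refine (ENNReal.mul_le_mul_iff_left ?_ ?_).1 h6
  · simp [hh]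
  · exact ENNReal.rpow_ne_top_of_nonneg (by positivity) (by simp)

/-- Smoothing: orbits of the autonomous problem satisfy `(t-a)‖w(t)‖_D ≤ K‖x‖`. -/
lemma Sol.orbit_enorm_D_le (hp : 1 ≤ p) (hp' : p ≠ ∞) (hh : 0 < h) (hB : AutWP ι B p h C)
    (hab : a < b) (hbh : b ≤ a + h) (hs : Sol ι (fun _ => B) p a b x (fun _ => 0) u v) :
    ∀ᵐ t ∂(iv a b), ENNReal.ofReal (t - a) * ‖u t‖ₑ * ENNReal.ofReal (h / 2) ≤
      2 * C * (ENNReal.ofReal h * (C ^ 2 + (C ^ 2 + C * (2 * C ^ 2 + C)))) * ‖x‖ₑ := by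
  set W : ℝ → X := fun t => x + ∫ r in a..t, v r with hW
  set v1 : ℝ → X := fun t => W t + (t - a) • v t with hv1
  have s1 : Sol ι (fun _ => B) p a b 0 W (fun t => (t - a) • u t) v1 := hs.orbit_sub_smul hp
  have hWm : MemLp W p (iv a b) := hs.memLp_prim hp p
  have hP1 : ∀ t ∈ Icc a b, ∫ r in a..t, v1 r = (t - a) • W t := fun t ht =>
    (sub_smul_prim hp hs.memV ht x).symm
  -- The right-hand side is chosen so that integrating this solution gives the one obtained from
  -- (t-a)²u by subtracting the integral of (s-a)u. Both have right-hand side 2(t-a)W - ∫W, so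
  -- uniqueness yields (t-a)v1(t) = ∫v2. An L^p-bound on v2 thus becomes a pointwise bound on v1,
  -- and Bu is read off from the equation.
  obtain ⟨u2, v2, s2⟩ := (hB a b hab hbh).exists_sol (fun t => (v1 t + v1 t) - W t)
    ((s1.memV.add s1.memV).sub hWm)
  have s3 := (s1.sub_smul hp).sub hp (s1.integrate hp p)
  have s4 := s2.integrate hp p
  simp only [sub_self, zero_add] at s3 s4
  have e : a ∈ Icc a b := ⟨le_rfl, hab.le⟩
  have h1 := ((hB a b hab hbh).unique hp s3 s4 (by
    refine ae_iv_of_forall fun t ht => ?_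
    have ht' := Ioo_subset_Icc_self ht
    have i1 := s1.intervalIntegrable hp e ht'
    have i2 := intervalIntegrable_of_memLp hp hWm e ht'
    rw [intervalIntegral.integral_sub (i1.add i1) i2, intervalIntegral.integral_add i1 i1,
      hP1 t ht'])).2
  have hWb : ∀ t ∈ Ioc a b, ‖W t‖ₑ ≤ C ^ 2 * ‖x‖ₑ := fun t ht =>
    hs.orbit_enorm_le hp hp' hB hbh ht.1 ht.2
  have hP2 : ∀ t ∈ Ioc a b, ‖∫ r in a..t, v2 r‖ₑ
      ≤ C * (2 * C ^ 2 + C) * ‖x‖ₑ * ENNReal.ofReal (t - a) := by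
    intro t ht
    have s5 := s2.restrict_left hp ht.1.le ht.2
    refine enorm_sub_smul_le_of_eLpNorm_le hp hp' ht.1.le s5.memV.1 ?_
    refine ((hB a t ht.1 (by linarith [ht.2])).boundV _ _ _ s5).trans ?_
    have m1 := (memLp_iv_mono s1.memV le_rfl ht.2).1
    have n1 := hs.orbit_eLpNorm_deriv_le hp hB hbh ht.1 ht.2
    have n2 := hs.orbit_eLpNorm_le hp hB hbh ht.1 ht.2
    calc _ ≤ (C : ℝ≥0∞) * (eLpNorm v1 p (iv a t) + eLpNorm v1 p (iv a t)
            + eLpNorm W p (iv a t)) := by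
          gcongr
          refine (eLpNorm_sub_le (m1.add m1) (memLp_iv_mono hWm le_rfl ht.2).1 hp).trans ?_
          gcongr
          exact eLpNorm_add_le m1 m1 hp
      _ ≤ (C : ℝ≥0∞) * (C ^ 2 * ‖x‖ₑ * ENNReal.ofReal (t - a) ^ (1 / p.toReal)
            + C ^ 2 * ‖x‖ₑ * ENNReal.ofReal (t - a) ^ (1 / p.toReal)
            + C * ‖x‖ₑ * ENNReal.ofReal (t - a) ^ (1 / p.toReal)) := by gcongr
      _ = _ := by ring
  filter_upwards [h1, s1.eqn, s1.prim, ae_iv_mem a b] with t h1 h2 h3 ht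
  have ht' : t ∈ Ioc a b := ⟨ht.1, ht.2.le⟩
  have h4 : ‖v1 t‖ₑ ≤ C * (2 * C ^ 2 + C) * ‖x‖ₑ := by
    have h5 : (t - a) • v1 t = ∫ r in a..t, v2 r := by rw [← h1]; abel
    have h6 := hP2 t ht'
    rw [← h5, enorm_smul, Real.enorm_of_nonneg (by linarith [ht.1]), mul_comm] at h6
    exact (ENNReal.mul_le_mul_iff_left (by simpa using ht.1) (by simp)).1 h6
  have h5 : ‖B ((t - a) • u t)‖ₑ ≤ (C ^ 2 + C * (2 * C ^ 2 + C)) * ‖x‖ₑ := by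
    have : B ((t - a) • u t) = W t - v1 t := by rw [← h2]; abel
    rw [this, add_mul]
    exact enorm_sub_le.trans (add_le_add (hWb t ht') h4)
  have h6 : ‖ι ((t - a) • u t)‖ₑ ≤ ENNReal.ofReal h * (C ^ 2 * ‖x‖ₑ) := by
    rw [h3, zero_add, hP1 t (Ioo_subset_Icc_self ht), enorm_smul,
      Real.enorm_of_nonneg (by linarith [ht.1])]
    gcongr
    · linarith [ht.2]
    · exact hWb t ht'
  have h7 := hB.enorm_le hp hp' hh ((t - a) • u t)
  rw [enorm_smul, Real.enorm_of_nonneg (by linarith [ht.1])] at h7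
  refine h7.trans ?_
  calc _ ≤ 2 * (C : ℝ≥0∞) * (ENNReal.ofReal h * (C ^ 2 * ‖x‖ₑ)
        + ENNReal.ofReal h * ((C ^ 2 + C * (2 * C ^ 2 + C)) * ‖x‖ₑ)) := by gcongr
    _ = _ := by ring

end Orbits

end NonAutonomous

namespace NonAutonomous

/-! ### Decay of solutions away from a mean-zero right-hand side. -/

section Tail

set_option linter.unusedSectionVars false

open Filter Topology
open scoped NNReal

variable {X D : Type*} [NormedAddCommGroup X] [NormedAddCommGroup D]
  [NormedSpace ℝ X] [NormedSpace ℝ D] [CompleteSpace X] [CompleteSpace D] {ι : D →L[ℝ] X}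

/-- Dyadic summation. On the piece from d + r to d + 2r the weight is at least r², so the integral
is at most 2K/r; the remaining tail starts at 2r and contributes 4K/(2r) by induction. The number n
bounds how many doublings exhaust the interval. -/
lemma lintegral_tail_le {φ : ℝ → ℝ≥0∞} {K : ℝ≥0∞} {d β : ℝ}
    (H : ∀ e ∈ Ioc d β, ∫⁻ t in Ioo d e, ENNReal.ofReal ((t - d) ^ 2) * φ t
      ≤ K * ENNReal.ofReal (e - d)) (n : ℕ) :
    ∀ r : ℝ, 0 < r → β - d ≤ 2 ^ n * r →
      ∫⁻ t in Ioo (d + r) β, φ t ≤ 4 * K * (ENNReal.ofReal r)⁻¹ := by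
  induction n with
  | zero =>
    intro r hr h
    rw [Ioo_eq_empty (by linarith)]; simp
  | succ n ih =>
    intro r hr h
    rcases le_or_gt β (d + r) with hβ | hβ
    · rw [Ioo_eq_empty (by linarith)]; simp
    have hr0 : ENNReal.ofReal r ≠ 0 := by simpa using hr
    have h1 : Ioo (d + r) β ⊆ Ioc (d + r) (min β (d + 2 * r)) ∪ Ioo (d + 2 * r) β := by
      intro t ht
      rcases le_or_gt t (d + 2 * r) with h' | h'
      · exact Or.inl ⟨ht.1, le_min ht.2.le h'⟩
      · exact Or.inr ⟨h', ht.2⟩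
    set e := min β (d + 2 * r) with he
    have hde : d < e := lt_min (by linarith) (by linarith)
    have h2 : ∫⁻ t in Ioc (d + r) e, φ t ≤ 2 * K * (ENNReal.ofReal r)⁻¹ := by
      have h3 : ∫⁻ t in Ioo (d + r) e, ENNReal.ofReal r ^ 2 * φ t ≤ K * ENNReal.ofReal (2 * r) := by
        calc _ ≤ ∫⁻ t in Ioo (d + r) e, ENNReal.ofReal ((t - d) ^ 2) * φ t := by
              refine setLIntegral_mono' measurableSet_Ioo fun t ht => ?_
              rw [← ENNReal.ofReal_pow hr.le]
              gcongr
              linarith [ht.1]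
          _ ≤ ∫⁻ t in Ioo d e, ENNReal.ofReal ((t - d) ^ 2) * φ t :=
              lintegral_mono_set (Ioo_subset_Ioo (by linarith) le_rfl)
          _ ≤ K * ENNReal.ofReal (e - d) := H e ⟨hde, min_le_left _ _⟩
          _ ≤ _ := by
              gcongr
              linarith [min_le_right β (d + 2 * r)]
      rw [lintegral_const_mul' _ _ (by simp)] at h3
      rw [setLIntegral_congr Ioo_ae_eq_Ioc.symm]
      have h4 : ENNReal.ofReal r ^ 2 * ∫⁻ t in Ioo (d + r) e, φ t
          ≤ ENNReal.ofReal r ^ 2 * (2 * K * (ENNReal.ofReal r)⁻¹) := by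
        refine h3.trans (le_of_eq ?_)
        rw [ENNReal.ofReal_mul (by norm_num)]
        calc _ = 2 * K * ENNReal.ofReal r * 1 := by simp; ring
          _ = 2 * K * ENNReal.ofReal r * (ENNReal.ofReal r * (ENNReal.ofReal r)⁻¹) := by
            rw [ENNReal.mul_inv_cancel hr0 (by simp)]
          _ = _ := by ring
      exact (ENNReal.mul_le_mul_iff_right (by simpa using hr0) (by finiteness)).1 h4
    calc _ ≤ (∫⁻ t in Ioc (d + r) e, φ t) + ∫⁻ t in Ioo (d + 2 * r) β, φ t :=
          (lintegral_mono_set h1).trans (lintegral_union_le _ _ _)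
      _ ≤ 2 * K * (ENNReal.ofReal r)⁻¹ + 4 * K * (ENNReal.ofReal (2 * r))⁻¹ := by
          gcongr
          exact ih (2 * r) (by linarith) (by rw [pow_succ] at h; linarith)
      _ = _ := by
          have h4 : (4 : ℝ≥0∞) * 2⁻¹ = 2 := by
            rw [show (4 : ℝ≥0∞) = 2 * 2 by norm_num, mul_assoc,
              ENNReal.mul_inv_cancel (by simp) (by simp), mul_one]
          rw [ENNReal.ofReal_mul (by norm_num), ENNReal.mul_inv (by simp) (by simp)]
          simp only [ENNReal.ofReal_ofNat]
          calc _ = 2 * K * (ENNReal.ofReal r)⁻¹ + (4 * 2⁻¹) * K * (ENNReal.ofReal r)⁻¹ := by ring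
            _ = _ := by rw [h4]; ring

variable {p : ℝ≥0∞} {h : ℝ} {f v : ℝ → X} {u : ℝ → D} {C : ℝ≥0} {B : D →L[ℝ] X}

/-- Decay away from the support of a right-hand side with mean zero. -/
lemma Sol.lintegral_tail_le (hp : 1 ≤ p) (hp' : p ≠ ∞) (hB : AutWP ι B p h C) {c d β : ℝ}
    (hcd : c < d) (hdβ : d ≤ β) (hβ : β ≤ c + h)
    (hs : Sol ι (fun _ => B) p c β 0 f u v) (hf : ∀ᵐ t ∂(iv d β), f t = 0)
    (hf0 : ∫ r in c..d, f r = 0) (hfm : MemLp f p (iv c β)) :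
    ∫⁻ t in Ioo (d + (d - c)) β, ‖v t‖ₑ
      ≤ 4 * ((2 * C + 2) * (C + C ^ 2) * C) * eLpNorm f 1 (iv c d) := by
  have ec : c ∈ Icc c β := ⟨le_rfl, by linarith⟩
  have ed : d ∈ Icc c β := ⟨hcd.le, hdβ⟩
  set F := eLpNorm f 1 (iv c d) with hF
  have I := hs.integrate hp p
  simp only [zero_add] at I
  set W : ℝ → X := fun t => ∫ r in c..t, v r with hW
  set x : X := ∫ r in c..d, W r with hx
  have hxb : ‖x‖ₑ ≤ C * F * ENNReal.ofReal (d - c) := by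
    have I1 := I.restrict_left hp hcd.le hdβ
    refine enorm_sub_smul_le_of_eLpNorm_le hp hp' hcd.le I1.memV.1 ?_
    refine ((hB c d hcd (by linarith)).boundV _ _ _ I1).trans ?_
    rw [mul_assoc]
    gcongr
    refine eLpNorm_const_iv_le (ae_iv_of_forall fun t ht => ?_)
    exact (enorm_integral_le_eLpNorm_one f ht.1.le).trans (eLpNorm_iv_mono f le_rfl ht.2.le)
  -- Mean zero makes ∫f vanish beyond d, so the integrated solution is a homogeneous orbit there.
  -- Its initial value x has size at most C‖f‖₁(d-c), and v is its second derivative.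
  have I2 : Sol ι (fun _ => B) p d β x (fun _ => 0) (fun t => ∫ r in c..t, u r) W := by
    have := I.restrict hp hcd.le hdβ le_rfl
    rw [zero_add] at this
    refine this.congr (ae_iv_of_forall fun t ht => ?_)
    have et : t ∈ Icc c β := ⟨by linarith [ht.1], ht.2.le⟩
    rw [← intervalIntegral.integral_add_adjacent_intervals
      (intervalIntegrable_of_memLp hp hfm ec ed) (intervalIntegrable_of_memLp hp hfm ed et), hf0,
      integral_congr_iv ht.1.le ht.2.le hf]
    simp
  set y : X := 0 + ∫ r in c..d, v r with hy
  have S2 : Sol ι (fun _ => B) p d β y (fun _ => 0) u v :=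
    (hs.restrict hp hcd.le hdβ le_rfl).congr hf
  set P : ℝ → X := fun t => y + ∫ r in d..t, v r with hP
  have hPW : ∀ t ∈ Icc d β, P t = W t := by
    intro t ht
    have et : t ∈ Icc c β := ⟨by linarith [ht.1], ht.2⟩
    rw [hP, hW, hy]
    simp only [zero_add]
    exact intervalIntegral.integral_add_adjacent_intervals (hs.intervalIntegrable hp ec ed)
      (hs.intervalIntegrable hp ed et)
  have S3 := S2.orbit_sub_smul hp
  have S4 := S3.sub_smul hp
  have hQ : ∀ t ∈ Icc d β, ∫ r in d..t, (P r + (r - d) • v r) = (t - d) • P t := fun t ht =>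
    (sub_smul_prim hp S2.memV ht y).symm
  have hPm : MemLp P p (iv d β) := S2.memLp_prim hp p
  refine (NonAutonomous.lintegral_tail_le (d := d) (β := β) (φ := fun t => ‖v t‖ₑ)
    (K := (2 * C + 2) * (C + C ^ 2) * ‖x‖ₑ)
    ?_ (Nat.ceil ((β - d) / (d - c))) (d - c) (by linarith) ?_).trans ?_
  · intro e he
    have hee : ∀ {g : ℝ → X}, MemLp g p (iv d β) → AEStronglyMeasurable g (iv d e) := fun hg =>
      (memLp_iv_mono hg le_rfl he.2).1
    have n1 := I2.orbit_eLpNorm_le hp hB (by linarith) he.1 he.2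
    have n2 := I2.orbit_eLpNorm_deriv_le hp hB (by linarith) he.1 he.2
    set L := ENNReal.ofReal (e - d) ^ (1 / p.toReal) with hL
    have n3 : eLpNorm (fun t => (t - d) • P t) p (iv d e) ≤ (C + C ^ 2) * ‖x‖ₑ * L := by
      calc _ = eLpNorm ((fun t => (x + ∫ r in d..t, W r) + (t - d) • W t)
            - fun t => x + ∫ r in d..t, W r) p (iv d e) := by
            refine eLpNorm_congr_ae (ae_iv_of_forall fun t ht => ?_)
            simp [hPW t ⟨ht.1.le, ht.2.le.trans he.2⟩]
        _ ≤ C ^ 2 * ‖x‖ₑ * L + C * ‖x‖ₑ * L := by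
            refine (eLpNorm_sub_le (hee (I2.orbit_sub_smul hp).memV) (hee (I2.memLp_prim hp p))
              hp).trans ?_
            gcongr
        _ = _ := by ring
    have n4 : eLpNorm (fun t => (t - d) • P t + (t - d) • P t) p (iv d e)
        ≤ 2 * ((C + C ^ 2) * ‖x‖ₑ * L) := by
      refine (eLpNorm_add_le (hee (memLp_sub_smul hPm)) (hee (memLp_sub_smul hPm)) hp).trans ?_
      rw [two_mul]
      gcongr
    have S5 := S4.restrict_left hp he.1.le he.2
    have n5 := (hB d e he.1 (by linarith [he.2])).boundV _ _ _ S5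
    -- (t-d)²u solves the problem with right-hand side 2(t-d)P and has derivative 2(t-d)P + (t-d)²v.
    -- Since P = W on this range, (t-d)P was bounded in `n3` by the first-order smoothing of the
    -- integrated orbit; this bounds (t-d)²v.
    have n6 : eLpNorm (fun t => (t - d) • (t - d) • v t) p (iv d e)
        ≤ (2 * C + 2) * (C + C ^ 2) * ‖x‖ₑ * L := by
      calc _ = eLpNorm ((fun t => (0 + ∫ r in d..t, ((y + ∫ r in d..r, v r) + (r - d) • v r))
              + (t - d) • ((y + ∫ r in d..t, v r) + (t - d) • v t))
            - fun t => (t - d) • P t + (t - d) • P t) p (iv d e) := by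
            refine eLpNorm_congr_ae (ae_iv_of_forall fun t ht => ?_)
            have := hQ t ⟨ht.1.le, ht.2.le.trans he.2⟩
            simp only [hP] at this
            simp only [Pi.sub_apply, hP, zero_add, this, smul_add]
            abel
        _ ≤ C * (2 * ((C + C ^ 2) * ‖x‖ₑ * L)) + 2 * ((C + C ^ 2) * ‖x‖ₑ * L) := by
            refine (eLpNorm_sub_le S5.memV.1
              (hee ((memLp_sub_smul hPm).add (memLp_sub_smul hPm))) hp).trans ?_
            refine add_le_add (n5.trans ?_) n4
            gcongr
            refine le_trans (le_of_eq (eLpNorm_congr_ae (ae_iv_of_forall fun t ht => ?_))) n4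
            have := hQ t ⟨ht.1.le, ht.2.le.trans he.2⟩
            simp only [hP] at this
            simp only [hP, zero_add, this]
        _ = _ := by ring
    have m6 := hee (memLp_sub_smul (memLp_sub_smul S2.memV))
    have n7 := eLpNorm_one_le_iv hp m6
    rw [eLpNorm_one_eq_lintegral_enorm] at n7
    calc _ = ∫⁻ t in Ioo d e, ‖(t - d) • (t - d) • v t‖ₑ := by
          refine lintegral_congr fun t => ?_
          rw [smul_smul, enorm_smul, ← pow_two, Real.enorm_of_nonneg (by positivity)]
      _ ≤ _ := n7
      _ ≤ ((2 * C + 2) * (C + C ^ 2) * ‖x‖ₑ * L) * ENNReal.ofReal (e - d) ^ (1 - 1 / p.toReal) := by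
          gcongr
      _ = _ := by rw [mul_assoc, hL, mul_comm (_ ^ _), rpow_mul_rpow_conj hp hp']
  · have h1 : (β - d) / (d - c) ≤ (2 : ℝ) ^ (Nat.ceil ((β - d) / (d - c))) := by
      refine (Nat.le_ceil _).trans ?_
      exact_mod_cast (Nat.lt_two_pow_self).le
    rwa [div_le_iff₀ (by linarith)] at h1
  · have hr0 : ENNReal.ofReal (d - c) ≠ 0 := by simpa using hcd
    calc _ ≤ 4 * ((2 * C + 2) * (C + C ^ 2) * (C * F * ENNReal.ofReal (d - c)))
          * (ENNReal.ofReal (d - c))⁻¹ := by gcongr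
      _ = 4 * ((2 * C + 2) * (C + C ^ 2) * C) * F
          * (ENNReal.ofReal (d - c) * (ENNReal.ofReal (d - c))⁻¹) := by ring
      _ = _ := by rw [ENNReal.mul_inv_cancel hr0 (by simp), mul_one]

end Tail

end NonAutonomous

namespace NonAutonomous

/-! ### Calderón–Zygmund decomposition on an interval and the distributional estimate. -/

section CalderonZygmund

set_option linter.unusedSectionVars false

open Filter Topology
open scoped NNReal

variable {X : Type*} [NormedAddCommGroup X] [NormedSpace ℝ X] [CompleteSpace X]

/-- Dyadic stopping-time selection at height `r` on `(c,d]`, for a function whose oscillation on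
intervals of length `2⁻ⁿ(d-c)` is at most `ε`. -/
lemma exists_stopping_intervals {f : ℝ → X} (hf : Continuous f) {r ε : ℝ} (n : ℕ) :
    ∀ c d : ℝ, c < d → (∀ s ∈ Ioc c d, ∀ t ∈ Ioc c d, |s - t| ≤ (d - c) / 2 ^ n → ‖f s - f t‖ ≤ ε) →
      ∫ t in c..d, ‖f t‖ ≤ r * (d - c) →
      ∃ J : Finset (ℝ × ℝ), (∀ I ∈ J, c ≤ I.1 ∧ I.1 < I.2 ∧ I.2 ≤ d) ∧
        ((J : Set (ℝ × ℝ)).PairwiseDisjoint fun I => Ioc I.1 I.2) ∧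
        (∀ I ∈ J, r * (I.2 - I.1) ≤ ∫ t in I.1..I.2, ‖f t‖ ∧
          ∫ t in I.1..I.2, ‖f t‖ ≤ 2 * r * (I.2 - I.1)) ∧
        ∀ t ∈ Ioc c d, (∀ I ∈ J, t ∉ Ioc I.1 I.2) → ‖f t‖ ≤ r + ε := by
  induction n with
  | zero =>
    intro c d hcd hosc hr
    refine ⟨∅, by simp, by simp, by simp, fun t ht _ => ?_⟩
    -- At the finest scale f varies by at most ε, so each value exceeds the mean of ‖f‖, hence r, by
    -- at most ε. This replaces Lebesgue differentiation.
    have h1 : ∫ s in c..d, (‖f t‖ - ε) ≤ ∫ s in c..d, ‖f s‖ := by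
      refine intervalIntegral.integral_mono_on_of_le_Ioo hcd.le (by simp)
        (hf.norm.intervalIntegrable _ _) fun s hs => ?_
      have h2 := hosc t ht s ⟨hs.1, hs.2.le⟩ (by
        rw [abs_le]; constructor <;> simp <;> linarith [hs.1, hs.2, ht.1, ht.2])
      have h3 : ‖f t‖ ≤ ‖f t - f s‖ + ‖f s‖ := norm_le_norm_sub_add _ _
      linarith
    rw [intervalIntegral.integral_const, smul_eq_mul] at h1
    have h2 : (d - c) * (‖f t‖ - ε) ≤ (d - c) * r := by linarith
    have := le_of_mul_le_mul_left h2 (by linarith)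
    linarith
  | succ n ih =>
    intro c d hcd hosc hr
    have half : ∀ c' d' : ℝ, c ≤ c' → d' ≤ d → d' - c' = (d - c) / 2 →
        ∃ J : Finset (ℝ × ℝ), (∀ I ∈ J, c' ≤ I.1 ∧ I.1 < I.2 ∧ I.2 ≤ d') ∧
        ((J : Set (ℝ × ℝ)).PairwiseDisjoint fun I => Ioc I.1 I.2) ∧
        (∀ I ∈ J, r * (I.2 - I.1) ≤ ∫ t in I.1..I.2, ‖f t‖ ∧
          ∫ t in I.1..I.2, ‖f t‖ ≤ 2 * r * (I.2 - I.1)) ∧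
        ∀ t ∈ Ioc c' d', (∀ I ∈ J, t ∉ Ioc I.1 I.2) → ‖f t‖ ≤ r + ε := by
      intro c' d' hc hd hl
      -- If the mean on the half is at most r, continue with it. Otherwise stop: its mean is at most
      -- 2r, because the parent has mean at most r and twice the length.
      rcases le_total (∫ t in c'..d', ‖f t‖) (r * (d' - c')) with h | h
      · refine ih c' d' (by linarith) (fun s hs t ht hst => ?_) h
        refine hosc s ⟨hc.trans_lt hs.1, hs.2.trans hd⟩ t ⟨hc.trans_lt ht.1, ht.2.trans hd⟩ ?_
        rwa [pow_succ, mul_comm, ← div_div, ← hl]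
      · refine ⟨{(c', d')}, ?_, by simp, ?_, ?_⟩
        · simp only [Finset.mem_singleton]
          rintro I rfl
          exact ⟨le_rfl, by simp; linarith, le_rfl⟩
        · simp only [Finset.mem_singleton]
          rintro I rfl
          refine ⟨h, ?_⟩
          simp only
          calc ∫ t in c'..d', ‖f t‖ ≤ ∫ t in c..d, ‖f t‖ :=
                intervalIntegral.integral_mono_interval hc (by linarith) hd
                  (Eventually.of_forall fun t => norm_nonneg _) (hf.norm.intervalIntegrable _ _)
            _ ≤ r * (d - c) := hr
            _ = _ := by rw [hl]; ring
        · intro t ht h'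
          exact absurd ht (h' (c', d') (by simp))
    obtain ⟨J1, a1, b1, c1, d1⟩ := half c ((c + d) / 2) le_rfl (by linarith) (by ring)
    obtain ⟨J2, a2, b2, c2, d2⟩ := half ((c + d) / 2) d (by linarith) le_rfl (by ring)
    classical
    refine ⟨J1 ∪ J2, ?_, ?_, ?_, ?_⟩
    · intro I hI
      rcases Finset.mem_union.1 hI with h | h
      · exact ⟨(a1 I h).1, (a1 I h).2.1, (a1 I h).2.2.trans (by linarith)⟩
      · exact ⟨le_trans (by linarith) (a2 I h).1, (a2 I h).2.1, (a2 I h).2.2⟩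
    · rw [Finset.coe_union]
      refine (pairwiseDisjoint_union).2 ⟨b1, b2, fun I hI I' hI' _ => ?_⟩
      refine Set.disjoint_left.2 ?_
      rintro t ⟨-, h1⟩ ⟨h2, -⟩
      linarith [(a1 I hI).2.2, (a2 I' hI').1]
    · intro I hI
      rcases Finset.mem_union.1 hI with h | h
      · exact c1 I h
      · exact c2 I h
    · intro t ht h'
      rcases le_or_gt t ((c + d) / 2) with h | h
      · exact d1 t ⟨ht.1, h⟩ fun I hI => h' I (Finset.mem_union_left _ hI)
      · exact d2 t ⟨h, ht.2⟩ fun I hI => h' I (Finset.mem_union_right _ hI)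

/-- A linear operator on `L^p(α,β;X)`, bounded by `C`, whose values on functions supported in
`(c,d]` with mean zero are integrable away from the doubled interval. -/
structure CZOperator (T : (ℝ → X) → ℝ → X) (p : ℝ) (α β : ℝ) (C K : ℝ≥0) : Prop where
  meas : ∀ f, MemLp f (ENNReal.ofReal p) (iv α β) → AEStronglyMeasurable (T f) (iv α β)
  add : ∀ f g, MemLp f (ENNReal.ofReal p) (iv α β) → MemLp g (ENNReal.ofReal p) (iv α β) →
    ∀ᵐ t ∂(iv α β), T (fun t => f t + g t) t = T f t + T g t
  bound : ∀ f, MemLp f (ENNReal.ofReal p) (iv α β) →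
    eLpNorm (T f) (ENNReal.ofReal p) (iv α β) ≤ C * eLpNorm f (ENNReal.ofReal p) (iv α β)
  tail : ∀ c d f, α ≤ c → c < d → d ≤ β → Continuous f → ∫ t in c..d, f t = 0 →
    ∫⁻ t in Ioo α β \ Ioo c (d + (d - c)), ‖T ((Ioc c d).indicator f) t‖ₑ
      ≤ K * eLpNorm f 1 (iv c d)

variable {T : (ℝ → X) → ℝ → X} {p α β : ℝ} {C K : ℝ≥0}

lemma CZOperator.sum (hT : CZOperator T p α β C K) {κ : Type*} (s : Finset κ) (b : κ → ℝ → X)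
    (hb : ∀ i ∈ s, MemLp (b i) (ENNReal.ofReal p) (iv α β)) (hp : 1 < p) :
    ∀ᵐ t ∂(iv α β), T (fun t => ∑ i ∈ s, b i t) t = ∑ i ∈ s, T (b i) t := by
  classical
  induction s using Finset.induction_on with
  | empty =>
    have h0 : MemLp (fun _ : ℝ => (0 : X)) (ENNReal.ofReal p) (iv α β) := memLp_const 0
    have h1 := hT.bound _ h0
    have h2 : eLpNorm (fun _ : ℝ => (0 : X)) (ENNReal.ofReal p) (iv α β) = 0 := eLpNorm_zero'
    rw [h2, mul_zero, nonpos_iff_eq_zero, eLpNorm_eq_zero_iff (hT.meas _ h0) (by simp; linarith)]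
      at h1
    filter_upwards [h1] with t ht
    simpa using ht
  | insert i s hi ih =>
    have h1 := ih fun j hj => hb j (Finset.mem_insert_of_mem hj)
    have h2 : MemLp (fun t => ∑ i ∈ s, b i t) (ENNReal.ofReal p) (iv α β) :=
      memLp_finsetSum s fun j hj => hb j (Finset.mem_insert_of_mem hj)
    filter_upwards [h1, hT.add _ _ (hb i (Finset.mem_insert_self _ _)) h2] with t h1 h2
    simp only [Finset.sum_insert hi]
    rw [h2, h1]

/-- Where ‖f‖ ≤ r/2, the integral is at most half of r(d-c); the set where ‖f‖ > r/2 carries the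
rest. Measuring the stopping intervals by this truncated integral gives a convergent integral over
all heights r later. -/
lemma half_mul_length_le {f : ℝ → X} (hf : Continuous f) {r c d : ℝ} (hr : 0 < r) (hcd : c < d)
    (h : r * (d - c) ≤ ∫ t in c..d, ‖f t‖) :
    ENNReal.ofReal (r / 2) * ENNReal.ofReal (d - c)
      ≤ ∫⁻ t in Ioc c d, {t | r / 2 < ‖f t‖}.indicator (fun t => ‖f t‖ₑ) t := by
  have h1 : ENNReal.ofReal (r * (d - c)) ≤ ∫⁻ t in Ioc c d, ‖f t‖ₑ := by
    rw [intervalIntegral.integral_of_le hcd.le] at h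
    refine (ENNReal.ofReal_le_ofReal h).trans ?_
    rw [ofReal_integral_norm_eq_lintegral_enorm]
    exact (hf.integrableOn_Icc).mono_set Ioc_subset_Icc_self
  have h2 : ∫⁻ t in Ioc c d, ‖f t‖ₑ ≤
      ∫⁻ t in Ioc c d, ({t | r / 2 < ‖f t‖}.indicator (fun t => ‖f t‖ₑ) t
        + ENNReal.ofReal (r / 2)) := by
    refine lintegral_mono fun t => ?_
    by_cases ht : r / 2 < ‖f t‖
    · rw [indicator_of_mem (by exact ht)]; exact le_self_add
    · rw [indicator_of_notMem (by exact ht), zero_add, ← ofReal_norm]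
      exact ENNReal.ofReal_le_ofReal (not_lt.1 ht)
  rw [lintegral_add_right _ measurable_const, lintegral_const] at h2
  simp only [MeasurableSet.univ, Measure.restrict_apply, univ_inter, Real.volume_Ioc] at h2
  have h3 : ENNReal.ofReal (r * (d - c)) = ENNReal.ofReal (r / 2) * ENNReal.ofReal (d - c)
      + ENNReal.ofReal (r / 2) * ENNReal.ofReal (d - c) := by
    rw [← add_mul, ← ENNReal.ofReal_add (by linarith) (by linarith), add_halves,
      ENNReal.ofReal_mul hr.le]
  have h4 := h1.trans h2
  rw [h3] at h4
  exact (ENNReal.add_le_add_iff_right (by finiteness)).1 h4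

/-- The distributional estimate behind the Calderón–Zygmund extrapolation. -/
lemma CZOperator.distrib_le (hT : CZOperator T p α β C K) (hp : 1 < p) (hαβ : α < β)
    {f : ℝ → X} (hf : Continuous f) {r : ℝ} (hr : 0 < r)
    (hav : ∫ t in α..β, ‖f t‖ ≤ r * (β - α)) :
    iv α β {t | 2 * ENNReal.ofReal r < ‖T f t‖ₑ} ≤
      (ENNReal.ofReal r)⁻¹ ^ p * (C : ℝ≥0∞) ^ p *
        (∫⁻ t in Ioo α β, {t | ‖f t‖ ≤ 2 * r}.indicator (fun t => ‖f t‖ₑ ^ p) t) +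
      ((2 : ℝ≥0∞) ^ p * (C : ℝ≥0∞) ^ p + 2 + 4 * K) * ((ENNReal.ofReal (r / 2))⁻¹ *
        ∫⁻ t in Ioo α β, {t | r / 2 < ‖f t‖}.indicator (fun t => ‖f t‖ₑ) t) := by
  classical
  set P := ENNReal.ofReal p with hP
  have hP1 : 1 ≤ P := by simpa [hP] using hp.le
  have hr0 : ENNReal.ofReal r ≠ 0 := by simpa using hr
  have huc : UniformContinuousOn f (Icc α β) :=
    isCompact_Icc.uniformContinuousOn_of_continuous hf.continuousOn
  obtain ⟨δ, hδ, hosc⟩ := Metric.uniformContinuousOn_iff.1 huc r hr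
  obtain ⟨n, hn⟩ := exists_pow_lt_of_lt_one (show 0 < δ / (β - α) from div_pos hδ (by linarith))
    (show (1 / 2 : ℝ) < 1 by norm_num)
  rw [lt_div_iff₀ (by linarith), one_div, inv_pow, inv_mul_eq_div] at hn
  -- With n fine enough that f oscillates by at most r, one has ‖f‖ ≤ 2r off the selected intervals.
  obtain ⟨J, hJ1, hJ2, hJ3, hJ4⟩ := exists_stopping_intervals hf (ε := r) n α β hαβ (by
    intro s hs t ht hst
    rw [← dist_eq_norm]
    refine (hosc s (Ioc_subset_Icc_self hs) t (Ioc_subset_Icc_self ht) ?_).le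
    rw [Real.dist_eq]
    exact hst.trans_lt hn) hav
  -- On a selected interval the good part is the mean of f, of norm at most 2r, and the bad part f -
  -- av has mean zero.
  set av : ℝ × ℝ → X := fun I => (I.2 - I.1)⁻¹ • ∫ t in I.1..I.2, f t with hav_def
  set b : ℝ × ℝ → ℝ → X := fun I => (Ioc I.1 I.2).indicator fun t => f t - av I with hb
  have hcb : ∀ I, Continuous fun t => f t - av I := fun I => hf.sub continuous_const
  have hfm : MemLp f P (iv α β) := memLp_of_continuousOn hf.continuousOn
  have hbm : ∀ I, MemLp (b I) P (iv α β) := fun I =>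
    (memLp_of_continuousOn (hcb I).continuousOn).indicator measurableSet_Ioc
  set bs : ℝ → X := fun t => ∑ I ∈ J, b I t with hbs
  have hbsm : MemLp bs P (iv α β) := memLp_finsetSum J fun I _ => hbm I
  set g : ℝ → X := fun t => f t - bs t with hg
  have hgm : MemLp g P (iv α β) := hfm.sub hbsm
  set Ω : Set ℝ := ⋃ I ∈ J, Ioc I.1 I.2 with hΩ
  have hΩm : MeasurableSet Ω := Finset.measurableSet_biUnion _ fun I _ => measurableSet_Ioc
  set om : ℝ≥0∞ := ∑ I ∈ J, ENNReal.ofReal (I.2 - I.1) with hom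
  have hΩom : volume Ω ≤ om := by
    refine (measure_biUnion_finset_le _ _).trans (le_of_eq ?_)
    simp [hom]
  set E := ∫⁻ t in Ioo α β, {t | r / 2 < ‖f t‖}.indicator (fun t => ‖f t‖ₑ) t with hE
  have hom2 : om ≤ (ENNReal.ofReal (r / 2))⁻¹ * E := by
    have h1 : ENNReal.ofReal (r / 2) * om ≤ E := by
      rw [hom, Finset.mul_sum]
      calc _ ≤ ∑ I ∈ J, ∫⁻ t in Ioc I.1 I.2,
            {t | r / 2 < ‖f t‖}.indicator (fun t => ‖f t‖ₑ) t :=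
            Finset.sum_le_sum fun I hI => half_mul_length_le hf hr (hJ1 I hI).2.1 (hJ3 I hI).1
        _ = ∫⁻ t in Ω, {t | r / 2 < ‖f t‖}.indicator (fun t => ‖f t‖ₑ) t :=
            (lintegral_biUnion_finset hJ2 (fun _ _ => measurableSet_Ioc) _).symm
        _ ≤ ∫⁻ t in Ioc α β, {t | r / 2 < ‖f t‖}.indicator (fun t => ‖f t‖ₑ) t := by
            refine lintegral_mono_set (iUnion₂_subset fun I hI => ?_)
            exact Ioc_subset_Ioc (hJ1 I hI).1 (hJ1 I hI).2.2
        _ = E := setLIntegral_congr Ioo_ae_eq_Ioc.symm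
    rw [mul_comm, ← div_eq_mul_inv, ENNReal.le_div_iff_mul_le (by simp [hr]) (by simp), mul_comm]
    exact h1
  have hbI : ∀ I ∈ J, ∀ t ∈ Ioc I.1 I.2, bs t = f t - av I := by
    intro I hI t ht
    simp only [hbs]
    rw [Finset.sum_eq_single I]
    · simp [hb, ht]
    · intro I' hI' hne
      have := hJ2 hI' hI hne
      rw [Function.onFun, Set.disjoint_left] at this
      simp only [hb]
      rw [indicator_of_notMem fun h => this h ht]
    · exact fun h => absurd hI h
  have hav2 : ∀ I ∈ J, ‖av I‖ ≤ 2 * r := by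
    intro I hI
    obtain ⟨-, h1, -⟩ := hJ1 I hI
    have h2 : 0 < I.2 - I.1 := by linarith
    rw [hav_def]
    simp only
    rw [norm_smul, norm_inv, Real.norm_of_nonneg h2.le, inv_mul_le_iff₀ h2]
    refine (intervalIntegral.norm_integral_le_integral_norm h1.le).trans ((hJ3 I hI).2.trans ?_)
    linarith
  have hgb : ∀ t ∈ Ioo α β, ‖g t‖ₑ ^ p ≤ {t | ‖f t‖ ≤ 2 * r}.indicator (fun t => ‖f t‖ₑ ^ p) t
      + Ω.indicator (fun _ => (2 * ENNReal.ofReal r) ^ p) t := by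
    intro t ht
    by_cases h : ∃ I ∈ J, t ∈ Ioc I.1 I.2
    · obtain ⟨I, hI, htI⟩ := h
      have htΩ : t ∈ Ω := by
        simp only [hΩ, mem_iUnion]
        exact ⟨I, hI, htI⟩
      rw [indicator_of_mem htΩ]
      refine le_trans ?_ le_add_self
      simp only [hg, hbI I hI t htI, sub_sub_cancel]
      gcongr
      rw [← ofReal_norm]
      refine (ENNReal.ofReal_le_ofReal (hav2 I hI)).trans (le_of_eq ?_)
      rw [ENNReal.ofReal_mul (by norm_num)]; simp
    · push Not at h
      have h1 : bs t = 0 := Finset.sum_eq_zero fun I hI => by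
        simp only [hb]; rw [indicator_of_notMem (h I hI)]
      have h2 := hJ4 t ⟨ht.1, ht.2.le⟩ h
      rw [indicator_of_mem (by show ‖f t‖ ≤ 2 * r; linarith)]
      simp [hg, h1]
  have hgood : iv α β {t | ENNReal.ofReal r ≤ ‖T g t‖ₑ} ≤ (ENNReal.ofReal r)⁻¹ ^ p * (C : ℝ≥0∞) ^ p *
        (∫⁻ t in Ioo α β, {t | ‖f t‖ ≤ 2 * r}.indicator (fun t => ‖f t‖ₑ ^ p) t) +
        (2 : ℝ≥0∞) ^ p * (C : ℝ≥0∞) ^ p * om := by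
    have h0 : P ≠ 0 := (zero_lt_one.trans_le hP1).ne'
    have h1 := meas_ge_le_mul_pow_eLpNorm_enorm (iv α β) h0 (by simp [hP]) (hT.meas g hgm) hr0
      (by simp)
    have hPp : P.toReal = p := ENNReal.toReal_ofReal (by linarith)
    rw [hPp] at h1
    have h2 : eLpNorm g P (iv α β) ^ p ≤
        (∫⁻ t in Ioo α β, {t | ‖f t‖ ≤ 2 * r}.indicator (fun t => ‖f t‖ₑ ^ p) t)
          + (2 * ENNReal.ofReal r) ^ p * om := by
      rw [eLpNorm_eq_lintegral_rpow_enorm_toReal h0 (by simp [hP]), hPp, ← ENNReal.rpow_mul,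
        one_div_mul_cancel (by linarith), ENNReal.rpow_one]
      calc _ ≤ ∫⁻ t in Ioo α β, ({t | ‖f t‖ ≤ 2 * r}.indicator (fun t => ‖f t‖ₑ ^ p) t
            + Ω.indicator (fun _ => (2 * ENNReal.ofReal r) ^ p) t) :=
            setLIntegral_mono' measurableSet_Ioo hgb
        _ = _ := lintegral_add_right _ (measurable_const.indicator hΩm)
        _ ≤ _ := by
            gcongr
            rw [lintegral_indicator_const hΩm]
            gcongr
            exact (Measure.restrict_apply_le _ _).trans hΩom
    refine h1.trans ?_
    calc _ ≤ (ENNReal.ofReal r)⁻¹ ^ p * (C * eLpNorm g P (iv α β)) ^ p := by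
          gcongr
          exact hT.bound g hgm
      _ = (ENNReal.ofReal r)⁻¹ ^ p * ((C : ℝ≥0∞) ^ p * eLpNorm g P (iv α β) ^ p) := by
          rw [ENNReal.mul_rpow_of_nonneg _ _ (by linarith)]
      _ ≤ (ENNReal.ofReal r)⁻¹ ^ p * ((C : ℝ≥0∞) ^ p * (
        (∫⁻ t in Ioo α β, {t | ‖f t‖ ≤ 2 * r}.indicator (fun t => ‖f t‖ₑ ^ p) t)
          + (2 * ENNReal.ofReal r) ^ p * om)) := by gcongr
      _ = (ENNReal.ofReal r)⁻¹ ^ p * (C : ℝ≥0∞) ^ p *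
        (∫⁻ t in Ioo α β, {t | ‖f t‖ ≤ 2 * r}.indicator (fun t => ‖f t‖ₑ ^ p) t) +
        ((ENNReal.ofReal r)⁻¹ * ENNReal.ofReal r) ^ p * (2 : ℝ≥0∞) ^ p * (C : ℝ≥0∞) ^ p * om := by
          rw [ENNReal.mul_rpow_of_nonneg _ _ (by linarith : 0 ≤ p),
            ENNReal.mul_rpow_of_nonneg _ _ (by linarith : 0 ≤ p)]
          ring
      _ = _ := by rw [ENNReal.inv_mul_cancel hr0 (by simp)]; simp
  -- The exceptional set extends each interval only to the right; `tail` controls everything else,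
  -- including the region to the left. This doubles the total length.
  set Ωs : Set ℝ := ⋃ I ∈ J, Ioo I.1 (I.2 + (I.2 - I.1)) with hΩs
  have hΩsm : MeasurableSet Ωs := Finset.measurableSet_biUnion _ fun I _ => measurableSet_Ioo
  have hbad : iv α β {t | ENNReal.ofReal r ≤ ‖T bs t‖ₑ} ≤ (2 + 4 * K) * om := by
    have h1 : volume Ωs ≤ 2 * om := by
      refine (measure_biUnion_finset_le _ _).trans (le_of_eq ?_)
      rw [hom, Finset.mul_sum]
      refine Finset.sum_congr rfl fun I hI => ?_
      have h2 : (2 : ℝ≥0∞) = ENNReal.ofReal 2 := by simp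
      rw [Real.volume_Ioo, h2, ← ENNReal.ofReal_mul (by norm_num)]
      congr 1; ring
    have h2 : ∫⁻ t in Ioo α β \ Ωs, ‖T bs t‖ₑ ≤ ENNReal.ofReal r * (4 * K * om) := by
      have hsum := hT.sum J b (fun I _ => hbm I) hp
      have hae : ∀ᵐ t ∂(volume.restrict (Ioo α β \ Ωs)), ‖T bs t‖ₑ ≤ ∑ I ∈ J, ‖T (b I) t‖ₑ := by
        refine ae_mono (Measure.restrict_mono sdiff_subset le_rfl) ?_
        filter_upwards [hsum] with t ht
        rw [ht]
        exact enorm_sum_le _ _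
      calc _ ≤ ∫⁻ t in Ioo α β \ Ωs, ∑ I ∈ J, ‖T (b I) t‖ₑ := lintegral_mono_ae hae
        _ = ∑ I ∈ J, ∫⁻ t in Ioo α β \ Ωs, ‖T (b I) t‖ₑ := by
            refine lintegral_finsetSum' _ fun I _ => ?_
            exact ((hT.meas _ (hbm I)).mono_measure
              (Measure.restrict_mono sdiff_subset le_rfl)).enorm
        _ ≤ ∑ I ∈ J, ENNReal.ofReal r * (4 * K * ENNReal.ofReal (I.2 - I.1)) := by
            refine Finset.sum_le_sum fun I hI => ?_
            obtain ⟨h3, h4, h5⟩ := hJ1 I hI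
            have h6 : 0 < I.2 - I.1 := by linarith
            have hmean : ∫ t in I.1..I.2, (f t - av I) = 0 := by
              rw [intervalIntegral.integral_sub (hf.intervalIntegrable _ _) (by simp),
                intervalIntegral.integral_const, hav_def]
              simp only
              rw [smul_smul, mul_inv_cancel₀ h6.ne', one_smul, sub_self]
            have hsub : Ioo α β \ Ωs ⊆ Ioo α β \ Ioo I.1 (I.2 + (I.2 - I.1)) :=
              sdiff_subset_sdiff_right (subset_biUnion_of_mem
                (u := fun I : ℝ × ℝ => Ioo I.1 (I.2 + (I.2 - I.1))) (s := (J : Set (ℝ × ℝ))) hI)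
            refine (lintegral_mono_set hsub).trans
              -- The L¹-norm of f - av is at most 2r|I| from f plus 2r|I| from the mean, whence the
              -- factor 4.
              ((hT.tail I.1 I.2 _ h3 h4 h5 (hcb I) hmean).trans ?_)
            have h7 : eLpNorm (fun t => f t - av I) 1 (iv I.1 I.2)
                ≤ 4 * (ENNReal.ofReal r * ENNReal.ofReal (I.2 - I.1)) := by
              refine (eLpNorm_sub_le hf.aestronglyMeasurable aestronglyMeasurable_const
                le_rfl).trans ?_
              have h8 : eLpNorm f 1 (iv I.1 I.2) ≤ ENNReal.ofReal (2 * r * (I.2 - I.1)) := by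
                rw [eLpNorm_one_eq_lintegral_enorm, setLIntegral_congr Ioo_ae_eq_Ioc,
                  ← ofReal_integral_norm_eq_lintegral_enorm
                    (hf.integrableOn_Icc.mono_set Ioc_subset_Icc_self),
                  ← intervalIntegral.integral_of_le h4.le]
                exact ENNReal.ofReal_le_ofReal (hJ3 I hI).2
              have h9 : eLpNorm (fun _ : ℝ => av I) 1 (iv I.1 I.2)
                  ≤ ENNReal.ofReal (2 * r * (I.2 - I.1)) := by
                rw [eLpNorm_const' _ one_ne_zero (by simp), iv_univ, ← ofReal_norm,
                  ENNReal.ofReal_mul (by linarith)]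
                simp only [ENNReal.toReal_one, div_one, ENNReal.rpow_one]
                gcongr
                exact hav2 I hI
              refine (add_le_add h8 h9).trans (le_of_eq ?_)
              rw [← ENNReal.ofReal_add (by positivity) (by positivity),
                ← ENNReal.ofReal_mul hr.le]
              have h4' : (4 : ℝ≥0∞) = ENNReal.ofReal 4 := by simp
              rw [h4', ← ENNReal.ofReal_mul (by norm_num)]
              congr 1; ring
            calc _ ≤ (K : ℝ≥0∞) * (4 * (ENNReal.ofReal r * ENNReal.ofReal (I.2 - I.1))) := by gcongr
              _ = _ := by ring
        _ = _ := by rw [hom, Finset.mul_sum, Finset.mul_sum]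
    have h3 : iv α β {t | ENNReal.ofReal r ≤ ‖T bs t‖ₑ}
        ≤ volume Ωs + volume.restrict (Ioo α β \ Ωs) {t | ENNReal.ofReal r ≤ ‖T bs t‖ₑ} := by
      have e1 : iv α β ≤ volume.restrict Ωs + volume.restrict (Ioo α β \ Ωs) := by
        refine (Measure.restrict_mono (s' := Ωs ∪ (Ioo α β \ Ωs)) ?_ le_rfl).trans
          (Measure.restrict_union_le _ _)
        intro t ht
        by_cases h : t ∈ Ωs
        · exact Or.inl h
        · exact Or.inr ⟨ht, h⟩
      refine (e1 _).trans ?_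
      rw [Measure.add_apply]
      refine add_le_add ?_ le_rfl
      exact (measure_mono (subset_univ _)).trans (Measure.restrict_apply_univ Ωs).le
    have h4 : volume.restrict (Ioo α β \ Ωs) {t | ENNReal.ofReal r ≤ ‖T bs t‖ₑ} ≤ 4 * K * om := by
      have h5 : ENNReal.ofReal r * volume.restrict (Ioo α β \ Ωs)
          {t | ENNReal.ofReal r ≤ ‖T bs t‖ₑ} ≤ ENNReal.ofReal r * (4 * K * om) := by
        refine le_trans (mul_meas_ge_le_lintegral₀ ?_ _) h2
        exact ((hT.meas _ hbsm).mono_measure (Measure.restrict_mono sdiff_subset le_rfl)).enorm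
      exact (ENNReal.mul_le_mul_iff_right hr0 (by simp)).1 h5
    refine h3.trans ((add_le_add h1 h4).trans (le_of_eq ?_))
    ring
  have hsplit : ∀ᵐ t ∂(iv α β), T f t = T g t + T bs t := by
    have := hT.add g bs hgm hbsm
    simpa [hg] using this
  have hlt : iv α β {t | 2 * ENNReal.ofReal r < ‖T f t‖ₑ} ≤
      iv α β {t | ENNReal.ofReal r ≤ ‖T g t‖ₑ} + iv α β {t | ENNReal.ofReal r ≤ ‖T bs t‖ₑ} := by
    refine le_trans (measure_mono_ae ?_) (measure_union_le _ _)
    filter_upwards [hsplit] with t ht h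
    by_contra hc
    have hc' : ¬ (ENNReal.ofReal r ≤ ‖T g t‖ₑ ∨ ENNReal.ofReal r ≤ ‖T bs t‖ₑ) := hc
    push Not at hc'
    have h' : 2 * ENNReal.ofReal r < ‖T f t‖ₑ := h
    rw [ht, two_mul] at h'
    exact absurd (h'.trans_le (enorm_add_le _ _)) (not_lt.2 (add_le_add hc'.1.le hc'.2.le))
  refine hlt.trans ((add_le_add hgood hbad).trans ?_)
  rw [add_assoc, ← add_mul, add_assoc ((2 : ℝ≥0∞) ^ p * (C : ℝ≥0∞) ^ p) 2]
  gcongr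

end CalderonZygmund

end NonAutonomous

namespace NonAutonomous

/-! ### From the distributional estimate to an L^q-bound for 1 < q < p. -/

section StrongType

set_option linter.unusedSectionVars false

open Filter Topology
open scoped NNReal

lemma lintegral_Ioi_rpow {e c : ℝ} (he : e < -1) (hc : 0 < c) :
    ∫⁻ s in Ioi c, ENNReal.ofReal (s ^ e) = ENNReal.ofReal (-c ^ (e + 1) / (e + 1)) := by
  rw [← integral_Ioi_rpow_of_lt he hc, ofReal_integral_eq_lintegral_ofReal
    (integrableOn_Ioi_rpow_of_lt he hc)]
  filter_upwards [ae_restrict_mem measurableSet_Ioi] with s hs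
  exact Real.rpow_nonneg (hc.le.trans (mem_Ioi.1 hs).le) _

lemma lintegral_Ioc_rpow {e c : ℝ} (he : -1 < e) (hc : 0 ≤ c) :
    ∫⁻ s in Ioc 0 c, ENNReal.ofReal (s ^ e) = ENNReal.ofReal (c ^ (e + 1) / (e + 1)) := by
  have h1 := integral_rpow (a := 0) (b := c) (Or.inl he)
  rw [Real.zero_rpow (by linarith), sub_zero, intervalIntegral.integral_of_le hc] at h1
  rw [← h1, ofReal_integral_eq_lintegral_ofReal]
  · exact (intervalIntegrable_iff_integrableOn_Ioc_of_le hc).1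
      (intervalIntegral.intervalIntegrable_rpow' he)
  · filter_upwards [ae_restrict_mem measurableSet_Ioc] with s hs
    exact Real.rpow_nonneg hs.1.le _

lemma lintegral_indicator_swap {R : Set (ℝ × ℝ)} (hR : MeasurableSet R) {a φ : ℝ → ℝ≥0∞}
    (ha : Measurable a) (hφ : Measurable φ) (S I : Set ℝ) :
    ∫⁻ s in S, a s * ∫⁻ t in I, {t | (s, t) ∈ R}.indicator φ t
      = ∫⁻ t in I, φ t * ∫⁻ s in S, {s | (s, t) ∈ R}.indicator a s := by
  have h1 : Measurable (Function.uncurry fun s t => R.indicator (fun z => a z.1 * φ z.2) (s, t)) :=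
    ((ha.comp measurable_fst).mul (hφ.comp measurable_snd)).indicator hR
  calc _ = ∫⁻ s in S, ∫⁻ t in I, R.indicator (fun z => a z.1 * φ z.2) (s, t) := by
        refine lintegral_congr fun s => ?_
        rw [← lintegral_const_mul _ (hφ.indicator
          (show MeasurableSet {t | (s, t) ∈ R} from measurable_prodMk_left hR))]
        refine lintegral_congr fun t => ?_
        by_cases h : (s, t) ∈ R <;> simp [h]
    _ = ∫⁻ t in I, ∫⁻ s in S, R.indicator (fun z => a z.1 * φ z.2) (s, t) :=
        lintegral_lintegral_swap h1.aemeasurable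
    _ = _ := by
        refine lintegral_congr fun t => ?_
        rw [← lintegral_const_mul _ (ha.indicator
          (show MeasurableSet {s | (s, t) ∈ R} from measurable_prodMk_right hR))]
        refine lintegral_congr fun s => ?_
        by_cases h : (s, t) ∈ R <;> simp [h, mul_comm]

variable {X : Type*} [NormedAddCommGroup X] [NormedSpace ℝ X] [CompleteSpace X]

/-- Height integral of the L¹-part: only s < 2‖y‖ contributes, and s^(q-2) is integrable at 0
because q > 1. -/
lemma lintegral_high_le {q : ℝ} (hq : 1 < q) (y : X) :
    ‖y‖ₑ * ∫⁻ s in Ioi (0 : ℝ), {s : ℝ | s / 2 < ‖y‖}.indicator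
      (fun s => ENNReal.ofReal (s ^ (q - 2))) s
      ≤ ENNReal.ofReal (2 ^ (q - 1) / (q - 1)) * ‖y‖ₑ ^ q := by
  have h1 : ∫⁻ s in Ioi (0 : ℝ), {s : ℝ | s / 2 < ‖y‖}.indicator
      (fun s => ENNReal.ofReal (s ^ (q - 2))) s
      ≤ ∫⁻ s in Ioc 0 (2 * ‖y‖), ENNReal.ofReal (s ^ (q - 2)) := by
    rw [← lintegral_indicator measurableSet_Ioi, ← lintegral_indicator measurableSet_Ioc]
    refine lintegral_mono fun s => ?_
    simp only [indicator, mem_Ioi, mem_ofPred_eq, mem_Ioc]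
    split_ifs with h1 h2 h3 <;> try simp
    exact absurd ⟨h1, by linarith⟩ h3
  rw [lintegral_Ioc_rpow (by linarith) (by positivity)] at h1
  refine (mul_le_mul_right h1 _).trans ?_
  have hq1 : 0 < q - 1 := by linarith
  rw [← ofReal_norm, ENNReal.ofReal_rpow_of_nonneg (norm_nonneg _) (by linarith),
    ← ENNReal.ofReal_mul (norm_nonneg _), ← ENNReal.ofReal_mul (by positivity)]
  refine le_of_eq ?_
  congr 1
  rw [show q - 2 + 1 = q - 1 by ring, Real.mul_rpow (by norm_num) (norm_nonneg _)]
  rcases eq_or_ne ‖y‖ 0 with h | h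
  · rw [h, Real.zero_rpow (show q ≠ 0 by linarith)]; simp
  · rw [Real.rpow_sub_one h]
    field_simp

/-- Height integral of the L^p-part: only s ≥ ‖y‖/2 contributes, and s^(q-1-p) is integrable at
infinity because q < p. -/
lemma lintegral_low_le {p q : ℝ} (hq : 1 < q) (hqp : q < p) (y : X) :
    ‖y‖ₑ ^ p * ∫⁻ s in Ioi (0 : ℝ), {s : ℝ | ‖y‖ ≤ 2 * s}.indicator
      (fun s => ENNReal.ofReal (s ^ (q - 1 - p))) s
      ≤ ENNReal.ofReal (2 ^ (p - q) / (p - q)) * ‖y‖ₑ ^ q := by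
  rcases eq_or_ne y 0 with rfl | hy
  · rw [enorm_zero, ENNReal.zero_rpow_of_pos (by linarith), zero_mul]; exact bot_le
  have hy0 : 0 < ‖y‖ := norm_pos_iff.2 hy
  have h1 : ∫⁻ s in Ioi (0 : ℝ), {s : ℝ | ‖y‖ ≤ 2 * s}.indicator
      (fun s => ENNReal.ofReal (s ^ (q - 1 - p))) s
      ≤ ∫⁻ s in Ioi (‖y‖ / 2), ENNReal.ofReal (s ^ (q - 1 - p)) := by
    rw [setLIntegral_congr (Ioi_ae_eq_Ici (a := ‖y‖ / 2)), ← lintegral_indicator measurableSet_Ioi,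
      ← lintegral_indicator measurableSet_Ici]
    refine lintegral_mono fun s => ?_
    simp only [indicator, mem_Ioi, mem_ofPred_eq, mem_Ici]
    split_ifs with h1 h2 h3 <;> try simp
    exact absurd (by linarith) h3
  rw [lintegral_Ioi_rpow (by linarith) (by positivity)] at h1
  refine (mul_le_mul_right h1 _).trans ?_
  rw [← ofReal_norm, ENNReal.ofReal_rpow_of_nonneg (norm_nonneg _) (by linarith),
    ENNReal.ofReal_rpow_of_nonneg (norm_nonneg _) (by linarith),
    ← ENNReal.ofReal_mul (by positivity), ← ENNReal.ofReal_mul (by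
      have : 0 < p - q := by linarith
      positivity)]
  refine le_of_eq ?_
  congr 1
  rw [show q - 1 - p + 1 = -(p - q) by ring, Real.div_rpow hy0.le (by norm_num),
    Real.rpow_neg hy0.le, Real.rpow_neg (by norm_num), Real.rpow_sub hy0]
  have : p - q ≠ 0 := by linarith
  field_simp

/-- Jensen's inequality. It covers heights below the mean of ‖f‖, where the stopping procedure
cannot start and only the trivial bound by the length of the interval is available. -/
lemma ofReal_average_rpow_le {q α β : ℝ} (hq : 1 < q) (hαβ : α < β) {f : ℝ → X}
    (hf : Continuous f) :
    ENNReal.ofReal (((∫ t in α..β, ‖f t‖) / (β - α)) ^ q) * ENNReal.ofReal (β - α)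
      ≤ ∫⁻ t in Ioo α β, ‖f t‖ₑ ^ q := by
  have h0 : 0 < β - α := by linarith
  have h1 := eLpNorm_one_le_iv (p := ENNReal.ofReal q) (by simpa using hq.le)
    (hf.aestronglyMeasurable : AEStronglyMeasurable f (iv α β))
  rw [eLpNorm_one_eq_lintegral_enorm, setLIntegral_congr Ioo_ae_eq_Ioc,
    ← ofReal_integral_norm_eq_lintegral_enorm
      (hf.integrableOn_Icc.mono_set Ioc_subset_Icc_self),
    ← intervalIntegral.integral_of_le hαβ.le, ENNReal.toReal_ofReal (by linarith),
    eLpNorm_eq_lintegral_rpow_enorm_toReal (by simp; linarith) (by simp),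
    ENNReal.toReal_ofReal (by linarith)] at h1
  have hI : 0 ≤ ∫ t in α..β, ‖f t‖ :=
    intervalIntegral.integral_nonneg hαβ.le fun _ _ => norm_nonneg _
  set F := ∫⁻ t in Ioo α β, ‖f t‖ₑ ^ q
  set L := ENNReal.ofReal (β - α) with hL
  have hL0 : L ≠ 0 := by simpa [hL] using hαβ
  have hLt : L ≠ ∞ := by simp [hL]
  have hq0 : q ≠ 0 := by linarith
  rw [← ENNReal.ofReal_rpow_of_nonneg (by positivity) (by linarith), ENNReal.ofReal_div_of_pos h0]
  calc _ ≤ (F ^ (1 / q) * L ^ (1 - 1 / q) / L) ^ q * L := by gcongr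
    _ = F * (L ^ (q - 1) * L⁻¹ ^ q * L) := by
        rw [div_eq_mul_inv, ENNReal.mul_rpow_of_nonneg _ _ (by linarith),
          ENNReal.mul_rpow_of_nonneg _ _ (by linarith), ← ENNReal.rpow_mul, ← ENNReal.rpow_mul,
          one_div_mul_cancel hq0, ENNReal.rpow_one, sub_mul, one_div_mul_cancel hq0, one_mul]
        ring
    _ = F := by
        rw [ENNReal.inv_rpow, ← ENNReal.rpow_neg]
        have : L ^ (q - 1) * L ^ (-q) * L = 1 := by
          rw [← ENNReal.rpow_add _ _ hL0 hLt]
          rw [show q - 1 + -q = -1 by ring, ENNReal.rpow_neg_one, ENNReal.inv_mul_cancel hL0 hLt]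
        rw [this, mul_one]

variable {T : (ℝ → X) → ℝ → X} {p q α β : ℝ} {C K : ℝ≥0}

/-- Marcinkiewicz-type argument: write the L^q-norm as an integral over heights s, use the
distributional estimate for s above the mean of ‖f‖, and exchange the order of integration. -/
lemma CZOperator.lintegral_rpow_le (hT : CZOperator T p α β C K) (hq : 1 < q) (hqp : q < p)
    (hαβ : α < β) {f : ℝ → X} (hf : Continuous f) :
    ∫⁻ t in Ioo α β, ‖T f t‖ₑ ^ q ≤ (2 : ℝ≥0∞) ^ q * (1 + ENNReal.ofReal q *
      ((C : ℝ≥0∞) ^ p * ENNReal.ofReal (2 ^ (p - q) / (p - q)) +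
        ((2 : ℝ≥0∞) ^ p * (C : ℝ≥0∞) ^ p + 2 + 4 * K) * 2 *
          ENNReal.ofReal (2 ^ (q - 1) / (q - 1)))) * ∫⁻ t in Ioo α β, ‖f t‖ₑ ^ q := by
  have hp : 1 < p := hq.trans hqp
  have h0 : 0 < β - α := by linarith
  have hfm : MemLp f (ENNReal.ofReal p) (iv α β) := memLp_of_continuousOn hf.continuousOn
  have hTm := hT.meas f hfm
  set F := ∫⁻ t in Ioo α β, ‖f t‖ₑ ^ q with hF
  set K1 : ℝ≥0∞ := (2 : ℝ≥0∞) ^ p * (C : ℝ≥0∞) ^ p + 2 + 4 * K with hK1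
  set c1 := ENNReal.ofReal (2 ^ (p - q) / (p - q))
  set c2 := ENNReal.ofReal (2 ^ (q - 1) / (q - 1))
  set av := (∫ t in α..β, ‖f t‖) / (β - α) with hav
  have hav0 : 0 ≤ av :=
    div_nonneg (intervalIntegral.integral_nonneg hαβ.le fun _ _ => norm_nonneg _) h0.le
  -- The function is halved because the distributional estimate at height s concerns the set where
  -- Tf exceeds 2s; this accounts for the factor 2^q.
  have hcake := lintegral_rpow_eq_lintegral_meas_lt_mul (iv α β) (f := fun t => ‖T f t‖ / 2)
    (Eventually.of_forall fun t => by positivity)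
    (hTm.norm.aemeasurable.div_const 2) (p := q) (by linarith)
  have hset : ∀ s : ℝ, 0 < s →
      {t | s < ‖T f t‖ / 2} ⊆ {t | 2 * ENNReal.ofReal s < ‖T f t‖ₑ} := by
    intro s hs t ht
    have h1 : 2 * s < ‖T f t‖ := by
      have : s < ‖T f t‖ / 2 := ht
      linarith
    have h2 : (2 : ℝ≥0∞) = ENNReal.ofReal 2 := by simp
    show 2 * ENNReal.ofReal s < ‖T f t‖ₑ
    rw [h2, ← ENNReal.ofReal_mul (by norm_num), ← ofReal_norm]
    exact (ENNReal.ofReal_lt_ofReal_iff (by linarith)).2 h1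
  have hlow : ∫⁻ s in Ioc 0 av, iv α β {t | s < ‖T f t‖ / 2} * ENNReal.ofReal (s ^ (q - 1))
      ≤ (ENNReal.ofReal q)⁻¹ * F := by
    calc _ ≤ ∫⁻ s in Ioc 0 av, ENNReal.ofReal (β - α) * ENNReal.ofReal (s ^ (q - 1)) := by
          refine lintegral_mono fun s => ?_
          gcongr
          exact (measure_mono (subset_univ _)).trans (iv_univ α β).le
      _ = ENNReal.ofReal (β - α) * ENNReal.ofReal (av ^ q / q) := by
          rw [lintegral_const_mul' _ _ (by simp), lintegral_Ioc_rpow (by linarith) hav0]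
          rw [show q - 1 + 1 = q by ring]
      _ = (ENNReal.ofReal q)⁻¹ * (ENNReal.ofReal (av ^ q) * ENNReal.ofReal (β - α)) := by
          rw [ENNReal.ofReal_div_of_pos (by linarith), div_eq_mul_inv]; ring
      _ ≤ _ := by gcongr; exact ofReal_average_rpow_le hq hαβ hf
  have hhigh : ∫⁻ s in Ioi av, iv α β {t | s < ‖T f t‖ / 2} * ENNReal.ofReal (s ^ (q - 1))
      ≤ ((C : ℝ≥0∞) ^ p * c1 + K1 * 2 * c2) * F := by
    have hR1 : MeasurableSet {z : ℝ × ℝ | ‖f z.2‖ ≤ 2 * z.1} :=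
      (isClosed_le (by fun_prop) (by fun_prop)).measurableSet
    have hR2 : MeasurableSet {z : ℝ × ℝ | z.1 / 2 < ‖f z.2‖} :=
      (isOpen_lt (by fun_prop) (by fun_prop)).measurableSet
    have hm1 : Measurable fun s : ℝ => ENNReal.ofReal (s ^ (q - 1 - p)) := by fun_prop
    have hm2 : Measurable fun s : ℝ => ENNReal.ofReal (s ^ (q - 2)) := by fun_prop
    have hφ1 : Measurable fun t => ‖f t‖ₑ ^ p := hf.enorm.measurable.pow_const p
    have hφ2 : Measurable fun t => ‖f t‖ₑ := hf.enorm.measurable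
    calc _ ≤ ∫⁻ s in Ioi av, ((C : ℝ≥0∞) ^ p * (ENNReal.ofReal (s ^ (q - 1 - p)) *
            ∫⁻ t in Ioo α β, {t | (s, t) ∈ {z : ℝ × ℝ | ‖f z.2‖ ≤ 2 * z.1}}.indicator
              (fun t => ‖f t‖ₑ ^ p) t)
          + K1 * 2 * (ENNReal.ofReal (s ^ (q - 2)) *
            ∫⁻ t in Ioo α β, {t | (s, t) ∈ {z : ℝ × ℝ | z.1 / 2 < ‖f z.2‖}}.indicator
              (fun t => ‖f t‖ₑ) t)) := by
          refine setLIntegral_mono' measurableSet_Ioi fun s hs => ?_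
          have hs0 : 0 < s := hav0.trans_lt hs
          have hd := hT.distrib_le hp hαβ hf hs0 (by
            have : av < s := hs
            rw [hav, div_lt_iff₀ h0] at this
            exact this.le)
          have e1 : (ENNReal.ofReal s)⁻¹ ^ p * ENNReal.ofReal (s ^ (q - 1))
              = ENNReal.ofReal (s ^ (q - 1 - p)) := by
            rw [← ENNReal.ofReal_inv_of_pos hs0, ENNReal.ofReal_rpow_of_nonneg (by positivity)
              (by linarith), ← ENNReal.ofReal_mul (by positivity), Real.inv_rpow hs0.le,
              ← Real.rpow_neg hs0.le, ← Real.rpow_add hs0]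
            congr 2; ring
          have e2 : (ENNReal.ofReal (s / 2))⁻¹ * ENNReal.ofReal (s ^ (q - 1))
              = 2 * ENNReal.ofReal (s ^ (q - 2)) := by
            have h2 : (2 : ℝ≥0∞) = ENNReal.ofReal 2 := by simp
            rw [← ENNReal.ofReal_inv_of_pos (by positivity), ← ENNReal.ofReal_mul (by positivity),
              h2, ← ENNReal.ofReal_mul (by positivity)]
            congr 1
            rw [show q - 2 = q - 1 - 1 by ring, Real.rpow_sub_one hs0.ne' (q - 1)]
            field_simp
          rw [← e1, show K1 * 2 * (ENNReal.ofReal (s ^ (q - 2)) *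
            ∫⁻ t in Ioo α β, {t | (s, t) ∈ {z : ℝ × ℝ | z.1 / 2 < ‖f z.2‖}}.indicator
              (fun t => ‖f t‖ₑ) t) = K1 * ((2 * ENNReal.ofReal (s ^ (q - 2))) *
            ∫⁻ t in Ioo α β, {t | (s, t) ∈ {z : ℝ × ℝ | z.1 / 2 < ‖f z.2‖}}.indicator
              (fun t => ‖f t‖ₑ) t) by ring, ← e2]
          refine (mul_le_mul_left ((measure_mono (hset s hs0)).trans hd) _).trans (le_of_eq ?_)
          simp only [mem_ofPred_eq]
          ring
      _ ≤ ∫⁻ s in Ioi 0, ((C : ℝ≥0∞) ^ p * (ENNReal.ofReal (s ^ (q - 1 - p)) *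
            ∫⁻ t in Ioo α β, {t | (s, t) ∈ {z : ℝ × ℝ | ‖f z.2‖ ≤ 2 * z.1}}.indicator
              (fun t => ‖f t‖ₑ ^ p) t)
          + K1 * 2 * (ENNReal.ofReal (s ^ (q - 2)) *
            ∫⁻ t in Ioo α β, {t | (s, t) ∈ {z : ℝ × ℝ | z.1 / 2 < ‖f z.2‖}}.indicator
              (fun t => ‖f t‖ₑ) t)) := lintegral_mono_set (Ioi_subset_Ioi hav0)
      _ = (C : ℝ≥0∞) ^ p * (∫⁻ t in Ioo α β, ‖f t‖ₑ ^ p * ∫⁻ s in Ioi (0 : ℝ),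
            {s | (s, t) ∈ {z : ℝ × ℝ | ‖f z.2‖ ≤ 2 * z.1}}.indicator
              (fun s => ENNReal.ofReal (s ^ (q - 1 - p))) s)
          + K1 * 2 * (∫⁻ t in Ioo α β, ‖f t‖ₑ * ∫⁻ s in Ioi (0 : ℝ),
            {s | (s, t) ∈ {z : ℝ × ℝ | z.1 / 2 < ‖f z.2‖}}.indicator
              (fun s => ENNReal.ofReal (s ^ (q - 2))) s) := by
          have hM1 : Measurable fun s : ℝ => ENNReal.ofReal (s ^ (q - 1 - p)) *
              ∫⁻ t in Ioo α β, {t | (s, t) ∈ {z : ℝ × ℝ | ‖f z.2‖ ≤ 2 * z.1}}.indicator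
              (fun t => ‖f t‖ₑ ^ p) t :=
            hm1.mul (Measurable.lintegral_prod_right'
              (f := {z : ℝ × ℝ | ‖f z.2‖ ≤ 2 * z.1}.indicator fun z => ‖f z.2‖ₑ ^ p)
              ((hφ1.comp measurable_snd).indicator hR1))
          have hM2 : Measurable fun s : ℝ => ENNReal.ofReal (s ^ (q - 2)) *
              ∫⁻ t in Ioo α β, {t | (s, t) ∈ {z : ℝ × ℝ | z.1 / 2 < ‖f z.2‖}}.indicator
              (fun t => ‖f t‖ₑ) t :=
            hm2.mul (Measurable.lintegral_prod_right'
              (f := {z : ℝ × ℝ | z.1 / 2 < ‖f z.2‖}.indicator fun z => ‖f z.2‖ₑ)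
              ((hφ2.comp measurable_snd).indicator hR2))
          rw [lintegral_add_left (hM1.const_mul _), lintegral_const_mul _ hM1,
            lintegral_const_mul _ hM2, lintegral_indicator_swap hR1 hm1 hφ1,
            lintegral_indicator_swap hR2 hm2 hφ2]
      _ ≤ (C : ℝ≥0∞) ^ p * (∫⁻ t in Ioo α β, c1 * ‖f t‖ₑ ^ q)
          + K1 * 2 * (∫⁻ t in Ioo α β, c2 * ‖f t‖ₑ ^ q) := by
          exact add_le_add
            (mul_le_mul_right (lintegral_mono fun t => lintegral_low_le hq hqp (f t)) _)
            (mul_le_mul_right (lintegral_mono fun t => lintegral_high_le hq (f t)) _)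
      _ = _ := by
          rw [lintegral_const_mul' _ _ (by simp [c1]), lintegral_const_mul' _ _ (by simp [c2])]
          ring
  have hsum : ∫⁻ s in Ioi (0 : ℝ), iv α β {t | s < ‖T f t‖ / 2} * ENNReal.ofReal (s ^ (q - 1))
      ≤ (ENNReal.ofReal q)⁻¹ * F + ((C : ℝ≥0∞) ^ p * c1 + K1 * 2 * c2) * F := by
    rw [← Ioc_union_Ioi_eq_Ioi hav0]
    exact (lintegral_union_le _ _ _).trans (add_le_add hlow hhigh)
  have e3 : ∫⁻ t in Ioo α β, ‖T f t‖ₑ ^ q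
      = 2 ^ q * ∫⁻ t in Ioo α β, ENNReal.ofReal ((‖T f t‖ / 2) ^ q) := by
    have h2 : (2 : ℝ≥0∞) = ENNReal.ofReal 2 := by simp
    rw [← lintegral_const_mul' _ _ (by simp)]
    refine lintegral_congr fun t => ?_
    rw [← ofReal_norm, h2, ENNReal.ofReal_rpow_of_nonneg (norm_nonneg _) (by linarith),
      ENNReal.ofReal_rpow_of_nonneg (by norm_num) (by linarith),
      ← ENNReal.ofReal_mul (by positivity), Real.div_rpow (norm_nonneg _) (by norm_num)]
    congr 1
    field_simp
  rw [e3, hcake, mul_assoc]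
  refine mul_le_mul_right ((mul_le_mul_right hsum _).trans (le_of_eq ?_)) _
  rw [mul_add, ← mul_assoc, ENNReal.mul_inv_cancel (by simp; linarith) (by simp)]
  ring

lemma CZOperator.exists_eLpNorm_le (p q : ℝ) (C K : ℝ≥0) (hq : 1 < q) (hqp : q < p) :
    ∃ K' : ℝ≥0, ∀ (T : (ℝ → X) → ℝ → X) (α β : ℝ), α < β → CZOperator T p α β C K →
      ∀ f : ℝ → X, Continuous f →
        eLpNorm (T f) (ENNReal.ofReal q) (iv α β) ≤ K' * eLpNorm f (ENNReal.ofReal q) (iv α β) := by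
  set Q : ℝ≥0∞ := (2 : ℝ≥0∞) ^ q * (1 + ENNReal.ofReal q *
      ((C : ℝ≥0∞) ^ p * ENNReal.ofReal (2 ^ (p - q) / (p - q)) +
        ((2 : ℝ≥0∞) ^ p * (C : ℝ≥0∞) ^ p + 2 + 4 * K) * 2 *
          ENNReal.ofReal (2 ^ (q - 1) / (q - 1)))) with hQ
  have hp : 0 ≤ p := by linarith
  have hQt : Q ≠ ∞ := by
    have h1 : (2 : ℝ≥0∞) ^ q ≠ ∞ := ENNReal.rpow_ne_top_of_nonneg (by linarith) (by simp)
    have h2 : (2 : ℝ≥0∞) ^ p ≠ ∞ := ENNReal.rpow_ne_top_of_nonneg hp (by simp)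
    have h3 : (C : ℝ≥0∞) ^ p ≠ ∞ := ENNReal.rpow_ne_top_of_nonneg hp (by simp)
    rw [hQ]
    finiteness
  refine ⟨(Q ^ (1 / q)).toNNReal, fun T α β hαβ hT f hf => ?_⟩
  rw [ENNReal.coe_toNNReal (ENNReal.rpow_ne_top_of_nonneg (by positivity) hQt),
    eLpNorm_eq_lintegral_rpow_enorm_toReal (by simp; linarith) (by simp),
    eLpNorm_eq_lintegral_rpow_enorm_toReal (by simp; linarith) (by simp),
    ENNReal.toReal_ofReal (by linarith), ← ENNReal.mul_rpow_of_nonneg _ _ (by positivity)]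
  gcongr
  exact hT.lintegral_rpow_le hq hqp hαβ hf

end StrongType

end NonAutonomous

namespace NonAutonomous

/-! ### Maximal regularity at smaller exponents. -/

section Extrapolation

set_option linter.unusedSectionVars false

open Filter Topology
open scoped NNReal

variable {X D : Type*} [NormedAddCommGroup X] [NormedAddCommGroup D]
  [NormedSpace ℝ X] [NormedSpace ℝ D] [CompleteSpace X] [CompleteSpace D] {ι : D →L[ℝ] X}
  {B : D →L[ℝ] X} {C : ℝ≥0} {h p q : ℝ}

/-- The singular integral is the map from f to the derivative of the solution. If f lives on (c,d],
uniqueness makes the solution vanish before c, and the decay estimate for mean-zero data covers the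
region beyond d + (d - c). -/
lemma AutWP.exists_solution_operator {a b : ℝ} (hp : 1 < p)
    (hB : AutWP ι B (ENNReal.ofReal p) h C) (hab : a < b) (hbh : b ≤ a + h) :
    ∃ (U : (ℝ → X) → ℝ → D) (V : (ℝ → X) → ℝ → X),
      (∀ f, MemLp f (ENNReal.ofReal p) (iv a b) →
        Sol ι (fun _ => B) (ENNReal.ofReal p) a b 0 f (U f) (V f)) ∧
      CZOperator V p a b C (4 * ((2 * C + 2) * (C + C ^ 2) * C)) := by
  classical
  set P := ENNReal.ofReal p with hP
  have hP1 : 1 ≤ P := by simpa [hP] using hp.le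
  have hPt : P ≠ ∞ := by simp [hP]
  have hW := hB a b hab hbh
  choose! U V hUV using hW.exists_sol
  refine ⟨U, V, hUV, ⟨fun f hf => (hUV f hf).memV.1, ?_, ?_, ?_⟩⟩
  · intro f g hf hg
    have h1 := (hUV f hf).add hP1 (hUV g hg)
    rw [add_zero] at h1
    exact (hW.unique hP1 (hUV _ (hf.add hg)) h1 (by simp)).2
  · exact fun f hf => hW.boundV _ _ _ (hUV f hf)
  · intro c d f hac hcd hdb hf hmean
    have hgm : MemLp ((Ioc c d).indicator f) P (iv a b) :=
      (memLp_of_continuousOn hf.continuousOn).indicator measurableSet_Ioc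
    have s0 := hUV _ hgm
    set v := V ((Ioc c d).indicator f)
    set g := (Ioc c d).indicator f with hg
    have hv0 : ∀ᵐ t ∂(iv a c), v t = 0 := by
      rcases hac.eq_or_lt with h | h
      · rw [← h]; simp [iv]
      · refine ((s0.restrict_left hP1 hac (by linarith)).ae_zero hP1
          (hB a c h (by linarith)) (ae_iv_of_forall fun t ht => ?_)).2
        exact indicator_of_notMem (fun h' => by linarith [h'.1, ht.2]) _
    have s1 : Sol ι (fun _ => B) P c b 0 g (U g) v := by
      have := s0.restrict hP1 hac (by linarith : c ≤ b) le_rfl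
      rw [integral_congr_iv hac le_rfl hv0] at this
      simpa using this
    have h1 := s1.lintegral_tail_le hP1 hPt hB hcd hdb (by linarith)
      (ae_iv_of_forall fun t ht => indicator_of_notMem (fun h' => by linarith [h'.2, ht.1]) _)
      (by
        rw [← hmean]
        refine intervalIntegral.integral_congr_ae (Eventually.of_forall fun t ht => ?_)
        rw [uIoc_of_le hcd.le] at ht
        exact indicator_of_mem ht _)
      (memLp_iv_mono hgm hac le_rfl)
    have h2 : eLpNorm g 1 (iv c d) = eLpNorm f 1 (iv c d) :=
      eLpNorm_congr_ae (ae_iv_of_forall fun t ht => indicator_of_mem (Ioo_subset_Ioc_self ht) _)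
    rw [h2] at h1
    have h3 : Ioo a b \ Ioo c (d + (d - c)) ⊆ Ioc a c ∪ Ico (d + (d - c)) b := by
      rintro t ⟨ht1, ht2⟩
      by_cases h : t ≤ c
      · exact Or.inl ⟨ht1.1, h⟩
      · refine Or.inr ⟨?_, ht1.2⟩
        by_contra h'
        exact ht2 ⟨not_le.1 h, not_le.1 h'⟩
    calc _ ≤ (∫⁻ t in Ioc a c, ‖v t‖ₑ) + ∫⁻ t in Ico (d + (d - c)) b, ‖v t‖ₑ :=
          (lintegral_mono_set h3).trans (lintegral_union_le _ _ _)
      _ = 0 + ∫⁻ t in Ioo (d + (d - c)) b, ‖v t‖ₑ := by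
          congr 1
          · rw [setLIntegral_congr Ioo_ae_eq_Ioc.symm]
            refine (lintegral_congr_ae (g := fun _ => 0) ?_).trans (by simp)
            filter_upwards [hv0] with t ht using by simp [ht]
          · exact setLIntegral_congr Ioo_ae_eq_Ico.symm
      _ ≤ _ := by
          rw [zero_add]
          refine h1.trans (le_of_eq ?_)
          push_cast
          ring

lemma exists_tendsto_of_edist_le {E F : Type*} [NormedAddCommGroup E] [NormedAddCommGroup F]
    [CompleteSpace F] {m : Measure ℝ} {r : ℝ≥0∞} (hr : 1 ≤ r) {K : ℝ≥0∞} (hK : K ≠ ∞)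
    {f : ℕ → ℝ → E} {g : ℕ → ℝ → F} {f₀ : ℝ → E} (hf₀ : AEStronglyMeasurable f₀ m)
    (hf : ∀ n, MemLp (f n) r m) (hg : ∀ n, MemLp (g n) r m)
    (hfn : ∀ n, eLpNorm (f n - f₀) r m ≤ (2⁻¹ : ℝ≥0∞) ^ n)
    (hle : ∀ n n', eLpNorm (g n - g n') r m ≤ K * eLpNorm (f n - f n') r m) :
    ∃ g₀, MemLp g₀ r m ∧ Tendsto (fun n => eLpNorm (g n - g₀) r m) atTop (𝓝 0) := by
  have : Fact (1 ≤ r) := ⟨hr⟩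
  have hc : CauchySeq fun n => (hg n).toLp (g n) := by
    refine cauchySeq_of_edist_le_geometric 2⁻¹ (K * 2) (by norm_num) (by finiteness) fun n => ?_
    rw [Lp.edist_toLp_toLp]
    refine (hle n (n + 1)).trans ?_
    rw [mul_assoc]
    gcongr
    have e : f n - f (n + 1) = (f n - f₀) - (f (n + 1) - f₀) := by abel
    rw [e, two_mul]
    refine (eLpNorm_sub_le ((hf n).1.sub hf₀) ((hf (n + 1)).1.sub hf₀) hr).trans ?_
    refine add_le_add (hfn n) ((hfn (n + 1)).trans ?_)
    exact pow_le_pow_right_of_le_one' (by norm_num) (Nat.le_succ n)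
  obtain ⟨G, hG⟩ := cauchySeq_tendsto_of_complete hc
  refine ⟨G, Lp.memLp G, ?_⟩
  rw [Lp.tendsto_Lp_iff_tendsto_eLpNorm'] at hG
  exact hG.congr fun n => eLpNorm_congr_ae ((hg n).coeFn_toLp.sub (ae_eq_refl _))

/-- Graph norm estimate. -/
lemma AutWP.exists_norm_le (hp : 1 < p) (hh : 0 < h) (hB : AutWP ι B (ENNReal.ofReal p) h C) :
    ∃ K : ℝ≥0, ∀ y, ‖y‖ ≤ K * (‖ι y‖ + ‖B y‖) := by
  refine ⟨NNReal.mk (2 * C * (1 + h) / (h / 2)) (by positivity), fun y => ?_⟩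
  have h2 := hB.enorm_le (by simpa using hp.le) (by simp) hh y
  have h3 : (2 : ℝ≥0∞) = ENNReal.ofReal 2 := by simp
  rw [← ofReal_norm, ← ofReal_norm, ← ofReal_norm, ← ENNReal.ofReal_mul hh.le,
    ← ENNReal.ofReal_add (by positivity) (by positivity), ← ENNReal.ofReal_mul (by positivity),
    ← ENNReal.ofReal_coe_nnreal, h3, ← ENNReal.ofReal_mul (by norm_num),
    ← ENNReal.ofReal_mul (by positivity), ENNReal.ofReal_le_ofReal_iff (by positivity)] at h2
  rw [NNReal.coe_mk, div_mul_eq_mul_div, le_div_iff₀ (by positivity)]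
  refine h2.trans ?_
  rw [mul_assoc (2 * (C : ℝ))]
  gcongr
  nlinarith [norm_nonneg (ι y), norm_nonneg (B y)]

lemma eLpNorm_le_of_norm_le {K : ℝ≥0} (hK : ∀ y, ‖y‖ ≤ K * (‖ι y‖ + ‖B y‖)) {m : Measure ℝ}
    {r : ℝ≥0∞} (hr : 1 ≤ r) {u : ℝ → D} (hu : AEStronglyMeasurable u m) :
    eLpNorm u r m ≤ K * (eLpNorm (fun t => ι (u t)) r m + eLpNorm (fun t => B (u t)) r m) := by
  have hm1 : AEStronglyMeasurable (fun t => ι (u t)) m := ι.continuous.comp_aestronglyMeasurable hu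
  have hm2 : AEStronglyMeasurable (fun t => B (u t)) m := B.continuous.comp_aestronglyMeasurable hu
  have h1 := eLpNorm_le_nnreal_smul_eLpNorm_of_ae_le_mul (f := u) (μ := m)
    (g := (fun t => ‖ι (u t)‖) + fun t => ‖B (u t)‖) (c := K)
    (Filter.Eventually.of_forall fun t => by
      rw [← NNReal.coe_le_coe]
      push_cast
      refine (hK (u t)).trans (le_of_eq ?_)
      rw [Pi.add_apply, Real.norm_of_nonneg (by positivity)]) r
  refine h1.trans ?_
  rw [ENNReal.smul_def, smul_eq_mul]
  gcongr
  refine (eLpNorm_add_le hm1.norm hm2.norm hr).trans_eq ?_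
  rw [eLpNorm_norm, eLpNorm_norm]

/-- Extrapolation of maximal regularity to smaller exponents. -/
theorem AutWP.exists_of_lt (hι : Function.Injective ι) (hh : 0 < h) (hq : 1 < q) (hqp : q < p)
    (hB : AutWP ι B (ENNReal.ofReal p) h C) : ∃ C', AutWP ι B (ENNReal.ofReal q) h C' := by
  have hp : 1 < p := hq.trans hqp
  set P := ENNReal.ofReal p with hP
  set Q := ENNReal.ofReal q with hQ
  have hP1 : 1 ≤ P := by simpa [hP] using hp.le
  have hQ1 : 1 ≤ Q := by simpa [hQ] using hq.le
  have hPt : P ≠ ∞ := by simp [hP]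
  have hQt : Q ≠ ∞ := by simp [hQ]
  have hQP : Q ≤ P := ENNReal.ofReal_le_ofReal hqp.le
  refine exists_autWP hQ1 hh ?_ ?_
  · intro a b hab hbh f hf
    obtain ⟨U, V, hUV, hCZ⟩ := hB.exists_solution_operator hp hab hbh
    obtain ⟨K, hK⟩ := CZOperator.exists_eLpNorm_le (X := X) p q C
      (4 * ((2 * C + 2) * (C + C ^ 2) * C)) hq hqp
    have hVb := hK V a b hab hCZ
    -- The L^q-bound is available for continuous functions only. These are dense, and estimates for
    -- differences make the approximating solutions Cauchy in L^q.
    choose g hg1 hg2 using fun n : ℕ => hf.exists_boundedContinuous_eLpNorm_sub_le hQt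
      (ε := (2⁻¹ : ℝ≥0∞) ^ n) (by simp)
    have hgP : ∀ n, MemLp (g n) P (iv a b) := fun n =>
      memLp_of_continuousOn (g n).continuous.continuousOn
    have hs : ∀ n, Sol ι (fun _ => B) P a b 0 (g n) (U (g n)) (V (g n)) := fun n => hUV _ (hgP n)
    have hsq : ∀ n, Sol ι (fun _ => B) Q a b 0 (g n) (U (g n)) (V (g n)) := fun n =>
      (hs n).mono_exponent hQP
    have hfn : ∀ n, eLpNorm (⇑(g n) - f) Q (iv a b) ≤ (2⁻¹ : ℝ≥0∞) ^ n := fun n => by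
      rw [← eLpNorm_neg, neg_sub]; exact hg1 n
    have hVd : ∀ n m, eLpNorm (V (g n) - V (g m)) Q (iv a b)
        ≤ K * eLpNorm (⇑(g n) - ⇑(g m)) Q (iv a b) := by
      intro n m
      have h1 := (hs n).sub hP1 (hs m)
      rw [sub_zero] at h1
      have hc : Continuous fun t => g n t - g m t := (g n).continuous.sub (g m).continuous
      have h2 := (hB a b hab hbh).unique hP1 h1
        (hUV _ (memLp_of_continuousOn hc.continuousOn)) (by simp)
      refine le_trans (le_of_eq (eLpNorm_congr_ae h2.2)) (hVb _ hc)
    obtain ⟨L, hL⟩ := hB.exists_norm_le hp hh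
    have hUd : ∀ n m, eLpNorm (U (g n) - U (g m)) Q (iv a b)
        ≤ (L * (ENNReal.ofReal (b - a) * K + (1 + K))) *
          eLpNorm (⇑(g n) - ⇑(g m)) Q (iv a b) := by
      intro n m
      have h1 := (hsq n).sub hQ1 (hsq m)
      rw [sub_zero] at h1
      have hι2 := h1.eLpNorm_embed_le hQ1 hQt
      -- The equation gives Bu = f - v. Together with the bound on ιu as a primitive of v, the graph
      -- norm estimate then controls u in D.
      have hB2 : eLpNorm (fun t => B ((U (g n) - U (g m)) t)) Q (iv a b)
          ≤ (1 + K) * eLpNorm (⇑(g n) - ⇑(g m)) Q (iv a b) := by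
        calc _ = eLpNorm ((⇑(g n) - ⇑(g m)) - (V (g n) - V (g m))) Q (iv a b) := by
              refine eLpNorm_congr_ae ?_
              filter_upwards [h1.eqn] with t ht
              simp only [Pi.sub_apply] at ht ⊢
              rw [← ht, add_sub_cancel_left]
          _ ≤ _ := eLpNorm_sub_le ((hg2 n).1.sub (hg2 m).1) h1.memV.1 hQ1
          _ ≤ _ := by rw [add_mul, one_mul]; gcongr; exact hVd n m
      calc _ ≤ _ := eLpNorm_le_of_norm_le hL hQ1 h1.memU.1
        _ ≤ L * (ENNReal.ofReal (b - a) * (K * eLpNorm (⇑(g n) - ⇑(g m)) Q (iv a b))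
            + (1 + K) * eLpNorm (⇑(g n) - ⇑(g m)) Q (iv a b)) := by
            gcongr
            · refine hι2.trans ?_
              gcongr
              exact hVd n m
            · exact hB2
        _ = _ := by ring
    obtain ⟨v, hv1, hv2⟩ := exists_tendsto_of_edist_le hQ1 (K := K) (by simp) hf.1 hg2
      (fun n => (hsq n).memV) hfn hVd
    obtain ⟨u, hu1, hu2⟩ := exists_tendsto_of_edist_le hQ1 (by finiteness) hf.1 hg2 (fun n => (hsq n).memU) hfn hUd
    refine ⟨u, v, Sol.of_tendsto hQ1 (OpBdd.const B a b) hsq hu1 hv1 hf hu2 hv2 ?_⟩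
    exact tendsto_of_tendsto_of_tendsto_of_le_of_le tendsto_const_nhds
      (ENNReal.tendsto_pow_atTop_nhds_zero_of_lt_one (by norm_num)) (fun _ => bot_le) hfn
  · intro a b hab hbh u v hs
    -- Integration in time lifts an L^q-solution of the homogeneous problem to exponent p, where
    -- uniqueness is known.
    have h1 := hs.integrate hQ1 P
    have h2 := (h1.ae_zero hP1 (hB a b hab hbh) (by simp)).2
    have hu : ∀ᵐ t ∂(iv a b), u t = 0 := by
      filter_upwards [hs.prim, h2] with t h3 h4
      exact hι (by rw [h3, h4, map_zero])
    refine ⟨hu, ?_⟩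
    filter_upwards [hu, hs.eqn] with t h3 h4
    simpa [h3] using h4

end Extrapolation

end NonAutonomous

namespace NonAutonomous

/-! ### Frozen coefficients: short-time well-posedness and the orbit bound in X. -/

section Freezing

set_option linter.unusedSectionVars false

open Filter Topology
open scoped NNReal

variable {X D : Type*} [NormedAddCommGroup X] [NormedAddCommGroup D]
  [NormedSpace ℝ X] [NormedSpace ℝ D] [CompleteSpace X] [CompleteSpace D] {ι : D →L[ℝ] X}
  {A : ℝ → D →L[ℝ] X} {B : D →L[ℝ] X} {C M : ℝ≥0} {h p q τ : ℝ} {P : ℝ≥0∞}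

lemma AutWP.mono {h' : ℝ} {C' : ℝ≥0} (hB : AutWP ι B P h C) (hh : h' ≤ h) (hC : C ≤ C') :
    AutWP ι B P h' C' :=
  fun a b hab hb => (hB a b hab (by linarith)).mono hC

lemma eLpNorm_le_of_relative_bound {Y : Type*} [NormedAddCommGroup Y] {a b : ℝ} {ε η : ℝ}
    (hε : 0 ≤ ε) (hη : 0 ≤ η) (hP : 1 ≤ P) {w : ℝ → Y} {u : ℝ → D}
    (hu : AEStronglyMeasurable u (iv a b))
    (hw : ∀ᵐ t ∂(iv a b), ‖w t‖ ≤ ε * ‖u t‖ + η * ‖ι (u t)‖) :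
    eLpNorm w P (iv a b) ≤ ENNReal.ofReal ε * eLpNorm u P (iv a b)
      + ENNReal.ofReal η * eLpNorm (fun t => ι (u t)) P (iv a b) := by
  have hm1 : AEStronglyMeasurable (fun t => ι (u t)) (iv a b) :=
    ι.continuous.comp_aestronglyMeasurable hu
  have h1 : eLpNorm w P (iv a b) ≤
      eLpNorm ((ε • fun t => ‖u t‖) + (η • fun t => ‖ι (u t)‖)) P (iv a b) := by
    refine eLpNorm_mono_ae ?_
    filter_upwards [hw] with t ht
    refine ht.trans (le_of_eq ?_)
    simp only [Pi.add_apply, Pi.smul_apply, smul_eq_mul]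
    rw [Real.norm_of_nonneg (by positivity)]
  refine h1.trans ((eLpNorm_add_le (hu.norm.const_smul ε) (hm1.norm.const_smul η) hP).trans
    (le_of_eq ?_))
  rw [eLpNorm_const_smul, eLpNorm_const_smul, eLpNorm_norm, eLpNorm_norm,
    Real.enorm_of_nonneg hε, Real.enorm_of_nonneg hη]

/-- Freezing the coefficients: an operator function which is close to a fixed operator with maximal
regularity is well-posed on short intervals. -/
lemma AutWP.wp_of_close (hP : 1 ≤ P) (hP' : P ≠ ∞) (hB : AutWP ι B P h C) {a b ε η : ℝ}
    (hA : OpBdd A M a b) (hab : a < b) (hbh : b ≤ a + h) (hε : 0 ≤ ε) (hη : 0 ≤ η)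
    (hd : ∀ t ∈ Ioo a b, ∀ y, ‖A t y - B y‖ ≤ ε * ‖y‖ + η * ‖ι y‖)
    (hs : C * (ε + η * (b - a)) ≤ 1 / 2) : WP ι A P a b (2 * C) := by
  refine (hB a b hab hbh).perturb hP (OpBdd.const B a b) hA fun g u v hg => ?_
  have hba : 0 ≤ b - a := by linarith
  have h1 := eLpNorm_le_of_relative_bound hε hη hP hg.memU.1
    (w := fun t => (A t - B) (u t)) (ae_iv_of_forall fun t ht => hd t ht (u t))
  -- The η-term gains a factor b - a, since ιu is the primitive of v; it is therefore small on short
  -- intervals however large η is.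
  have h2 := (hg.eLpNorm_embed_le hP hP').trans
    (mul_le_mul_right ((hB a b hab hbh).boundV _ _ _ hg) _)
  have h3 := (hB a b hab hbh).boundU _ _ _ hg
  calc _ ≤ ENNReal.ofReal ε * (C * eLpNorm g P (iv a b)) + ENNReal.ofReal η *
        (ENNReal.ofReal (b - a) * (C * eLpNorm g P (iv a b))) := h1.trans (by gcongr)
    _ = (C * (ENNReal.ofReal ε + ENNReal.ofReal η * ENNReal.ofReal (b - a)))
        * eLpNorm g P (iv a b) := by ring
    _ ≤ _ := by
        gcongr
        rw [← ENNReal.ofReal_mul hη, ← ENNReal.ofReal_add hε (by positivity),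
          ← ENNReal.ofReal_coe_nnreal, ← ENNReal.ofReal_mul (by positivity)]
        refine (ENNReal.ofReal_le_ofReal hs).trans (le_of_eq ?_)
        rw [one_div, ENNReal.ofReal_inv_of_pos (by norm_num)]
        simp

/-- The modulus-of-continuity part of the relative Dini condition. -/
structure RelCont (ι : D →L[ℝ] X) (A : ℝ → D →L[ℝ] X) (τ η : ℝ) (ω : ℝ → ℝ) : Prop where
  eta_nonneg : 0 ≤ η
  omega_cont : ContinuousOn ω (Icc 0 τ)
  omega_nonneg : ∀ t ∈ Icc 0 τ, 0 ≤ ω t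
  omega_zero : ω 0 = 0
  bound : ∀ y, ∀ s ∈ Icc 0 τ, ∀ t ∈ Icc 0 τ, ‖A t y - A s y‖ ≤ ω |t - s| * ‖y‖ + η * ‖ι y‖

variable {η : ℝ} {ω : ℝ → ℝ}

lemma RelCont.exists_radius (hR : RelCont ι A τ η ω) (hτ : 0 < τ) {ε : ℝ} (hε : 0 < ε) :
    ∃ r, 0 < r ∧ ∀ s ∈ Icc 0 τ, ∀ t ∈ Icc 0 τ, |t - s| < r → ∀ y,
      ‖A t y - A s y‖ ≤ ε * ‖y‖ + η * ‖ι y‖ := by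
  have h1 := hR.omega_cont 0 ⟨le_rfl, hτ.le⟩
  rw [Metric.continuousWithinAt_iff] at h1
  obtain ⟨r, hr, h2⟩ := h1 ε hε
  refine ⟨r, hr, fun s hs t ht hst y => (hR.bound y s hs t ht).trans ?_⟩
  have h3 : |t - s| ∈ Icc 0 τ := ⟨abs_nonneg _, abs_le.2 ⟨by linarith [hs.2, ht.1], by
    linarith [hs.1, ht.2]⟩⟩
  have h4 := h2 h3 (by simpa using hst)
  rw [hR.omega_zero, dist_zero_right] at h4
  gcongr
  exact (le_abs_self _).trans h4.le

/-- Near a point where the frozen operator is well-posed, the frozen operators and the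
non-autonomous problem are uniformly well-posed. -/
lemma RelCont.exists_nhds (hR : RelCont ι A τ η ω) (hτ : 0 < τ) (hA : OpBdd A M 0 τ)
    (hP : 1 ≤ P) (hP' : P ≠ ∞) {s₀ : ℝ} (hs₀ : s₀ ∈ Icc 0 τ) (hh : 0 < h)
    (hB : AutWP ι (A s₀) P h C) :
    ∃ r h' : ℝ, ∃ C' : ℝ≥0, 0 < r ∧ 0 < h' ∧ ∀ s ∈ Icc 0 τ, |s - s₀| < r →
      AutWP ι (A s) P h' C' ∧ ∀ b, s < b → b ≤ s + h' → b ≤ τ → WP ι A P s b C' := by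
  have hη := hR.eta_nonneg
  -- The ω-part and the η-part of the perturbation are each to contribute at most 1/4 to the
  -- threshold 1/2: the first by this choice of ε, the second by the bound on h'.
  obtain ⟨r, hr, h1⟩ := hR.exists_radius hτ (ε := 1 / (4 * (C + 1))) (by positivity)
  set h' := min (min h (r / 2)) (1 / (4 * (C + 1) * (η + 1))) with hh'
  have hpos : 0 < h' := by positivity
  have hle1 : h' ≤ h := (min_le_left _ _).trans (min_le_left _ _)
  have hle2 : h' ≤ r / 2 := (min_le_left _ _).trans (min_le_right _ _)
  have hle3 : h' ≤ 1 / (4 * (C + 1) * (η + 1)) := min_le_right _ _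
  have hsmall : ∀ d : ℝ, d ≤ h' → (C : ℝ) * (1 / (4 * (C + 1)) + η * d) ≤ 1 / 2 := by
    intro d hd
    have e1 : (C : ℝ) * (1 / (4 * (C + 1))) ≤ 1 / 4 := by
      rw [mul_one_div, div_le_div_iff₀ (by positivity) (by norm_num)]
      linarith
    have e2 : (C : ℝ) * (η * d) ≤ 1 / 4 := by
      calc (C : ℝ) * (η * d) ≤ (C + 1) * ((η + 1) * (1 / (4 * (C + 1) * (η + 1)))) := by
            have : η * d ≤ (η + 1) * (1 / (4 * (C + 1) * (η + 1))) := by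
              calc η * d ≤ η * (1 / (4 * (C + 1) * (η + 1))) := by gcongr; exact hd.trans hle3
                _ ≤ _ := by gcongr; linarith
            have h0 : 0 ≤ (η + 1) * (1 / (4 * ((C : ℝ) + 1) * (η + 1))) := by positivity
            calc (C : ℝ) * (η * d) ≤ C * ((η + 1) * (1 / (4 * (C + 1) * (η + 1)))) := by gcongr
              _ ≤ _ := by gcongr; linarith
        _ = 1 / 4 := by field_simp
    rw [mul_add]
    linarith
  refine ⟨r / 2, h', 2 * C, by positivity, hpos, fun s hs hss => ⟨?_, ?_⟩⟩
  · intro a b hab hb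
    refine hB.wp_of_close hP hP' (OpBdd.const (A s) a b) hab (by linarith) (by positivity) hη
      (fun t _ y => h1 s₀ hs₀ s hs (by linarith) y) (hsmall _ (by linarith))
  · intro b hsb hb hbτ
    refine hB.wp_of_close hP hP' (hA.mono hs.1 hbτ) hsb (by linarith) (by positivity) hη
      (fun t ht y => h1 s₀ hs₀ t ⟨by linarith [hs.1, ht.1], by linarith [ht.2]⟩ ?_ y)
      (hsmall _ (by linarith))
    rw [abs_lt] at hss ⊢
    constructor <;> linarith [ht.1, ht.2]

/-- A common exponent of maximal regularity. -/
lemma RelCont.exists_exponent (hι : Function.Injective ι) (hR : RelCont ι A τ η ω) (hτ : 0 < τ)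
    (hA : OpBdd A M 0 τ)
    (hmr : ∀ s ∈ Icc 0 τ, ∃ p C, 1 < p ∧ AutWP ι (A s) (ENNReal.ofReal p) 1 C) :
    ∃ p₀, 1 < p₀ ∧ ∀ q, 1 < q → q ≤ p₀ → ∀ s ∈ Icc 0 τ, ∃ h C, 0 < h ∧
      AutWP ι (A s) (ENNReal.ofReal q) h C := by
  -- Near s₀ all A(s) have maximal regularity at the exponent of A(s₀). Extrapolation reaches every
  -- smaller exponent, so the minimum over a finite cover works everywhere.
  refine isCompact_Icc.induction_on (p := fun S => ∃ p₀ : ℝ, 1 < p₀ ∧ ∀ q, 1 < q → q ≤ p₀ →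
    ∀ s ∈ S, ∃ (h : ℝ) (C : ℝ≥0), 0 < h ∧ AutWP ι (A s) (ENNReal.ofReal q) h C)
    ⟨2, by norm_num, by simp⟩ ?_ ?_ ?_
  · rintro S T hST ⟨p₀, h1, h2⟩
    exact ⟨p₀, h1, fun q hq hq' s hs => h2 q hq hq' s (hST hs)⟩
  · rintro S T ⟨p₀, h1, h2⟩ ⟨p₁, h3, h4⟩
    refine ⟨min p₀ p₁, lt_min h1 h3, fun q hq hq' s hs => ?_⟩
    rcases hs with hs | hs
    · exact h2 q hq (hq'.trans (min_le_left _ _)) s hs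
    · exact h4 q hq (hq'.trans (min_le_right _ _)) s hs
  · intro s₀ hs₀
    obtain ⟨p, C, hp, hB⟩ := hmr s₀ hs₀
    obtain ⟨r, h', C', hr, hh', h1⟩ := hR.exists_nhds hτ hA (by simpa using hp.le) (by simp) hs₀
      one_pos hB
    refine ⟨Metric.ball s₀ r ∩ Icc 0 τ, inter_mem (mem_nhdsWithin_of_mem_nhds (Metric.ball_mem_nhds _ hr)) self_mem_nhdsWithin,
      p, hp, fun q hq hqp s hs => ?_⟩
    have h2 := (h1 s hs.2 hs.1).1
    rcases hqp.eq_or_lt with rfl | hlt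
    · exact ⟨h', C', hh', h2⟩
    · obtain ⟨C'', h3⟩ := h2.exists_of_lt hι hh' hq hlt
      exact ⟨h', C'', hh', h3⟩

/-- Uniform well-posedness of the frozen and of the non-autonomous problems. -/
lemma RelCont.exists_uniform (hR : RelCont ι A τ η ω) (hτ : 0 < τ) (hA : OpBdd A M 0 τ)
    (hP : 1 ≤ P) (hP' : P ≠ ∞)
    (hB : ∀ s ∈ Icc 0 τ, ∃ h C, 0 < h ∧ AutWP ι (A s) P h C) :
    ∃ h C, 0 < h ∧ ∀ s ∈ Icc 0 τ, AutWP ι (A s) P h C ∧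
      ∀ b, s < b → b ≤ s + h → b ≤ τ → WP ι A P s b C := by
  refine isCompact_Icc.induction_on (p := fun S => ∃ (h : ℝ) (C : ℝ≥0), 0 < h ∧ ∀ s ∈ S,
    AutWP ι (A s) P h C ∧ ∀ b, s < b → b ≤ s + h → b ≤ τ → WP ι A P s b C)
    ⟨1, 0, one_pos, by simp⟩ ?_ ?_ ?_
  · rintro S T hST ⟨h, C, h1, h2⟩
    exact ⟨h, C, h1, fun s hs => h2 s (hST hs)⟩
  · rintro S T ⟨h, C, h1, h2⟩ ⟨h', C', h3, h4⟩
    refine ⟨min h h', max C C', lt_min h1 h3, fun s hs => ?_⟩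
    rcases hs with hs | hs
    · exact ⟨(h2 s hs).1.mono (min_le_left _ _) (le_max_left _ _), fun b hsb hb hbτ =>
        ((h2 s hs).2 b hsb (by linarith [min_le_left h h']) hbτ).mono (le_max_left _ _)⟩
    · exact ⟨(h4 s hs).1.mono (min_le_right _ _) (le_max_right _ _), fun b hsb hb hbτ =>
        ((h4 s hs).2 b hsb (by linarith [min_le_right h h']) hbτ).mono (le_max_right _ _)⟩
  · intro s₀ hs₀
    obtain ⟨h, C, hh, h1⟩ := hB s₀ hs₀
    obtain ⟨r, h', C', hr, hh', h2⟩ := hR.exists_nhds hτ hA hP hP' hs₀ hh h1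
    exact ⟨Metric.ball s₀ r ∩ Icc 0 τ, inter_mem (mem_nhdsWithin_of_mem_nhds (Metric.ball_mem_nhds _ hr)) self_mem_nhdsWithin,
      h', C', hh', fun s hs => h2 s hs.2 hs.1⟩

lemma eLpNorm_shift_le {Y : Type*} [NormedAddCommGroup Y] (φ : ℝ → Y) {a b : ℝ} (ha : 0 ≤ a)
    (hb : b ≤ τ) (hφ : AEStronglyMeasurable φ (iv 0 τ)) :
    eLpNorm (fun t => φ (t - a)) P (iv a b) ≤ eLpNorm φ P (iv 0 τ) := by
  have h1 := measurePreserving_shift 0 (b - a) (-a)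
  have h2 : eLpNorm (fun t => φ (t + -a)) P (iv (0 - -a) (b - a - -a))
      = eLpNorm φ P (iv 0 (b - a)) :=
    eLpNorm_comp_measurePreserving (hφ.mono_measure (iv_mono le_rfl (by linarith))) h1
  have e1 : (0 : ℝ) - -a = a := by ring
  have e2 : b - a - -a = b := by ring
  rw [e1, e2] at h2
  simp only [sub_eq_add_neg]
  rw [h2]
  exact eLpNorm_iv_mono _ le_rfl (by linarith)

/-- Boundedness in `X` of the orbits of the non-autonomous problem, in terms of the norm in `X`
of the initial value. -/
lemma RelCont.exists_orbit_bound (hR : RelCont ι A τ η ω) (hP : 1 ≤ P) (hP' : P ≠ ∞)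
    (hω : MemLp (fun t => ω t / t) P (iv 0 τ)) (hh : 0 < h)
    (hW : ∀ s ∈ Icc 0 τ, AutWP ι (A s) P h C ∧
      ∀ b, s < b → b ≤ s + h → b ≤ τ → WP ι A P s b C) :
    ∃ K : ℝ≥0, ∀ a b y u v, 0 ≤ a → a < b → b ≤ a + h → b ≤ τ →
      Sol ι A P a b (ι y) (fun _ => 0) u v →
      ∀ t ∈ Icc a b, ‖ι y + ∫ r in a..t, v r‖ₑ ≤ K * ‖ι y‖ₑ := by
  have hη := hR.eta_nonneg
  -- The smoothing constant of `Sol.orbit_enorm_D_le`, divided by its factor h/2. It depends on C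
  -- and h only, hence is uniform in the freezing point.
  set K₁ : ℝ≥0∞ := 2 * C * (ENNReal.ofReal h * (C ^ 2 + (C ^ 2 + C * (2 * C ^ 2 + C))))
    * (ENNReal.ofReal (h / 2))⁻¹ with hK₁
  have hh2 : ENNReal.ofReal (h / 2) ≠ 0 := by simpa using hh
  have hK₁t : K₁ ≠ ∞ := by finiteness
  set Ω := eLpNorm (fun t => ω t / t) P (iv 0 τ)
  have hΩ : Ω ≠ ∞ := hω.2.ne
  set T : ℝ≥0∞ := ENNReal.ofReal h ^ (1 / P.toReal) with hT
  have hTt : T ≠ ∞ := ENNReal.rpow_ne_top_of_nonneg (by positivity) (by simp)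
  have hPr : 1 ≤ P.toReal := by simpa using (ENNReal.toReal_le_toReal (by simp) hP').2 hP
  set T' : ℝ≥0∞ := ENNReal.ofReal h ^ (1 - 1 / P.toReal) with hT'
  have hcon : 0 ≤ 1 - 1 / P.toReal := by
    rw [sub_nonneg, div_le_one] <;> linarith
  have hTt' : T' ≠ ∞ := ENNReal.rpow_ne_top_of_nonneg hcon (by simp)
  set K : ℝ≥0∞ := (C ^ 2 + 1) + T' * (C * (K₁ * Ω + ENNReal.ofReal η * (C ^ 2 + 1) * T)) with hK
  have hKt : K ≠ ∞ := by finiteness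
  refine ⟨K.toNNReal, fun a b y u v ha hab hbh hbτ hs t ht => ?_⟩
  rw [ENNReal.coe_toNNReal hKt]
  have haτ : a ∈ Icc 0 τ := ⟨ha, by linarith⟩
  obtain ⟨hF, hN⟩ := hW a haτ
  have hWP := hN b hab hbh hbτ
  obtain ⟨u₀, v₀, hs₀⟩ := (hF a b hab hbh).exists_iv hP (OpBdd.const (A a) a b) y
    (f := fun _ => 0) (memLp_const 0)
  have hx : ∀ c ∈ Icc a b, ‖ι y + ∫ r in a..c, v₀ r‖ₑ ≤ (C ^ 2 + 1) * ‖ι y‖ₑ := by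
    intro c hc
    rcases hc.1.eq_or_lt with rfl | h1
    · rw [intervalIntegral.integral_same, add_zero]
      exact le_mul_of_one_le_left' (by simp)
    · refine (hs₀.orbit_enorm_le hP hP' hF hbh h1 hc.2).trans ?_
      gcongr
      simp
  have hD := hs₀.orbit_enorm_D_le hP hP' hh hF hab hbh
  -- Compare with the orbit frozen at the initial time a: the difference starts at zero and has
  -- right-hand side (A(a) - A(t))u₀.
  have hdiff : Sol ι A P a b 0 (fun t => A a (u₀ t) - A t (u₀ t)) (fun t => u t - u₀ t)
      (fun t => v t - v₀ t) := by
    have h1 : Sol ι A P a b (ι y) (fun t => A t (u₀ t) - A a (u₀ t)) u₀ v₀ := by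
      refine hs₀.congr_op ?_
      filter_upwards [hs₀.eqn] with t ht
      rw [eq_neg_of_add_eq_zero_left ht]; abel
    have h2 := hs.sub hP h1
    rw [sub_self] at h2
    exact h2.congr (Eventually.of_forall fun t => by simp)
  have hDm : ∀ᵐ t ∂(iv a b), ENNReal.ofReal (t - a) * ‖u₀ t‖ₑ ≤ K₁ * ‖ι y‖ₑ := by
    filter_upwards [hD] with t ht
    rw [hK₁, mul_right_comm]
    rwa [← ENNReal.div_eq_inv_mul.trans (mul_comm _ _), ENNReal.le_div_iff_mul_le (Or.inl hh2) (Or.inl (by simp))]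
  have hg : eLpNorm (fun t => A a (u₀ t) - A t (u₀ t)) P (iv a b)
      ≤ (K₁ * Ω + ENNReal.ofReal η * (C ^ 2 + 1) * T) * ‖ι y‖ₑ := by
    -- The singularity 1/(t-a) of ‖u₀(t)‖_D is paired with ω(t-a); the Dini condition says exactly
    -- that the quotient is p-integrable.
    set φ : ℝ → ℝ := fun t => ω (t - a) / (t - a) with hφ
    have hφm : AEStronglyMeasurable φ (iv a b) := by
      have h1 := measurePreserving_shift 0 (b - a) (-a)
      have e1 : (0 : ℝ) - -a = a := by ring
      have e2 : b - a - -a = b := by ring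
      rw [e1, e2] at h1
      exact (hω.1.mono_measure (iv_mono le_rfl (by linarith))).comp_measurePreserving h1
    have hpt : ∀ᵐ t ∂(iv a b), ‖A a (u₀ t) - A t (u₀ t)‖ₑ
        ≤ ‖((K₁.toReal * ‖ι y‖) • φ + (fun _ => η * ((C ^ 2 + 1) * ‖ι y‖) : ℝ → ℝ)) t‖ₑ := by
      filter_upwards [hDm, hs₀.prim, ae_iv_mem a b] with t h1 h2 ht
      have hta : 0 < t - a := by linarith [ht.1]
      have hmem : t - a ∈ Icc 0 τ := ⟨hta.le, by linarith [ht.2]⟩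
      have h3 := hR.bound (u₀ t) t ⟨by linarith [ht.1], by linarith [ht.2]⟩ a haτ
      rw [abs_sub_comm, abs_of_pos hta] at h3
      have h4 : ‖ι (u₀ t)‖ ≤ (C ^ 2 + 1) * ‖ι y‖ := by
        have := hx t (Ioo_subset_Icc_self ht)
        rw [← h2] at this
        rw [← enorm_norm (ι (u₀ t)), ← enorm_norm (ι y), Real.enorm_of_nonneg (norm_nonneg _),
          Real.enorm_of_nonneg (norm_nonneg _), ← ENNReal.ofReal_coe_nnreal, ← ENNReal.ofReal_pow
          (by positivity), ← ENNReal.ofReal_one, ← ENNReal.ofReal_add (by positivity) (by positivity), ← ENNReal.ofReal_mul (by positivity)] at this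
        exact (ENNReal.ofReal_le_ofReal_iff (by positivity)).1 this
      have h5 : (t - a) * ‖u₀ t‖ ≤ K₁.toReal * ‖ι y‖ := by
        rw [← ENNReal.ofReal_toReal hK₁t, ← ofReal_norm, ← ofReal_norm, ← ENNReal.ofReal_mul hta.le,
          ← ENNReal.ofReal_mul (by positivity)] at h1
        exact (ENNReal.ofReal_le_ofReal_iff (by positivity)).1 h1
      have hωn := hR.omega_nonneg _ hmem
      rw [enorm_le_iff_norm_le]
      refine h3.trans ?_
      simp only [Pi.add_apply, Pi.smul_apply, smul_eq_mul, hφ]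
      rw [Real.norm_of_nonneg (by positivity)]
      refine add_le_add ?_ (by gcongr)
      rw [mul_div_assoc', le_div_iff₀ hta]
      calc _ = ω (t - a) * ((t - a) * ‖u₀ t‖) := by ring
        _ ≤ ω (t - a) * (K₁.toReal * ‖ι y‖) := by gcongr
        _ = _ := by ring
    calc _ ≤ _ := eLpNorm_mono_enorm_ae hpt
      _ ≤ _ := eLpNorm_add_le (hφm.const_smul _) aestronglyMeasurable_const hP
      _ ≤ K₁ * ‖ι y‖ₑ * Ω + ENNReal.ofReal η * ((C ^ 2 + 1) * ‖ι y‖ₑ) * T := by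
          have e1 : ‖K₁.toReal * ‖ι y‖‖ₑ = K₁ * ‖ι y‖ₑ := by
            rw [enorm_mul, enorm_norm, Real.enorm_of_nonneg (by positivity),
              ENNReal.ofReal_toReal hK₁t]
          have e2 : ‖η * (((C : ℝ) ^ 2 + 1) * ‖ι y‖)‖ₑ
              = ENNReal.ofReal η * ((C ^ 2 + 1) * ‖ι y‖ₑ) := by
            rw [enorm_mul, enorm_mul, enorm_norm, Real.enorm_of_nonneg hη,
              Real.enorm_of_nonneg (by positivity : (0 : ℝ) ≤ (C : ℝ) ^ 2 + 1),
              ENNReal.ofReal_add (by positivity) (by positivity),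
              ENNReal.ofReal_pow (by positivity)]
            simp
          have e3 : ENNReal.ofReal (b - a) ^ (1 / P.toReal) ≤ T :=
            ENNReal.rpow_le_rpow (ENNReal.ofReal_le_ofReal (by linarith)) (by positivity)
          rw [eLpNorm_const_smul, e1]
          refine add_le_add (mul_le_mul_right
            (eLpNorm_shift_le (fun t => ω t / t) ha hbτ hω.1) _) ?_
          exact (eLpNorm_const_iv_le (Eventually.of_forall fun t => e2.le)).trans
            (mul_le_mul_right e3 _)
      _ = _ := by ring
  have h1 := hdiff.enorm_prim_le hP ht.1 ht.2
  have h2 : ι y + ∫ r in a..t, v r = (ι y + ∫ r in a..t, v₀ r) + ∫ r in a..t, (v r - v₀ r) := by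
    rw [intervalIntegral.integral_sub (hs.intervalIntegrable hP ⟨le_rfl, hab.le⟩ ht)
      (hs₀.intervalIntegrable hP ⟨le_rfl, hab.le⟩ ht)]
    abel
  rw [h2]
  refine (enorm_add_le _ _).trans ?_
  calc _ ≤ (C ^ 2 + 1) * ‖ι y‖ₑ + T' * (C * ((K₁ * Ω + ENNReal.ofReal η * (C ^ 2 + 1) * T) * ‖ι y‖ₑ)) := by
        refine add_le_add (hx t ht) (h1.trans ?_)
        refine mul_le_mul' (ENNReal.rpow_le_rpow (ENNReal.ofReal_le_ofReal (by linarith)) hcon) ?_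
        · exact (hWP.boundV _ _ _ hdiff).trans (by gcongr)
    _ = _ := by rw [hK]; ring

end Freezing

end NonAutonomous

namespace NonAutonomous

/-! ### Gluing short intervals. -/

section Globalization

set_option linter.unusedSectionVars false

open Filter Topology
open scoped NNReal

variable {X D : Type*} [NormedAddCommGroup X] [NormedAddCommGroup D]
  [NormedSpace ℝ X] [NormedSpace ℝ D] [CompleteSpace X] [CompleteSpace D] {ι : D →L[ℝ] X}
  {A : ℝ → D →L[ℝ] X} {C K M : ℝ≥0} {h τ a b c : ℝ} {P : ℝ≥0∞} {x : X} {y : D}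
  {f v : ℝ → X} {u : ℝ → D}

/-- Uniform well-posedness on short intervals. -/
def LocWP (ι : D →L[ℝ] X) (A : ℝ → D →L[ℝ] X) (P : ℝ≥0∞) (τ h : ℝ) (C : ℝ≥0) : Prop :=
  ∀ a b, 0 ≤ a → a < b → b ≤ a + h → b ≤ τ → WP ι A P a b C

lemma exists_nat_step (hh : 0 < h) (τ : ℝ) : ∃ n : ℕ, τ ≤ n * (h / 2) := by
  obtain ⟨n, hn⟩ := exists_nat_ge (τ / (h / 2))
  exact ⟨n, by rwa [div_le_iff₀ (by positivity)] at hn⟩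

lemma Sol.exists_mem_D (hs : Sol ι A P a b x f u v) {c d : ℝ} (hac : a ≤ c)
    (hcd : c < d) (hdb : d ≤ b) : ∃ t ∈ Ioo c d, ι (u t) = x + ∫ r in a..t, v r :=
  exists_of_ae_iv hcd (ae_iv_mono hac hdb hs.prim)

lemma LocWP.exists_iv (hP : 1 ≤ P) (hA : OpBdd A M 0 τ) (hh : 0 < h) (hW : LocWP ι A P τ h C)
    (ha : 0 ≤ a) (hab : a < b) (hb : b ≤ τ) (y : D) (hf : MemLp f P (iv a b)) :
    ∃ u v, Sol ι A P a b (ι y) f u v := by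
  have key : ∀ n : ℕ, ∀ a y, 0 ≤ a → a < b → b ≤ a + h + n * (h / 2) → MemLp f P (iv a b) →
      ∃ u v, Sol ι A P a b (ι y) f u v := by
    intro n
    induction n with
    | zero =>
      intro a y ha hab hbn hf
      exact (hW a b ha hab (by simpa using hbn) hb).exists_iv hP (hA.mono ha hb) y hf
    | succ n ih =>
      intro a y ha hab hbn hf
      by_cases hbh : b ≤ a + h
      · exact (hW a b ha hab hbh hb).exists_iv hP (hA.mono ha hb) y hf
      push Not at hbh
      obtain ⟨u, v, hs⟩ := (hW a (a + h) ha (by linarith) le_rfl (by linarith)).exists_iv hP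
        (hA.mono ha (by linarith)) y (memLp_iv_mono hf le_rfl hbh.le)
      obtain ⟨c, hc, hcD⟩ := hs.exists_mem_D (c := a + h / 2) (by linarith) (by linarith) le_rfl
      push_cast at hbn
      obtain ⟨u', v', hs'⟩ := ih c (u c) (by linarith [hc.1]) (by linarith [hc.2])
        (by linarith [hc.1]) (memLp_iv_mono hf (by linarith [hc.1]) le_rfl)
      rw [hcD] at hs'
      exact ⟨_, _, (hs.restrict_left hP (by linarith [hc.1]) hc.2.le).concat hP
        (by linarith [hc.1]) hs'⟩
  obtain ⟨n, hn⟩ := exists_nat_step hh τ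
  exact key n a y ha hab (by linarith) hf

lemma LocWP.ae_zero (hP : 1 ≤ P) (hh : 0 < h) (hW : LocWP ι A P τ h C)
    (ha : 0 ≤ a) (hb : b ≤ τ) (hs : Sol ι A P a b 0 (fun _ => 0) u v) :
    (∀ᵐ t ∂(iv a b), u t = 0) ∧ ∀ᵐ t ∂(iv a b), v t = 0 := by
  have key : ∀ n : ℕ, ∀ a, 0 ≤ a → b ≤ a + h + n * (h / 2) → Sol ι A P a b 0 (fun _ => 0) u v →
      (∀ᵐ t ∂(iv a b), u t = 0) ∧ ∀ᵐ t ∂(iv a b), v t = 0 := by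
    intro n
    have base : ∀ a, 0 ≤ a → b ≤ a + h → Sol ι A P a b 0 (fun _ => 0) u v →
        (∀ᵐ t ∂(iv a b), u t = 0) ∧ ∀ᵐ t ∂(iv a b), v t = 0 := by
      intro a ha hbh hs
      rcases le_or_gt b a with hab | hab
      · simp [iv, Ioo_eq_empty (not_lt.2 hab)]
      · exact hs.ae_zero hP (hW a b ha hab hbh hb) (by simp)
    induction n with
    | zero => intro a ha hbn; exact base a ha (by simpa using hbn)
    | succ n ih =>
      intro a ha hbn hs
      by_cases hbh : b ≤ a + h
      · exact base a ha hbh hs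
      push Not at hbh
      obtain ⟨h1, h2⟩ := (hs.restrict_left hP (d := a + h) (by linarith) hbh.le).ae_zero hP
        (hW a (a + h) ha (by linarith) le_rfl (by linarith)) (by simp)
      have hs' := hs.restrict hP (c := a + h) (by linarith) hbh.le le_rfl
      rw [integral_congr_iv (v' := fun _ => 0) (by linarith) le_rfl h2] at hs'
      push_cast at hbn
      obtain ⟨h3, h4⟩ := ih (a + h) (by linarith) (by linarith) (by simpa using hs')
      exact ⟨ae_iv_split h1 h3, ae_iv_split h2 h4⟩
  obtain ⟨n, hn⟩ := exists_nat_step hh τ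
  exact key n a ha (by linarith) hs

/-- Well-posedness on short intervals implies well-posedness on all subintervals. -/
lemma LocWP.exists_wp (hP : 1 ≤ P) (hτ : 0 < τ) (hA : OpBdd A M 0 τ) (hh : 0 < h)
    (hW : LocWP ι A P τ h C) : ∃ C', ∀ a b, 0 ≤ a → a < b → b ≤ τ → WP ι A P a b C' := by
  have hex : ∀ a b, 0 ≤ a → a < b → b ≤ τ → ∀ f, MemLp f P (iv a b) →
      ∃ u v, Sol ι A P a b 0 f u v := by
    intro a b ha hab hb f hf
    simpa using hW.exists_iv hP hA hh ha hab hb 0 hf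
  obtain ⟨C', hC'⟩ := exists_WP hP hA (hex 0 τ le_rfl hτ le_rfl)
    fun u v hs => hW.ae_zero hP hh le_rfl le_rfl hs
  have main : ∀ a b, 0 ≤ a → a < b → b ≤ τ → ∀ f u v, Sol ι A P a b 0 f u v →
      eLpNorm u P (iv a b) ≤ C' * eLpNorm f P (iv a b) ∧
      eLpNorm v P (iv a b) ≤ C' * eLpNorm f P (iv a b) := by
    intro a b ha hab hb f u v hs
    have hf : MemLp f P (iv a b) := by
      refine (hs.memV.add ((hA.mono ha hb).memLp hs.memU)).ae_eq ?_
      filter_upwards [hs.eqn] with t ht using ht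
    -- The constant of (0,τ) serves every subinterval: extend f by zero, and note that the solution
    -- vanishes up to a and agrees with the given one on (a,b).
    obtain ⟨u', v', hs'⟩ := hC'.exists_sol _ (memLp_extend_zero (a := 0) (b := τ) hf)
    have h1 : (∀ᵐ t ∂(iv a b), (if t ≤ a then 0 else u t) - u' t = 0) ∧
        ∀ᵐ t ∂(iv a b), (if t ≤ a then 0 else v t) - v' t = 0 := by
      have h2 := ((hs.extend_left hP ha).sub hP (hs'.restrict_left hP (by linarith) hb)).congr
        (f' := fun _ => 0) (ae_iv_of_forall fun t ht => by
          by_cases hta : t ≤ a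
          · simp [hta]
          · simp [hta, indicator_of_mem (show t ∈ Ioo a b from ⟨not_le.1 hta, ht.2⟩)])
      rw [sub_zero] at h2
      obtain ⟨h3, h4⟩ := hW.ae_zero hP hh le_rfl hb h2
      exact ⟨ae_iv_mono ha le_rfl h3, ae_iv_mono ha le_rfl h4⟩
    have e1 : eLpNorm u P (iv a b) = eLpNorm u' P (iv a b) := eLpNorm_congr_ae (by
      filter_upwards [h1.1, ae_iv_mem a b] with t h2 ht
      rwa [if_neg (not_le.2 ht.1), sub_eq_zero] at h2)
    have e2 : eLpNorm v P (iv a b) = eLpNorm v' P (iv a b) := eLpNorm_congr_ae (by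
      filter_upwards [h1.2, ae_iv_mem a b] with t h2 ht
      rwa [if_neg (not_le.2 ht.1), sub_eq_zero] at h2)
    rw [e1, e2]
    constructor
    · refine (eLpNorm_iv_mono u' ha hb).trans ((hC'.boundU _ _ _ hs').trans ?_)
      gcongr
      exact eLpNorm_extend_zero_le _
    · refine (eLpNorm_iv_mono v' ha hb).trans ((hC'.boundV _ _ _ hs').trans ?_)
      gcongr
      exact eLpNorm_extend_zero_le _
  exact ⟨C', fun a b ha hab hb => ⟨hex a b ha hab hb,
    fun f u v hs => (main a b ha hab hb f u v hs).1,
    fun f u v hs => (main a b ha hab hb f u v hs).2⟩⟩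

/-- Well-posedness of the non-autonomous problem on all subintervals of `[0,τ]`, together with a
bound for its orbits in terms of the norm in `X` of the initial value. -/
structure EvolWP (ι : D →L[ℝ] X) (A : ℝ → D →L[ℝ] X) (P : ℝ≥0∞) (τ : ℝ) (M C K : ℝ≥0) :
    Prop where
  opBdd : OpBdd A M 0 τ
  wp : ∀ a b, 0 ≤ a → a < b → b ≤ τ → WP ι A P a b C
  orbit : ∀ a b y u v, 0 ≤ a → a ≤ b → b ≤ τ → Sol ι A P a b (ι y) (fun _ => 0) u v →
    ∀ t ∈ Icc a b, ‖ι y + ∫ r in a..t, v r‖ₑ ≤ K * ‖ι y‖ₑ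

lemma LocWP.exists_evolWP (hP : 1 ≤ P) (hτ : 0 < τ) (hA : OpBdd A M 0 τ) (hh : 0 < h)
    (hW : LocWP ι A P τ h C)
    (hK : ∀ a b y u v, 0 ≤ a → a < b → b ≤ a + h → b ≤ τ →
      Sol ι A P a b (ι y) (fun _ => 0) u v →
      ∀ t ∈ Icc a b, ‖ι y + ∫ r in a..t, v r‖ₑ ≤ K * ‖ι y‖ₑ) :
    ∃ C' K', EvolWP ι A P τ M C' K' := by
  obtain ⟨C', hC'⟩ := hW.exists_wp hP hτ hA hh
  -- Each restart costs a factor K + 1; the summand 1 covers the trivial case a = b and makes the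
  -- powers increasing.
  have key : ∀ n : ℕ, ∀ a b y u v, 0 ≤ a → a ≤ b → b ≤ a + h + n * (h / 2) → b ≤ τ →
      Sol ι A P a b (ι y) (fun _ => 0) u v →
      ‖ι y + ∫ r in a..b, v r‖ₑ ≤ ((K + 1) ^ (n + 1) : ℝ≥0) * ‖ι y‖ₑ := by
    intro n
    have base : ∀ a b y u v, 0 ≤ a → a ≤ b → b ≤ a + h → b ≤ τ →
        Sol ι A P a b (ι y) (fun _ => 0) u v →
        ‖ι y + ∫ r in a..b, v r‖ₑ ≤ ((K + 1) : ℝ≥0) * ‖ι y‖ₑ := by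
      intro a b y u v ha hab hbh hb hs
      rcases hab.eq_or_lt with rfl | hab
      · rw [intervalIntegral.integral_same, add_zero]
        exact le_mul_of_one_le_left' (by simp)
      · refine (hK a b y u v ha hab hbh hb hs b ⟨hab.le, le_rfl⟩).trans ?_
        gcongr
        simp
    induction n with
    | zero =>
      intro a b y u v ha hab hbn hb hs
      simpa using base a b y u v ha hab (by simpa using hbn) hb hs
    | succ n ih =>
      intro a b y u v ha hab hbn hb hs
      by_cases hbh : b ≤ a + h
      · refine (base a b y u v ha hab hbh hb hs).trans ?_
        gcongr
        exact le_self_pow₀ (by simp) (by simp)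
      push Not at hbh
      obtain ⟨c, hc, hcD⟩ := hs.exists_mem_D (c := a + h / 2) (d := a + h) (by linarith)
        (by linarith) hbh.le
      push_cast at hbn
      have h1 := base a c y u v ha (by linarith [hc.1]) hc.2.le (by linarith [hc.2])
        (hs.restrict_left hP (by linarith [hc.1]) (by linarith [hc.2]))
      have h2 := hs.restrict hP (c := c) (by linarith [hc.1]) (by linarith [hc.2]) le_rfl
      rw [← hcD] at h2 h1
      have h3 := ih c b (u c) u v (by linarith [hc.1]) (by linarith [hc.2]) (by linarith [hc.1])
        hb h2
      rw [hcD, add_assoc, intervalIntegral.integral_add_adjacent_intervals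
        (hs.intervalIntegrable hP ⟨le_rfl, hab⟩ ⟨by linarith [hc.1], by linarith [hc.2]⟩)
        (hs.intervalIntegrable hP ⟨by linarith [hc.1], by linarith [hc.2]⟩ ⟨hab, le_rfl⟩),
        ← hcD] at h3
      refine h3.trans ?_
      calc _ ≤ ((K + 1) ^ (n + 1) : ℝ≥0) * (((K + 1) : ℝ≥0) * ‖ι y‖ₑ) := by gcongr
        _ = _ := by rw [← mul_assoc, ← ENNReal.coe_mul, ← pow_succ]
  obtain ⟨n, hn⟩ := exists_nat_step hh τ
  refine ⟨C', (K + 1) ^ (n + 1), hA, hC', fun a b y u v ha hab hb hs t ht => ?_⟩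
  exact key n a t y u v ha ht.1 (by linarith [ht.2]) (by linarith [ht.2])
    (hs.restrict_left hP ht.1 ht.2)

lemma EvolWP.unique (hP : 1 ≤ P) (hE : EvolWP ι A P τ M C K) (ha : 0 ≤ a) (hb : b ≤ τ)
    {u' : ℝ → D} {v' : ℝ → X} (hs : Sol ι A P a b x f u v) (hs' : Sol ι A P a b x f u' v') :
    (∀ᵐ t ∂(iv a b), u t = u' t) ∧ ∀ᵐ t ∂(iv a b), v t = v' t := by
  rcases le_or_gt b a with hab | hab
  · simp [iv, Ioo_eq_empty (not_lt.2 hab)]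
  · exact (hE.wp a b ha hab hb).unique hP hs hs' (by simp)

lemma EvolWP.exists_iv (hP : 1 ≤ P) (hE : EvolWP ι A P τ M C K) (ha : 0 ≤ a) (hb : b ≤ τ)
    (y : D) (hf : MemLp f P (iv a b)) : ∃ u v, Sol ι A P a b (ι y) f u v := by
  rcases le_or_gt b a with hab | hab
  · have : iv a b = 0 := by simp [iv, Ioo_eq_empty (not_lt.2 hab)]
    exact ⟨fun _ => y, fun _ => 0, by simp [this], by simp [this], by simp [this], by simp [this]⟩
  · exact (hE.wp a b ha hab hb).exists_iv hP (hE.opBdd.mono ha hb) y hf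

/-- The orbit bound for arbitrary initial values in `X`. -/
lemma EvolWP.enorm_le (hP : 1 ≤ P) (hE : EvolWP ι A P τ M C K) (ha : 0 ≤ a) (hb : b ≤ τ)
    (hs : Sol ι A P a b x (fun _ => 0) u v) {t : ℝ} (hat : a < t) (htb : t ≤ b) :
    ‖x + ∫ r in a..t, v r‖ₑ ≤ K * ‖x‖ₑ := by
  have hab : a ≤ b := by linarith
  have hcont := hs.continuousOn hP hab
  -- The value at almost every c > a lies in the image of D, so the orbit bound applies from c.
  -- Letting c tend to a gives the bound for x by continuity.
  have h1 : ∀ᵐ c ∂(iv a t), ‖x + ∫ r in a..t, v r‖ₑ ≤ K * ‖x + ∫ r in a..c, v r‖ₑ := by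
    filter_upwards [ae_iv_mono le_rfl htb hs.prim, ae_iv_mem a t] with c hcD hc
    have h2 := hs.restrict hP (c := c) hc.1.le (by linarith [hc.2]) le_rfl
    rw [← hcD] at h2
    have h3 := hE.orbit c b (u c) u v (by linarith [hc.1]) (by linarith [hc.2]) hb h2 t
      ⟨hc.2.le, htb⟩
    rw [hcD, add_assoc, intervalIntegral.integral_add_adjacent_intervals
      (hs.intervalIntegrable hP ⟨le_rfl, hab⟩ ⟨hc.1.le, by linarith [hc.2]⟩)
      (hs.intervalIntegrable hP ⟨hc.1.le, by linarith [hc.2]⟩ ⟨hat.le, htb⟩), ← hcD] at h3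
    rwa [← hcD]
  by_contra hcon
  push Not at hcon
  have h2 : ContinuousWithinAt (fun c => (K : ℝ≥0∞) * ‖x + ∫ r in a..c, v r‖ₑ) (Icc a b) a :=
    ENNReal.Tendsto.const_mul (continuous_enorm.continuousAt.comp_continuousWithinAt
      (hcont a ⟨le_rfl, hab⟩)) (Or.inr (by simp))
  have h3 : Tendsto (fun c => (K : ℝ≥0∞) * ‖x + ∫ r in a..c, v r‖ₑ) (𝓝[Icc a b] a)
      (𝓝 (K * ‖x‖ₑ)) := by
    have := h2.tendsto
    simpa using this
  have h4 := h3.eventually_lt_const hcon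
  rw [eventually_nhdsWithin_iff, Metric.eventually_nhds_iff] at h4
  obtain ⟨ε, hε, h5⟩ := h4
  obtain ⟨c, hc, h6⟩ := exists_of_ae_iv (b := min t (a + ε)) (lt_min hat (by linarith))
    (ae_iv_mono le_rfl (min_le_left _ _) h1)
  have hc1 : c < t := hc.2.trans_le (min_le_left _ _)
  have hc2 : c < a + ε := hc.2.trans_le (min_le_right _ _)
  refine absurd h6 (not_le.2 (h5 ?_ ⟨hc.1.le, by linarith⟩))
  rw [Real.dist_eq, abs_of_pos (by linarith [hc.1])]
  linarith

/-- Orbits starting in `D`: bound for the derivative. -/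
lemma EvolWP.eLpNorm_deriv_le (hP : 1 ≤ P) (hE : EvolWP ι A P τ M C K) (ha : 0 ≤ a)
    (hab : a < b) (hb : b ≤ τ) (hs : Sol ι A P a b (ι y) (fun _ => 0) u v) :
    eLpNorm v P (iv a b) ≤ C * (M * (‖y‖ₑ * ENNReal.ofReal τ ^ (1 / P.toReal))) := by
  have h1 := (hE.wp a b ha hab hb).boundV _ _ _ (hs.sub_const hP)
  refine h1.trans (mul_le_mul_right ?_ _)
  simp only [zero_sub]
  rw [show (fun t => -(A t) y) = -(fun t => A t y) from rfl, eLpNorm_neg]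
  refine ((hE.opBdd.mono ha hb).eLpNorm_le (fun _ => y) P).trans (mul_le_mul_right ?_ _)
  refine (eLpNorm_const_iv_le (Eventually.of_forall fun t => le_rfl)).trans
    (mul_le_mul_right (ENNReal.rpow_le_rpow (ENNReal.ofReal_le_ofReal (by linarith))
      (by positivity)) _)

end Globalization

end NonAutonomous

namespace NonAutonomous

/-! ### The convolution estimate: from orbits to inhomogeneous problems. -/

section Convolution

set_option linter.unusedSectionVars false

open Filter Topology
open scoped NNReal

variable {X D Y : Type*} [NormedAddCommGroup X] [NormedAddCommGroup D] [NormedAddCommGroup Y]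
  [NormedSpace ℝ X] [NormedSpace ℝ D] [NormedSpace ℝ Y] [CompleteSpace X] [CompleteSpace D]
  {ι : D →L[ℝ] X}
  {A : ℝ → D →L[ℝ] X} {S : ℝ → D →L[ℝ] Y} {C K M N γ : ℝ≥0} {τ a b : ℝ} {P Θ : ℝ≥0∞} {x : X} {y : D}
  {f v : ℝ → X} {u : ℝ → D}

/-- The observation `S` is `L^Θ`-admissible on the orbits that start in `[a,b)`. -/
def ObsBdd (ι : D →L[ℝ] X) (A : ℝ → D →L[ℝ] X) (P : ℝ≥0∞) (S : ℝ → D →L[ℝ] Y) (Θ : ℝ≥0∞)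
    (a b : ℝ) (γ : ℝ≥0) : Prop :=
  ∀ r y u v, a ≤ r → r < b → Sol ι A P r b (ι y) (fun _ => 0) u v →
    eLpNorm (fun t => S t (u t)) Θ (iv r b) ≤ γ * ‖ι y‖ₑ

/-- Fatou along an almost everywhere convergent subsequence. Convergence is needed only in L^P, so Θ
may be an unrelated, larger exponent. -/
lemma eLpNorm_le_of_tendsto (hP : P ≠ 0) (hS : OpBdd S N a b) {U : ℕ → ℝ → D}
    (hU : ∀ n, AEStronglyMeasurable (U n) (iv a b)) (hu : AEStronglyMeasurable u (iv a b))
    (hlim : Tendsto (fun n => eLpNorm (U n - u) P (iv a b)) atTop (𝓝 0)) {c : ℕ → ℝ≥0∞}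
    {c₀ : ℝ≥0∞} (hc : Tendsto c atTop (𝓝 c₀))
    (hle : ∀ n, eLpNorm (fun t => S t (U n t)) Θ (iv a b) ≤ c n) :
    eLpNorm (fun t => S t (u t)) Θ (iv a b) ≤ c₀ := by
  obtain ⟨φ, hφ, h1⟩ := (tendstoInMeasure_of_tendsto_eLpNorm hP hU hu hlim).exists_seq_tendsto_ae
  refine (Lp.eLpNorm_lim_le_liminf_eLpNorm (f := fun n t => S t (U (φ n) t))
    (fun n => hS.aestronglyMeasurable (hU _)) _ ?_).trans ?_
  · filter_upwards [h1] with t ht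
    exact ((S t).continuous.tendsto _).comp ht
  · rw [← (hc.comp hφ.tendsto_atTop).liminf_eq]
    exact liminf_le_liminf (Eventually.of_forall fun n => hle _)

/-- `o` is the orbit starting from y at time r, preceded by zero. It jumps in X; subtracting the
step function removes the jump and leaves a solution with zero initial value to which the a priori
estimates apply. -/
lemma ObsBdd.exists_jump (hP : 1 ≤ P) (hE : EvolWP ι A P τ M C K) (ha : 0 ≤ a) (hb : b ≤ τ)
    (hobs : ObsBdd ι A P S Θ a b γ) {r : ℝ} (hr : r ∈ Ico a b) (y : D) :
    ∃ (o : ℝ → D) (ν : ℝ → X), Sol ι A P a b 0 (fun t => -(A t (if t ≤ r then 0 else y)))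
      (fun t => o t - if t ≤ r then 0 else y) ν ∧
      eLpNorm (fun t => S t (o t)) Θ (iv a b) ≤ γ * ‖ι y‖ₑ := by
  obtain ⟨u, v, hs⟩ := hE.exists_iv hP (a := r) (b := b) (ha.trans hr.1) hb y
    (f := fun _ => 0) (memLp_const 0)
  have h1 := (hs.sub_const hP).extend_left hP hr.1
  refine ⟨fun t => if t ≤ r then 0 else u t, fun t => if t ≤ r then 0 else v t, ?_, ?_⟩
  · convert h1 using 2 with t t
    · by_cases h : t ≤ r <;> simp [h]
    · by_cases h : t ≤ r <;> simp [h]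
  · refine le_trans (le_trans (le_of_eq (eLpNorm_congr_ae ?_))
      (eLpNorm_extend_zero_le (fun t => S t (u t)) (c := r) (d := b))) (hobs r y u v hr.1 hr.2 hs)
    refine ae_iv_of_forall fun t ht => ?_
    by_cases h : t ≤ r
    · simp [h]
    · simp [h, indicator_of_mem (show t ∈ Ioo r b from ⟨not_le.1 h, ht.2⟩)]

lemma ObsBdd.exists_jumps (hP : 1 ≤ P) (hΘ : 1 ≤ Θ) (hE : EvolWP ι A P τ M C K) (ha : 0 ≤ a)
    (hb : b ≤ τ) (hS : OpBdd S N a b) (hobs : ObsBdd ι A P S Θ a b γ) (r : ℕ → ℝ) (F : ℕ → D) (n : ℕ)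
    (hr : ∀ i < n, r i ∈ Ico a b) :
    ∃ (o : ℝ → D) (ν : ℝ → X), Sol ι A P a b 0
      (fun t => -(A t (∑ i ∈ Finset.range n, if t ≤ r i then 0 else F i)))
      (fun t => o t - ∑ i ∈ Finset.range n, if t ≤ r i then 0 else F i) ν ∧
      AEStronglyMeasurable o (iv a b) ∧
      eLpNorm (fun t => S t (o t)) Θ (iv a b) ≤ γ * ∑ i ∈ Finset.range n, ‖ι (F i)‖ₑ := by
  induction n with
  | zero =>
    refine ⟨fun _ => 0, fun _ => 0, ?_, aestronglyMeasurable_const, by simp⟩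
    simpa using Sol.const (ι := ι) (B := A) (p := P) (a := a) (b := b) (0 : D) (fun _ => 0)
      (by simp)
  | succ n ih =>
    obtain ⟨o, ν, h1, h2, h3⟩ := ih fun i hi => hr i (by omega)
    obtain ⟨o', ν', h1', h3'⟩ := hobs.exists_jump hP hE ha hb (hr n (by omega)) (F n)
    have hm : AEStronglyMeasurable o' (iv a b) := by
      have hj : AEStronglyMeasurable (fun t => if t ≤ r n then 0 else F n) (iv a b) :=
        (StronglyMeasurable.ite measurableSet_Iic stronglyMeasurable_const
          stronglyMeasurable_const).aestronglyMeasurable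
      refine (h1'.memU.1.add hj).congr (Eventually.of_forall fun t => ?_)
      simp only [Pi.add_apply, sub_add_cancel]
    refine ⟨fun t => o t + o' t, fun t => ν t + ν' t, ?_, h2.add hm, ?_⟩
    · have h4 := h1.add hP h1'
      rw [add_zero] at h4
      convert h4 using 2 with t t
      · simp only [Finset.sum_range_succ, map_add]; abel
      · simp only [Finset.sum_range_succ]; abel
    · simp only [map_add]
      refine (eLpNorm_add_le (hS.aestronglyMeasurable h2) (hS.aestronglyMeasurable hm) hΘ).trans ?_
      rw [Finset.sum_range_succ, mul_add]
      exact add_le_add h3 h3'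

lemma eLpNorm_one_iv_add_le {c d : ℝ} (hac : a ≤ c) (hcd : c ≤ d) :
    eLpNorm f 1 (iv a c) + eLpNorm f 1 (iv c d) ≤ eLpNorm f 1 (iv a d) := by
  simp only [eLpNorm_one_eq_lintegral_enorm, iv]
  rw [← lintegral_union measurableSet_Ioo]
  · refine lintegral_mono_set (union_subset (Ioo_subset_Ioo le_rfl hcd) (Ioo_subset_Ioo hac le_rfl))
  · exact Set.disjoint_left.2 fun t h1 h2 => not_lt.2 h1.2.le h2.1

lemma sum_enorm_le {φ : ℝ → D} (r : ℕ → ℝ) (hr : Monotone r) (n : ℕ)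
    (hφ : IntervalIntegrable φ volume (r 0) (r n)) :
    ∑ i ∈ Finset.range n, ‖ι (∫ t in r i..r (i + 1), φ t)‖ₑ
      ≤ eLpNorm (fun t => ι (φ t)) 1 (iv (r 0) (r n)) := by
  induction n with
  | zero => simp
  | succ n ih =>
    rw [Finset.sum_range_succ]
    have h0 := hr (Nat.zero_le n)
    have h1 := hr (Nat.le_succ n)
    have hsub : IntervalIntegrable φ volume (r 0) (r n) := hφ.mono_set (by
      rw [uIcc_of_le h0, uIcc_of_le (h0.trans h1)]; exact Icc_subset_Icc le_rfl h1)
    have hsub' : IntervalIntegrable φ volume (r n) (r (n + 1)) := hφ.mono_set (by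
      rw [uIcc_of_le h1, uIcc_of_le (h0.trans h1)]; exact Icc_subset_Icc h0 le_rfl)
    refine (add_le_add (ih hsub) ?_).trans (eLpNorm_one_iv_add_le h0 h1)
    rw [← ContinuousLinearMap.intervalIntegral_comp_comm ι hsub']
    exact enorm_integral_le_eLpNorm_one _ h1

/-- The increment over each subinterval enters the step function at its right end, so at any time
only the integral over the current subinterval is missing. The increment of the last subinterval
would enter at the right end of the whole interval and is omitted. -/
lemma norm_integral_sub_sum_le {φ : ℝ → D} {R δ : ℝ} (hR : ∀ t, ‖φ t‖ ≤ R) (r : ℕ → ℝ)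
    (hδ : ∀ i, r (i + 1) - r i = δ) (hδ0 : 0 ≤ δ) (n : ℕ)
    (hφ : IntervalIntegrable φ volume (r 0) (r (n + 1))) {t : ℝ} (ht : t ∈ Ioo (r 0) (r (n + 1))) :
    ‖(∫ s in r 0..t, φ s) - ∑ i ∈ Finset.range n, if t ≤ r (i + 1) then 0 else
      ∫ s in r i..r (i + 1), φ s‖ ≤ R * δ := by
  classical
  have hmono : Monotone r := monotone_nat_of_le_succ fun i => by linarith [hδ i]
  have hex : ∃ k, t ≤ r (k + 1) := ⟨n, ht.2.le⟩
  obtain ⟨k, hk1, hk2, hkn⟩ : ∃ k, r k < t ∧ t ≤ r (k + 1) ∧ k ≤ n := by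
    refine ⟨Nat.find hex, ?_, Nat.find_spec hex, Nat.find_min' hex ht.2.le⟩
    rcases Nat.eq_zero_or_pos (Nat.find hex) with h | h
    · rw [h]; exact ht.1
    · have h1 := Nat.find_min hex (m := Nat.find hex - 1) (by omega)
      rw [Nat.sub_add_cancel h] at h1
      exact not_le.1 h1
  have hint : ∀ i j, i ≤ n + 1 → j ≤ n + 1 → IntervalIntegrable φ volume (r i) (r j) := by
    intro i j hi hj
    refine hφ.mono_set ?_
    rw [uIcc_of_le (hmono (Nat.zero_le (n + 1)))]
    exact uIcc_subset_Icc ⟨hmono (Nat.zero_le _), hmono hi⟩ ⟨hmono (Nat.zero_le _), hmono hj⟩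
  have hsum : ∑ i ∈ Finset.range n, (if t ≤ r (i + 1) then 0 else ∫ s in r i..r (i + 1), φ s)
      = ∫ s in r 0..r k, φ s := by
    rw [← Finset.sum_subset (Finset.range_mono hkn), ←
      intervalIntegral.sum_integral_adjacent_intervals fun i hi =>
        hint i (i + 1) (by omega) (by omega)]
    · refine Finset.sum_congr rfl fun i hi => if_neg (not_le.2 ?_)
      exact (hmono (Finset.mem_range.1 hi)).trans_lt hk1
    · intro i _ hi
      exact if_pos (hk2.trans (hmono (by simpa using hi)))
  have hkt : IntervalIntegrable φ volume (r k) t := (hint k (k + 1) (by omega) (by omega)).mono_set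
    (by rw [uIcc_of_le hk1.le, uIcc_of_le (hmono (Nat.le_succ k))]; exact Icc_subset_Icc le_rfl hk2)
  rw [hsum, ← intervalIntegral.integral_add_adjacent_intervals
    (hint 0 k (Nat.zero_le _) (by omega)) hkt, add_sub_cancel_left]
  refine (intervalIntegral.norm_integral_le_of_norm_le_const fun s _ => hR s).trans ?_
  have hR0 : 0 ≤ R := (norm_nonneg _).trans (hR 0)
  gcongr
  rw [abs_of_nonneg (by linarith)]
  linarith [hδ k]

/-- The convolution estimate for a bounded right-hand side with values in `D`. -/
lemma ObsBdd.eLpNorm_le_of_bounded (hP : 1 ≤ P) (hΘ : 1 ≤ Θ) (hE : EvolWP ι A P τ M C K)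
    (ha : 0 ≤ a) (hab : a < b) (hb : b ≤ τ) (hS : OpBdd S N a b) (hobs : ObsBdd ι A P S Θ a b γ)
    {φ : ℝ → D} (hφm : AEStronglyMeasurable φ (iv a b)) {R : ℝ} (hR : ∀ t, ‖φ t‖ ≤ R)
    (hs : Sol ι A P a b 0 (fun t => ι (φ t)) u v) :
    eLpNorm (fun t => S t (u t)) Θ (iv a b) ≤ γ * eLpNorm (fun t => ι (φ t)) 1 (iv a b) := by
  have hP0 : P ≠ 0 := (zero_lt_one.trans_le hP).ne'
  have hR0 : 0 ≤ R := (norm_nonneg _).trans (hR 0)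
  have hφL : MemLp φ P (iv a b) := MemLp.of_bound hφm R (Eventually.of_forall hR)
  have hφI : IntervalIntegrable φ volume a b :=
    intervalIntegrable_of_memLp hP hφL ⟨le_rfl, hab.le⟩ ⟨hab.le, le_rfl⟩
  -- Since φ has values in D, u - G solves the problem with right-hand side -AG. Replacing G by step
  -- functions turns u into a finite superposition of orbits.
  set G : ℝ → D := fun t => ∫ s in a..t, φ s with hG
  have hGm : MemLp G P (iv a b) := memLp_of_continuousOn (continuousOn_primitive hP hab.le hφL)
  have hsG : Sol ι A P a b 0 (fun t => -(A t (G t))) (fun t => u t - G t)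
      (fun t => v t - ι (φ t)) := by
    have hιφ : MemLp (fun t => ι (φ t)) P (iv a b) := ι.comp_memLp' hφL
    refine ⟨hs.memU.sub hGm, hs.memV.sub hιφ, ?_, ?_⟩
    · filter_upwards [hs.prim, ae_iv_mem a b] with t h1 ht
      have h2 : IntervalIntegrable φ volume a t :=
        intervalIntegrable_of_memLp hP hφL ⟨le_rfl, hab.le⟩ (Ioo_subset_Icc_self ht)
      rw [intervalIntegral.integral_sub
        (hs.intervalIntegrable hP ⟨le_rfl, hab.le⟩ (Ioo_subset_Icc_self ht))
        (intervalIntegrable_of_memLp hP hιφ ⟨le_rfl, hab.le⟩ (Ioo_subset_Icc_self ht)),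
        ContinuousLinearMap.intervalIntegral_comp_comm ι h2, map_sub, h1, hG, zero_add, zero_add]
    · filter_upwards [hs.eqn] with t h1
      rw [map_sub, ← h1]; abel
  set δ : ℕ → ℝ := fun n => (b - a) / (n + 1) with hδ
  set r : ℕ → ℕ → ℝ := fun n i => a + i * δ n with hr
  have hδ0 : ∀ n, 0 < δ n := fun n => by
    have : 0 < b - a := by linarith
    positivity
  have hr0 : ∀ n, r n 0 = a := fun n => by simp [hr]
  have hrn : ∀ n, r n (n + 1) = b := fun n => by
    simp only [hr, hδ]; push_cast; field_simp; ring
  have hrs : ∀ n i, r n (i + 1) - r n i = δ n := fun n i => by simp only [hr]; push_cast; ring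
  have hmono : ∀ n, StrictMono (r n) := fun n => strictMono_nat_of_lt_succ fun i => by
    linarith [hrs n i, hδ0 n]
  -- The orbits start at the interior grid points with the increments of G as initial values, and
  -- those increments sum in X to at most the L¹-norm of ιφ.
  choose o ν h1 h2 h3 using fun n : ℕ => hobs.exists_jumps hP hΘ hE ha hb hS
    (fun i => r n (i + 1)) (fun i => ∫ s in r n i..r n (i + 1), φ s) n fun i hi =>
      ⟨by rw [← hr0 n]; exact (hmono n).monotone (Nat.zero_le _), by
        rw [← hrn n]; exact hmono n (by omega)⟩
  set J : ℕ → ℝ → D := fun n t => ∑ i ∈ Finset.range n, if t ≤ r n (i + 1) then 0 else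
      ∫ s in r n i..r n (i + 1), φ s with hJ
  have hGJ : ∀ n, ∀ t ∈ Ioo a b, ‖G t - J n t‖ ≤ R * δ n := by
    intro n t ht
    have := norm_integral_sub_sum_le hR (r n) (hrs n) (hδ0 n).le n
      (by rwa [hr0, hrn]) (t := t) (by rwa [hr0, hrn])
    rw [hr0] at this
    exact this
  have hJm : ∀ n, AEStronglyMeasurable (J n) (iv a b) := fun n => by
    have := (h2 n).sub (h1 n).memU.1
    refine this.congr (Eventually.of_forall fun t => ?_)
    simp [hJ]
  have hGJe : ∀ n, eLpNorm (fun t => G t - J n t) P (iv a b)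
      ≤ ENNReal.ofReal (R * δ n) * ENNReal.ofReal (b - a) ^ (1 / P.toReal) := fun n =>
    eLpNorm_const_iv_le (ae_iv_of_forall fun t ht => by
      rw [← ofReal_norm]; exact ENNReal.ofReal_le_ofReal (hGJ n t ht))
  -- u - G and o - J solve the problems with right-hand sides -AG and -AJ, so the a priori estimate
  -- bounds the error by G - J, which tends to zero uniformly.
  have hbd : ∀ n, eLpNorm (o n - u) P (iv a b) ≤ (C * M + 1) *
      (ENNReal.ofReal (R * δ n) * ENNReal.ofReal (b - a) ^ (1 / P.toReal)) := by
    intro n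
    have h4 := hsG.sub hP (h1 n)
    rw [sub_zero] at h4
    have h5 := (hE.wp a b ha hab hb).boundU _ _ _ h4
    have h6 : eLpNorm ((fun t => -(A t (G t))) - fun t => -(A t (J n t))) P (iv a b)
        ≤ M * eLpNorm (fun t => G t - J n t) P (iv a b) := by
      refine le_trans (le_of_eq ?_) ((hE.opBdd.mono ha hb).eLpNorm_le _ P)
      rw [← eLpNorm_neg]
      congr 1
      ext t
      simp only [Pi.neg_apply, Pi.sub_apply, map_sub]
      abel
    calc eLpNorm (o n - u) P (iv a b) = eLpNorm (((fun t => u t - G t) - fun t => o n t - J n t)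
          + fun t => G t - J n t) P (iv a b) := by
          rw [← eLpNorm_neg]
          congr 1
          ext t
          simp only [Pi.neg_apply, Pi.sub_apply, Pi.add_apply]
          abel
      _ ≤ _ := eLpNorm_add_le h4.memU.1 (hGm.1.sub (hJm n)) hP
      _ ≤ C * (M * eLpNorm (fun t => G t - J n t) P (iv a b))
          + eLpNorm (fun t => G t - J n t) P (iv a b) := by
          gcongr
          exact h5.trans (mul_le_mul_right h6 _)
      _ = (C * M + 1) * eLpNorm (fun t => G t - J n t) P (iv a b) := by ring
      _ ≤ _ := by gcongr; exact hGJe n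
  refine eLpNorm_le_of_tendsto hP0 hS h2 hs.memU.1 ?_ (c := fun _ =>
    γ * eLpNorm (fun t => ι (φ t)) 1 (iv a b)) tendsto_const_nhds fun n => (h3 n).trans ?_
  · refine tendsto_of_tendsto_of_tendsto_of_le_of_le tendsto_const_nhds
      (h := fun n => (C * M + 1) *
      (ENNReal.ofReal (R * δ n) * ENNReal.ofReal (b - a) ^ (1 / P.toReal))) ?_
      (fun _ => bot_le) hbd
    have h4 : Tendsto (fun n => ENNReal.ofReal (R * δ n)) atTop (𝓝 0) := by
      rw [← ENNReal.ofReal_zero]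
      refine ENNReal.tendsto_ofReal ?_
      have h5 : Tendsto (fun n : ℕ => (b - a) * (1 / ((n : ℝ) + 1))) atTop (𝓝 ((b - a) * 0)) :=
        tendsto_one_div_add_atTop_nhds_zero_nat.const_mul _
      have h6 := h5.const_mul R
      simp only [mul_zero, mul_one_div] at h6
      exact h6
    have hfin : ENNReal.ofReal (b - a) ^ (1 / P.toReal) ≠ ∞ :=
      ENNReal.rpow_ne_top_of_nonneg (by positivity) (by simp)
    have h5 := ENNReal.Tendsto.const_mul (a := (C * M + 1 : ℝ≥0∞))
      (ENNReal.Tendsto.mul_const h4 (Or.inr hfin)) (Or.inr (by finiteness))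
    simpa using h5
  · refine mul_le_mul_right ((sum_enorm_le (r n) (hmono n).monotone n ?_).trans ?_) _
    · refine hφI.mono_set ?_
      rw [hr0, uIcc_of_le hab.le]
      exact uIcc_subset_Icc ⟨le_rfl, hab.le⟩ ⟨by
        rw [← hr0 n]; exact (hmono n).monotone (Nat.zero_le _), by
        rw [← hrn n]; exact (hmono n).monotone (by omega)⟩
    · rw [hr0]
      exact eLpNorm_iv_mono _ le_rfl (by rw [← hrn n]; exact (hmono n).monotone (by omega))

/-- Functions with bounded `D`-valued representatives are dense in `L^p(a,b;X)`. -/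
lemma exists_bounded_approx (hι : DenseRange ι) (hP' : P ≠ ∞)
    (hf : MemLp f P (iv a b)) {ε : ℝ≥0∞} (hε : ε ≠ 0) :
    ∃ (φ : ℝ → D) (R : ℝ), AEStronglyMeasurable φ (iv a b) ∧ (∀ t, ‖φ t‖ ≤ R) ∧
      eLpNorm (f - fun t => ι (φ t)) P (iv a b) ≤ ε := by
  have key : ∃ g, eLpNorm (f - g) P (iv a b) ≤ ε ∧ ∃ (φ : ℝ → D) (R : ℝ),
      AEStronglyMeasurable φ (iv a b) ∧ (∀ t, ‖φ t‖ ≤ R) ∧ g = fun t => ι (φ t) := by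
    refine hf.induction_dense hP' (P := fun g => ∃ (φ : ℝ → D) (R : ℝ),
      AEStronglyMeasurable φ (iv a b) ∧ (∀ t, ‖φ t‖ ≤ R) ∧ g = fun t => ι (φ t)) ?_ ?_ ?_ hε
    · intro c s hs _ ε hε
      set T := ENNReal.ofReal (b - a) ^ (1 / P.toReal) with hT
      have hTt : T ≠ ∞ := ENNReal.rpow_ne_top_of_nonneg (by positivity) (by simp)
      have hpos : 0 < ε / (T + 1) := ENNReal.div_pos hε (by finiteness)
      obtain ⟨y, hy⟩ : ∃ y, ‖ι y - c‖ₑ < ε / (T + 1) := by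
        have := hι.exists_mem_open (Metric.isOpen_eball (x := c) (ε := ε / (T + 1)))
          ⟨c, Metric.mem_eball_self hpos⟩
        obtain ⟨y, hy⟩ := this
        exact ⟨y, by simpa [edist_eq_enorm_sub] using hy⟩
      refine ⟨_, ?_, s.indicator fun _ => y, ‖y‖, aestronglyMeasurable_const.indicator hs,
        fun t => norm_indicator_le_norm_self _ _, rfl⟩
      refine (eLpNorm_const_iv_le (K := ε / (T + 1)) (Eventually.of_forall fun t => ?_)).trans ?_
      · by_cases ht : t ∈ s
        · simpa [ht] using hy.le
        · simp [ht]
      · calc ε / (T + 1) * T ≤ ε / (T + 1) * (T + 1) := by gcongr; simp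
          _ ≤ ε := (ENNReal.div_mul_cancel (by simp) (by finiteness)).le
    · rintro _ _ ⟨φ, R, h1, h2, rfl⟩ ⟨φ', R', h1', h2', rfl⟩
      exact ⟨fun t => φ t + φ' t, R + R', h1.add h1', fun t => (norm_add_le _ _).trans
        (add_le_add (h2 t) (h2' t)), by ext t; simp⟩
    · rintro _ ⟨φ, R, h1, h2, rfl⟩
      exact ι.continuous.comp_aestronglyMeasurable h1
  obtain ⟨g, hg, φ, R, h1, h2, rfl⟩ := key
  exact ⟨φ, R, h1, h2, hg⟩

/-- The convolution estimate: an observation which is `L^Θ`-admissible for the orbits is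
`L¹`-`L^Θ`-bounded on the solutions of the inhomogeneous problem. -/
theorem ObsBdd.eLpNorm_le (hι : DenseRange ι) (hP : 1 ≤ P) (hP' : P ≠ ∞) (hΘ : 1 ≤ Θ)
    (hE : EvolWP ι A P τ M C K)
    (ha : 0 ≤ a) (hab : a < b) (hb : b ≤ τ) (hS : OpBdd S N a b) (hobs : ObsBdd ι A P S Θ a b γ)
    (hs : Sol ι A P a b 0 f u v) :
    eLpNorm (fun t => S t (u t)) Θ (iv a b) ≤ γ * eLpNorm f 1 (iv a b) := by
  have hP0 : P ≠ 0 := (zero_lt_one.trans_le hP).ne'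
  have hf : MemLp f P (iv a b) := by
    refine (hs.memV.add ((hE.opBdd.mono ha hb).memLp hs.memU)).ae_eq ?_
    filter_upwards [hs.eqn] with t ht using ht
  have hWP := hE.wp a b ha hab hb
  choose φ R h1 h2 h3 using fun n : ℕ => exists_bounded_approx hι hP' hf
    (ε := (2⁻¹ : ℝ≥0∞) ^ n) (by simp)
  have hφL : ∀ n, MemLp (fun t => ι (φ n t)) P (iv a b) := fun n =>
    ι.comp_memLp' (MemLp.of_bound (h1 n) (R n) (Eventually.of_forall (h2 n)))
  choose U V hUV using fun n => hWP.exists_sol _ (hφL n)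
  have hpow : Tendsto (fun n : ℕ => (2⁻¹ : ℝ≥0∞) ^ n) atTop (𝓝 0) :=
    ENNReal.tendsto_pow_atTop_nhds_zero_of_lt_one (by norm_num)
  set T := ENNReal.ofReal (b - a) ^ (1 - 1 / P.toReal) with hT
  have hPr : 1 ≤ P.toReal := by simpa using (ENNReal.toReal_le_toReal (by simp) hP').2 hP
  have hTt : T ≠ ∞ := by
    refine ENNReal.rpow_ne_top_of_nonneg ?_ (by simp)
    rw [sub_nonneg, div_le_one] <;> linarith
  -- L^P-approximation of f gives convergence of the solutions in L^P(D); on a bounded interval it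
  -- also makes the L¹-norms of the data converge.
  refine eLpNorm_le_of_tendsto hP0 hS (fun n => (hUV n).memU.1) hs.memU.1 ?_
    (c := fun n => γ * (eLpNorm f 1 (iv a b) + (2⁻¹ : ℝ≥0∞) ^ n * T)) ?_ fun n => ?_
  · refine tendsto_of_tendsto_of_tendsto_of_le_of_le tendsto_const_nhds
      (h := fun n => (C : ℝ≥0∞) * (2⁻¹ : ℝ≥0∞) ^ n) ?_ (fun _ => bot_le) fun n => ?_
    · simpa using ENNReal.Tendsto.const_mul hpow (Or.inr (by simp : (C : ℝ≥0∞) ≠ ∞))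
    · have h4 := (hUV n).sub hP hs
      rw [sub_zero] at h4
      refine (hWP.boundU _ _ _ h4).trans (mul_le_mul_right ?_ _)
      exact (eLpNorm_sub_comm _ _ _ _).trans_le (h3 n)
  · have h4 := (ENNReal.Tendsto.mul_const hpow (Or.inr hTt)).const_add (eLpNorm f 1 (iv a b))
    simpa using ENNReal.Tendsto.const_mul h4 (Or.inr (by simp : (γ : ℝ≥0∞) ≠ ∞))
  · refine (hobs.eLpNorm_le_of_bounded hP hΘ hE ha hab hb hS (h1 n) (h2 n) (hUV n)).trans
      (mul_le_mul_right ?_ _)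
    calc eLpNorm (fun t => ι (φ n t)) 1 (iv a b)
        = eLpNorm (f - (f - fun t => ι (φ n t))) 1 (iv a b) := by rw [sub_sub_cancel]
      _ ≤ _ := eLpNorm_sub_le hf.1 (hf.1.sub (hφL n).1) le_rfl
      _ ≤ _ := by
        gcongr
        exact (eLpNorm_one_le_iv hP (hf.1.sub (hφL n).1)).trans (mul_le_mul_left (h3 n) _)

end Convolution

end NonAutonomous

namespace NonAutonomous

/-! ### Miyadera–Voigt perturbations. -/

section MiyaderaPerturbation

set_option linter.unusedSectionVars false

open Filter Topology
open scoped NNReal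

variable {X D Y : Type*} [NormedAddCommGroup X] [NormedAddCommGroup D] [NormedAddCommGroup Y]
  [NormedSpace ℝ X] [NormedSpace ℝ D] [NormedSpace ℝ Y] [CompleteSpace X] [CompleteSpace D]
  {ι : D →L[ℝ] X}
  {A A' R : ℝ → D →L[ℝ] X} {S : ℝ → D →L[ℝ] Y} {C K M C' K' M' N γ c : ℝ≥0} {τ a b : ℝ}
  {P Θ : ℝ≥0∞} {x : X} {y : D} {f v : ℝ → X} {u : ℝ → D}

lemma ObsBdd.mono_left {a' : ℝ} (h : ObsBdd ι A P S Θ a b γ) (ha : a ≤ a') :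
    ObsBdd ι A P S Θ a' b γ :=
  fun r y u v har hrb hs => h r y u v (ha.trans har) hrb hs

/-- Every orbit on the shorter interval is, by uniqueness, the restriction of an orbit on the longer
one. -/
lemma ObsBdd.mono_right (hP : 1 ≤ P) (hE : EvolWP ι A P τ M C K) (h : ObsBdd ι A P S Θ a b γ)
    (ha : 0 ≤ a) (hb : b ≤ τ) {b' : ℝ} (hbb : b' ≤ b) : ObsBdd ι A P S Θ a b' γ := by
  intro r y u v har hrb hs
  obtain ⟨u', v', hs'⟩ := hE.exists_iv hP (a := r) (b := b) (ha.trans har) hb y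
    (f := fun _ => 0) (memLp_const 0)
  have h1 := (hE.unique hP (ha.trans har) (hbb.trans hb) hs
    (hs'.restrict_left hP hrb.le hbb)).1
  calc eLpNorm (fun t => S t (u t)) Θ (iv r b') = eLpNorm (fun t => S t (u' t)) Θ (iv r b') :=
        eLpNorm_congr_ae (by filter_upwards [h1] with t ht using by rw [ht])
    _ ≤ _ := eLpNorm_iv_mono _ le_rfl hbb
    _ ≤ _ := h r y u' v' har (hrb.trans_le hbb) hs'

lemma ObsBdd.exists_mono_exponent {Θ' : ℝ≥0∞} (hS : OpBdd S N a b)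
    (hΘ1 : 1 ≤ Θ') (hΘ : Θ' ≤ Θ) (hΘt : Θ ≠ ∞) (h : ObsBdd ι A P S Θ a b γ) :
    ∃ γ', ObsBdd ι A P S Θ' a b γ' := by
  have hΘt' : Θ' ≠ ∞ := ne_top_of_le_ne_top hΘt hΘ
  have hr1 : 1 ≤ Θ'.toReal := by simpa using (ENNReal.toReal_le_toReal (by simp) hΘt').2 hΘ1
  have hr2 : Θ'.toReal ≤ Θ.toReal := (ENNReal.toReal_le_toReal hΘt' hΘt).2 hΘ
  have he : 0 ≤ 1 / Θ'.toReal - 1 / Θ.toReal :=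
    sub_nonneg.2 (one_div_le_one_div_of_le (by linarith) hr2)
  set T := ENNReal.ofReal (b - a) ^ (1 / Θ'.toReal - 1 / Θ.toReal) with hT
  have hTt : T ≠ ∞ := ENNReal.rpow_ne_top_of_nonneg he (by simp)
  refine ⟨γ * T.toNNReal, fun r y u v har hrb hs => ?_⟩
  have hm : AEStronglyMeasurable (fun t => S t (u t)) (iv r b) :=
    (hS.mono har le_rfl).aestronglyMeasurable hs.memU.1
  have h1 := eLpNorm_le_eLpNorm_mul_rpow_measure_univ hΘ hm
  rw [iv_univ] at h1
  rw [ENNReal.coe_mul, ENNReal.coe_toNNReal hTt, mul_right_comm]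
  exact h1.trans (mul_le_mul' (h r y u v har hrb hs)
    (ENNReal.rpow_le_rpow (ENNReal.ofReal_le_ofReal (by linarith)) he))

/-- Admissibility is stable under perturbations which are `L¹`-bounded on the perturbed orbits. -/
lemma ObsBdd.of_perturb (hι : DenseRange ι) (hP : 1 ≤ P) (hP' : P ≠ ∞) (hΘ : 1 ≤ Θ)
    (hE : EvolWP ι A P τ M C K) (ha : 0 ≤ a) (hb : b ≤ τ) (hS : OpBdd S N a b)
    (h : ObsBdd ι A P S Θ a b γ) (hR : ObsBdd ι A' P (fun t => A' t - A t) 1 a b c) :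
    ObsBdd ι A' P S Θ a b (γ * (1 + c)) := by
  intro r y u v har hrb hs
  have hr : 0 ≤ r := ha.trans har
  obtain ⟨u₀, v₀, hs₀⟩ := hE.exists_iv hP hr hb y (f := fun _ => 0) (memLp_const 0)
  -- The variation of constants formula: an orbit of A' is the orbit of A plus the solution for A
  -- with right-hand side -(A' - A)u and zero initial value. The convolution estimate needs only the
  -- L¹-norm of the latter.
  have h1 : Sol ι A P r b (ι y) (fun t => -((A' t - A t) (u t))) u v := by
    refine hs.congr_op ?_
    filter_upwards [hs.eqn] with t ht
    rw [eq_neg_of_add_eq_zero_left ht, _root_.sub_apply]; abel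
  have h2 := h1.sub hP hs₀
  rw [sub_self] at h2
  have hS' := hS.mono har le_rfl
  have h3 := (h.mono_left har).eLpNorm_le hι hP hP' hΘ hE hr hrb hb hS' h2
  have h4 : eLpNorm (fun t => -((A' t - A t) (u t)) - 0) 1 (iv r b) ≤ c * ‖ι y‖ₑ := by
    simp only [sub_zero]
    rw [show (fun t => -((A' t - A t) (u t))) = -(fun t => (A' t - A t) (u t)) from rfl,
      eLpNorm_neg]
    exact hR r y u v har hrb hs
  have h5 := h r y u₀ v₀ har hrb hs₀
  calc eLpNorm (fun t => S t (u t)) Θ (iv r b)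
      = eLpNorm ((fun t => S t (u₀ t)) + fun t => S t (u t - u₀ t)) Θ (iv r b) := by
        congr 1; ext t; simp
    _ ≤ _ := eLpNorm_add_le (hS'.aestronglyMeasurable hs₀.memU.1)
        (hS'.aestronglyMeasurable h2.memU.1) hΘ
    _ ≤ γ * ‖ι y‖ₑ + γ * (c * ‖ι y‖ₑ) := add_le_add h5 (h3.trans (mul_le_mul_right h4 _))
    _ = _ := by push_cast; ring

lemma exists_rpow_small (hP : 1 < P) (hP' : P ≠ ∞) (γ : ℝ≥0) :
    ∃ h : ℝ, 0 < h ∧ γ * ENNReal.ofReal h ^ (1 - 1 / P.toReal) ≤ 2⁻¹ := by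
  have hPr : 1 < P.toReal := by simpa using (ENNReal.toReal_lt_toReal (by simp) hP').2 hP
  have hκ : 0 < 1 - 1 / P.toReal := by rw [sub_pos, div_lt_one] <;> linarith
  set κ := 1 - 1 / P.toReal
  refine ⟨(1 / (2 * (γ + 1)) : ℝ) ^ (1 / κ), by positivity, ?_⟩
  rw [ENNReal.ofReal_rpow_of_nonneg (by positivity) hκ.le, ← Real.rpow_mul (by positivity),
    one_div_mul_cancel hκ.ne', Real.rpow_one, ← ENNReal.ofReal_coe_nnreal,
    ← ENNReal.ofReal_mul (by positivity)]
  have : (2⁻¹ : ℝ≥0∞) = ENNReal.ofReal (1 / 2) := by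
    rw [one_div, ENNReal.ofReal_inv_of_pos (by norm_num)]; simp
  rw [this]
  refine ENNReal.ofReal_le_ofReal ?_
  rw [mul_one_div, div_le_div_iff₀ (by positivity) (by norm_num)]
  linarith

/-- Miyadera–Voigt type perturbation theorem for non-autonomous maximal regularity. -/
lemma EvolWP.exists_perturb (hι : DenseRange ι) (hP : 1 < P) (hP' : P ≠ ∞) (hτ : 0 < τ)
    (hE : EvolWP ι A P τ M C K) (hRb : OpBdd R N 0 τ) (hR : ObsBdd ι A P R P 0 τ γ) :
    ∃ C' K', EvolWP ι (fun t => A t + R t) P τ (M + N) C' K' := by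
  have hP1 : 1 ≤ P := hP.le
  have hPr : 1 < P.toReal := by simpa using (ENNReal.toReal_lt_toReal (by simp) hP').2 hP
  have hκ : 0 < 1 - 1 / P.toReal := by rw [sub_pos, div_lt_one] <;> linarith
  obtain ⟨h, hh, hsmall⟩ := exists_rpow_small hP hP' γ
  have hAR := hE.opBdd.add hRb
  have hW : LocWP ι (fun t => A t + R t) P τ h (2 * C) := by
    intro a b ha hab hbh hb
    refine (hE.wp a b ha hab hb).perturb hP1 (hE.opBdd.mono ha hb) (hAR.mono ha hb)
      fun g u v hs => ?_
    have hgm : AEStronglyMeasurable g (iv a b) := by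
      refine (hs.memV.1.add ((hE.opBdd.mono ha hb).memLp hs.memU).1).congr ?_
      filter_upwards [hs.eqn] with t ht using ht
    -- The convolution estimate with the perturbation itself as observation bounds Ru by γ‖g‖₁;
    -- Hölder then supplies the positive power of the length that makes this at most half the
    -- L^P-norm of g.
    have h1 := ((hR.mono_left ha).mono_right hP1 hE ha le_rfl hb).eLpNorm_le hι hP1 hP' hP1 hE
      ha hab hb (hRb.mono ha hb) hs
    simp only [add_sub_cancel_left]
    refine h1.trans ?_
    calc γ * eLpNorm g 1 (iv a b)
        ≤ γ * (eLpNorm g P (iv a b) * ENNReal.ofReal h ^ (1 - 1 / P.toReal)) := by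
          refine mul_le_mul_right ((eLpNorm_one_le_iv hP1 hgm).trans (mul_le_mul_right
            (ENNReal.rpow_le_rpow (ENNReal.ofReal_le_ofReal (by linarith)) hκ.le) _)) _
      _ = γ * ENNReal.ofReal h ^ (1 - 1 / P.toReal) * eLpNorm g P (iv a b) := by ring
      _ ≤ _ := by gcongr
  set T := ENNReal.ofReal τ ^ (1 - 1 / P.toReal) with hT
  have hTt : T ≠ ∞ := ENNReal.rpow_ne_top_of_nonneg hκ.le (by simp)
  refine hW.exists_evolWP hP1 hτ hAR hh (K := K + T.toNNReal * (2 * C * γ)) ?_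
  intro a b y u v ha hab hbh hb hs t ht
  obtain ⟨u₀, v₀, hs₀⟩ := hE.exists_iv hP1 ha hb y (f := fun _ => 0) (memLp_const 0)
  -- Unperturbed orbits satisfy the perturbed equation with right-hand side Ru₀, which is in L^P by
  -- the Miyadera–Voigt estimate. The difference of the orbits starts at zero and is bounded in X.
  have h1 : Sol ι (fun t => A t + R t) P a b (ι y) (fun t => R t (u₀ t)) u₀ v₀ := by
    refine hs₀.congr_op ?_
    filter_upwards [hs₀.eqn] with t ht
    rw [_root_.add_apply, ← add_assoc, ht, zero_add]
  have h2 := hs.sub hP1 h1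
  rw [sub_self] at h2
  have h3 := (hW a b ha hab hbh hb).boundV _ _ _ h2
  have h4 : eLpNorm (fun t => 0 - R t (u₀ t)) P (iv a b) ≤ γ * ‖ι y‖ₑ := by
    simp only [zero_sub]
    rw [show (fun t => -(R t (u₀ t))) = -(fun t => R t (u₀ t)) from rfl, eLpNorm_neg]
    exact (hR.mono_right hP1 hE le_rfl le_rfl hb) a y u₀ v₀ ha hab hs₀
  have h5 := h2.enorm_prim_le hP1 ht.1 ht.2
  have e : ι y + ∫ r in a..t, v r = (ι y + ∫ r in a..t, v₀ r) + ∫ r in a..t, (v r - v₀ r) := by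
    rw [intervalIntegral.integral_sub (hs.intervalIntegrable hP1 ⟨le_rfl, hab.le⟩ ht)
      (hs₀.intervalIntegrable hP1 ⟨le_rfl, hab.le⟩ ht)]
    abel
  rw [e]
  refine (enorm_add_le _ _).trans ?_
  calc _ ≤ K * ‖ι y‖ₑ + T * ((2 * C : ℝ≥0) * (γ * ‖ι y‖ₑ)) := by
        refine add_le_add (hE.orbit a b y u₀ v₀ ha hab.le hb hs₀ t ht) (h5.trans ?_)
        exact mul_le_mul' (ENNReal.rpow_le_rpow (ENNReal.ofReal_le_ofReal (by linarith)) hκ.le)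
          (h3.trans (mul_le_mul_right h4 _))
    _ = _ := by
        push_cast [ENNReal.coe_toNNReal hTt]
        ring

/-- The Miyadera–Voigt estimate carries over to the perturbed orbits. -/
lemma ObsBdd.perturbed (hP : 1 ≤ P) (hE : EvolWP ι A P τ M C K) (hRb : OpBdd R N 0 τ)
    (hE' : EvolWP ι (fun t => A t + R t) P τ M' C' K') (hR : ObsBdd ι A P R P 0 τ γ) :
    ObsBdd ι (fun t => A t + R t) P R P 0 τ (γ + N * (C' * γ)) := by
  intro a y u v ha hab hs
  obtain ⟨u₀, v₀, hs₀⟩ := hE.exists_iv hP ha le_rfl y (f := fun _ => 0) (memLp_const 0)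
  have h1 : Sol ι (fun t => A t + R t) P a τ (ι y) (fun t => R t (u₀ t)) u₀ v₀ := by
    refine hs₀.congr_op ?_
    filter_upwards [hs₀.eqn] with t ht
    rw [_root_.add_apply, ← add_assoc, ht, zero_add]
  have h2 := hs.sub hP h1
  rw [sub_self] at h2
  -- Maximal regularity of the perturbed problem bounds the difference of the orbits in L^P(D);
  -- boundedness of R from D to X then suffices.
  have h3 := (hE'.wp a τ ha hab le_rfl).boundU _ _ _ h2
  have h6 := hR a y u₀ v₀ ha hab hs₀
  have h4 : eLpNorm (fun t => 0 - R t (u₀ t)) P (iv a τ) ≤ γ * ‖ι y‖ₑ := by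
    simp only [zero_sub]
    rwa [show (fun t => -(R t (u₀ t))) = -(fun t => R t (u₀ t)) from rfl, eLpNorm_neg]
  have hR' := hRb.mono ha le_rfl
  calc eLpNorm (fun t => R t (u t)) P (iv a τ)
      = eLpNorm ((fun t => R t (u₀ t)) + fun t => R t (u t - u₀ t)) P (iv a τ) := by
        congr 1; ext t; simp
    _ ≤ _ := eLpNorm_add_le (hR'.aestronglyMeasurable hs₀.memU.1)
        (hR'.aestronglyMeasurable h2.memU.1) hP
    _ ≤ γ * ‖ι y‖ₑ + N * (C' * (γ * ‖ι y‖ₑ)) :=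
        add_le_add h6 ((hR'.eLpNorm_le _ P).trans (mul_le_mul_right (h3.trans
          (mul_le_mul_right h4 _)) _))
    _ = _ := by push_cast; ring

end MiyaderaPerturbation

end NonAutonomous

namespace NonAutonomous

/-! ### Joint continuity of orbits in time and initial time. -/

section OrbitContinuity

set_option linter.unusedSectionVars false

open Filter Topology
open scoped NNReal

variable {X D : Type*} [NormedAddCommGroup X] [NormedAddCommGroup D]
  [NormedSpace ℝ X] [NormedSpace ℝ D] [CompleteSpace X] [CompleteSpace D] {ι : D →L[ℝ] X}
  {A : ℝ → D →L[ℝ] X} {C K M : ℝ≥0} {τ a b c d : ℝ} {P : ℝ≥0∞} {x : X} {y : D}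
  {f v v' : ℝ → X} {u u' : ℝ → D}

lemma eq_of_tendsto_of_ae {Z : Type*} [TopologicalSpace Z] [T2Space Z] {g : ℝ → Z} {l m : Z}
    (hab : a < b) (hg : Tendsto g (𝓝[Icc a b] a) (𝓝 l)) (h : ∀ᵐ c ∂(iv a b), g c = m) :
    l = m := by
  by_contra hne
  have h1 : ∀ᶠ c in 𝓝[Icc a b] a, g c ≠ m := hg.eventually_ne hne
  rw [eventually_nhdsWithin_iff, Metric.eventually_nhds_iff] at h1
  obtain ⟨ε, hε, h5⟩ := h1
  obtain ⟨c, hc, h6⟩ := exists_of_ae_iv (b := min b (a + ε)) (lt_min hab (by linarith))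
    (ae_iv_mono le_rfl (min_le_left _ _) h)
  have hc1 : c < b := hc.2.trans_le (min_le_left _ _)
  have hc2 : c < a + ε := hc.2.trans_le (min_le_right _ _)
  refine h5 ?_ ⟨hc.1.le, by linarith⟩ h6
  rw [Real.dist_eq, abs_of_pos (by linarith [hc.1])]
  linarith

/-- Hölder continuity of the orbits starting in `D`. -/
lemma EvolWP.enorm_integral_le (hP : 1 ≤ P) (hE : EvolWP ι A P τ M C K) (ha : 0 ≤ a)
    (hb : b ≤ τ) (hs : Sol ι A P a b (ι y) (fun _ => 0) u v) (hac : a ≤ c) (hcd : c ≤ d)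
    (hdb : d ≤ b) : ‖∫ r in c..d, v r‖ₑ ≤
      C * (M * (‖y‖ₑ * ENNReal.ofReal τ ^ (1 / P.toReal)))
        * ENNReal.ofReal (d - c) ^ (1 - 1 / P.toReal) := by
  rcases hcd.eq_or_lt with rfl | hcd'
  · simp
  refine (enorm_integral_le_eLpNorm_one v hcd).trans ((eLpNorm_one_le_iv hP
    (memLp_iv_mono hs.memV hac hdb).1).trans (mul_le_mul_left ?_ _))
  exact (eLpNorm_iv_mono v hac hdb).trans (hE.eLpNorm_deriv_le hP ha (by linarith) hb hs)

/-- At time c the two orbits differ by the distance the earlier one has already travelled; from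
there on the difference is an orbit, amplified by at most K. -/
lemma EvolWP.enorm_sub_le (hP : 1 ≤ P) (hE : EvolWP ι A P τ M C K) (ha : 0 ≤ a) (hac : a ≤ c)
    (hb : b ≤ τ) (hs : Sol ι A P a b (ι y) (fun _ => 0) u v)
    (hs' : Sol ι A P c b (ι y) (fun _ => 0) u' v') {t : ℝ} (hct : c ≤ t) (htb : t ≤ b) :
    ‖(ι y + ∫ r in a..t, v r) - (ι y + ∫ r in c..t, v' r)‖ₑ
      ≤ (K + 1) * ‖∫ r in a..c, v r‖ₑ := by
  have i1 := hs.intervalIntegrable hP (c := a) (d := c) ⟨le_rfl, by linarith⟩ ⟨hac, by linarith⟩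
  have i2 := hs.intervalIntegrable hP (c := c) (d := t) ⟨hac, by linarith⟩ ⟨by linarith, htb⟩
  rw [← intervalIntegral.integral_add_adjacent_intervals i1 i2]
  rcases hct.eq_or_lt with rfl | hct'
  · rw [intervalIntegral.integral_same, intervalIntegral.integral_same, add_zero, add_zero,
      add_sub_cancel_left]
    exact le_mul_of_one_le_left' (by simp)
  have h1 := (hs.restrict hP hac (by linarith) le_rfl).sub hP hs'
  rw [sub_zero, add_sub_cancel_left] at h1
  have h2 := hE.enorm_le hP (ha.trans hac) hb h1 hct' htb
  rw [intervalIntegral.integral_sub i2 (hs'.intervalIntegrable hP ⟨le_rfl, by linarith⟩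
    ⟨hct, htb⟩)] at h2
  refine le_trans (le_of_eq ?_) (h2.trans ?_)
  · congr 1; abel
  · gcongr; simp

/-- Joint Hölder continuity of the orbits starting in `D`, as functions of the time and of the
initial time. -/
lemma EvolWP.enorm_orbit_sub_le (hP : 1 ≤ P) (hP' : P ≠ ∞) (hE : EvolWP ι A P τ M C K)
    {s s' t t' : ℝ}
    (hs0 : 0 ≤ s) (hst : s ≤ t) (ht : t ≤ τ) (hss : s ≤ s') (hst' : s' ≤ t') (ht' : t' ≤ τ)
    (h : Sol ι A P s τ (ι y) (fun _ => 0) u v) (h' : Sol ι A P s' τ (ι y) (fun _ => 0) u' v') :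
    ‖(ι y + ∫ r in s..t, v r) - (ι y + ∫ r in s'..t', v' r)‖ₑ
      ≤ (K + 1) * (C * (M * (‖y‖ₑ * ENNReal.ofReal τ ^ (1 / P.toReal)))) *
        (ENNReal.ofReal |s - s'| ^ (1 - 1 / P.toReal)
          + ENNReal.ofReal |t - t'| ^ (1 - 1 / P.toReal)) := by
  have hPr : 1 ≤ P.toReal := by simpa using (ENNReal.toReal_le_toReal (by simp) hP').2 hP
  have hκ : 0 ≤ 1 - 1 / P.toReal := by rw [sub_nonneg, div_le_one] <;> linarith
  set H := C * (M * (‖y‖ₑ * ENNReal.ofReal τ ^ (1 / P.toReal)))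
  set κ := 1 - 1 / P.toReal
  have hmono : ∀ {p q : ℝ}, p ≤ q → ENNReal.ofReal p ^ κ ≤ ENNReal.ofReal q ^ κ := fun hpq =>
    ENNReal.rpow_le_rpow (ENNReal.ofReal_le_ofReal hpq) hκ
  have hs'0 : 0 ≤ s' := hs0.trans hss
  rw [abs_sub_comm s, abs_of_nonneg (by linarith : 0 ≤ s' - s), mul_add]
  rcases le_or_gt s' t with h1 | h1
  · have e : (ι y + ∫ r in s..t, v r) - (ι y + ∫ r in s'..t', v' r)
        = ((ι y + ∫ r in s..t, v r) - (ι y + ∫ r in s'..t, v' r))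
          + ((∫ r in s'..t, v' r) - ∫ r in s'..t', v' r) := by abel
    rw [e]
    refine (enorm_add_le _ _).trans (add_le_add ?_ ?_)
    · refine (hE.enorm_sub_le hP hs0 hss le_rfl h h' h1 ht).trans ?_
      rw [mul_assoc]
      gcongr
      exact hE.enorm_integral_le hP hs0 le_rfl h le_rfl hss (by linarith)
    · rw [mul_assoc]
      refine le_trans ?_ (le_mul_of_one_le_left' (by simp))
      have i1 := h'.intervalIntegrable hP (c := s') (d := t) ⟨le_rfl, by linarith⟩ ⟨h1, ht⟩
      have i2 := h'.intervalIntegrable hP (c := s') (d := t') ⟨le_rfl, by linarith⟩ ⟨hst', ht'⟩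
      rcases le_total t t' with h2 | h2
      · rw [← enorm_neg, neg_sub, intervalIntegral.integral_interval_sub_left i2 i1]
        refine (hE.enorm_integral_le hP hs'0 le_rfl h' h1 h2 ht').trans (mul_le_mul_right ?_ _)
        exact hmono (by rw [abs_sub_comm]; exact le_abs_self _)
      · rw [intervalIntegral.integral_interval_sub_left i1 i2]
        refine (hE.enorm_integral_le hP hs'0 le_rfl h' hst' h2 ht).trans (mul_le_mul_right ?_ _)
        exact hmono (le_abs_self _)
  -- The time intervals are disjoint: each orbit is compared with the common initial value, and t -
  -- s as well as t' - s' are dominated by s' - s and t' - t.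
  · have e : (ι y + ∫ r in s..t, v r) - (ι y + ∫ r in s'..t', v' r)
        = (∫ r in s..t, v r) - ∫ r in s'..t', v' r := by abel
    rw [e, mul_assoc (K + 1 : ℝ≥0∞) H, mul_assoc (K + 1 : ℝ≥0∞) H]
    refine _root_.enorm_sub_le.trans (add_le_add ?_ ?_)
    · refine le_trans ?_ (le_mul_of_one_le_left' (by simp))
      exact (hE.enorm_integral_le hP hs0 le_rfl h le_rfl hst ht).trans
        (mul_le_mul_right (hmono (by linarith)) _)
    · refine le_trans ?_ (le_mul_of_one_le_left' (by simp))
      refine (hE.enorm_integral_le hP hs'0 le_rfl h' le_rfl hst' ht').trans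
        (mul_le_mul_right (hmono ?_) _)
      rw [abs_sub_comm]
      exact le_trans (by linarith) (le_abs_self _)

lemma EvolWP.exists_orbits (hP : 1 ≤ P) (hE : EvolWP ι A P τ M C K) :
    ∃ (u : ℝ → D → ℝ → D) (v : ℝ → D → ℝ → X), ∀ s ∈ Icc 0 τ, ∀ y,
      Sol ι A P s τ (ι y) (fun _ => 0) (u s y) (v s y) := by
  have h : ∀ s y, ∃ u v, s ∈ Icc 0 τ → Sol ι A P s τ (ι y) (fun _ => 0) u v := by
    intro s y
    by_cases hs : s ∈ Icc 0 τ
    · obtain ⟨u, v, h⟩ := hE.exists_iv hP hs.1 le_rfl y (f := fun _ => 0) (memLp_const 0)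
      exact ⟨u, v, fun _ => h⟩
    · exact ⟨fun _ => 0, fun _ => 0, fun h => absurd h hs⟩
  choose u v huv using h
  exact ⟨u, v, fun s hs y => huv s y hs⟩

lemma EvolWP.continuousOn_orbits (hP : 1 < P) (hP' : P ≠ ∞) (hE : EvolWP ι A P τ M C K)
    {u : ℝ → D → ℝ → D} {v : ℝ → D → ℝ → X} (huv : ∀ s ∈ Icc 0 τ, ∀ y,
      Sol ι A P s τ (ι y) (fun _ => 0) (u s y) (v s y)) (y : D) :
    ContinuousOn (fun z : ℝ × ℝ => ι y + ∫ r in z.2..z.1, v z.2 y r)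
      {z | 0 ≤ z.2 ∧ z.2 ≤ z.1 ∧ z.1 ≤ τ} := by
  have hPr : 1 < P.toReal := by simpa using (ENNReal.toReal_lt_toReal (by simp) hP').2 hP
  have hκ : 0 < 1 - 1 / P.toReal := by rw [sub_pos, div_lt_one] <;> linarith
  rintro ⟨t₀, s₀⟩ ⟨h1, h2, h3⟩
  rw [ContinuousWithinAt, tendsto_iff_edist_tendsto_0]
  set H : ℝ≥0∞ := (K + 1) * (C * (M * (‖y‖ₑ * ENNReal.ofReal τ ^ (1 / P.toReal))))
  have hH : H ≠ ∞ := by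
    have : ENNReal.ofReal τ ^ (1 / P.toReal) ≠ ∞ :=
      ENNReal.rpow_ne_top_of_nonneg (by positivity) (by simp)
    finiteness
  have hle : ∀ z ∈ {z : ℝ × ℝ | 0 ≤ z.2 ∧ z.2 ≤ z.1 ∧ z.1 ≤ τ},
      edist (ι y + ∫ r in z.2..z.1, v z.2 y r) (ι y + ∫ r in s₀..t₀, v s₀ y r)
        ≤ H * (ENNReal.ofReal |z.2 - s₀| ^ (1 - 1 / P.toReal)
          + ENNReal.ofReal |z.1 - t₀| ^ (1 - 1 / P.toReal)) := by
    rintro ⟨t, s⟩ ⟨h1', h2', h3'⟩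
    simp only at h1 h2 h3 h1' h2' h3' ⊢
    rcases le_total s s₀ with h | h
    · rw [edist_eq_enorm_sub]
      exact hE.enorm_orbit_sub_le hP.le hP' h1' h2' h3' h h2 h3
        (huv s ⟨h1', by linarith⟩ y) (huv s₀ ⟨h1, by linarith⟩ y)
    · rw [edist_comm, edist_eq_enorm_sub, abs_sub_comm s, abs_sub_comm t]
      exact hE.enorm_orbit_sub_le hP.le hP' h1 h2 h3 h h2' h3'
        (huv s₀ ⟨h1, by linarith⟩ y) (huv s ⟨h1', by linarith⟩ y)
  refine tendsto_of_tendsto_of_tendsto_of_le_of_le' tendsto_const_nhds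
    (h := fun z : ℝ × ℝ => H * (ENNReal.ofReal |z.2 - s₀| ^ (1 - 1 / P.toReal)
          + ENNReal.ofReal |z.1 - t₀| ^ (1 - 1 / P.toReal))) ?_
    (Eventually.of_forall fun _ => bot_le) (eventually_nhdsWithin_of_forall hle)
  have hz : ∀ g : ℝ × ℝ → ℝ, Continuous g → g (t₀, s₀) = 0 → Tendsto
      (fun z => ENNReal.ofReal (g z) ^ (1 - 1 / P.toReal)) (𝓝 (t₀, s₀)) (𝓝 0) := by
    intro g hg h0
    have h4 := ENNReal.tendsto_ofReal (hg.tendsto (t₀, s₀))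
    rw [h0, ENNReal.ofReal_zero] at h4
    have h5 := h4.ennrpow_const (1 - 1 / P.toReal)
    rwa [ENNReal.zero_rpow_of_pos hκ] at h5
  have h6 := (hz (fun z => |z.2 - s₀|) (by fun_prop) (by simp)).add
    (hz (fun z => |z.1 - t₀|) (by fun_prop) (by simp))
  rw [add_zero] at h6
  have h7 := ENNReal.Tendsto.const_mul h6 (Or.inr hH)
  rw [mul_zero] at h7
  exact h7.mono_left nhdsWithin_le_nhds

end OrbitContinuity

/-! ### Construction of the evolution family. -/

section Propagator

set_option linter.unusedSectionVars false

open Filter Topology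
open scoped NNReal

variable {𝕜 X D : Type*} [RCLike 𝕜] [NormedAddCommGroup X] [NormedAddCommGroup D]
  [NormedSpace 𝕜 X] [NormedSpace 𝕜 D]
  [NormedSpace ℝ X] [NormedSpace ℝ D] [IsScalarTower ℝ 𝕜 X] [IsScalarTower ℝ 𝕜 D]
  [CompleteSpace X] [CompleteSpace D]
  {ι : D →L[𝕜] X} {A : ℝ → D →L[𝕜] X} {a b τ : ℝ} {P : ℝ≥0∞} {C K M : ℝ≥0}
  {x : X} {f v : ℝ → X} {u : ℝ → D}

/-- The real problem underlying a problem over `𝕜`. -/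
abbrev realify (A : ℝ → D →L[𝕜] X) : ℝ → D →L[ℝ] X := fun t => (A t).restrictScalars ℝ

lemma Sol.smul_rclike (h : Sol (ι.restrictScalars ℝ) (realify A) P a b x f u v) (k : 𝕜) :
    Sol (ι.restrictScalars ℝ) (realify A) P a b (k • x) (fun t => k • f t) (fun t => k • u t)
      (fun t => k • v t) := by
  have : SMulCommClass ℝ 𝕜 X := IsScalarTower.to_smulCommClass
  refine ⟨h.memU.const_smul k, h.memV.const_smul k, ?_, ?_⟩
  · filter_upwards [h.prim] with t h1
    rw [intervalIntegral.integral_smul, ← smul_add, ← h1]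
    exact map_smul ι k (u t)
  · filter_upwards [h.eqn] with t h1
    rw [← h1, smul_add]
    congr 1
    exact map_smul (A t) k (u t)

/-- The family `U` solves the initial value problems for `A`. -/
structure IsPropagator (ι : D →L[𝕜] X) (A : ℝ → D →L[𝕜] X) (P : ℝ≥0∞) (τ : ℝ)
    (U : ℝ → ℝ → X →L[𝕜] X) : Prop where
  isEvolutionFamily : IsEvolutionFamily τ U
  orbit : ∀ a b x u v, 0 ≤ a → a ≤ b → b ≤ τ →
    Sol (ι.restrictScalars ℝ) (realify A) P a b x (fun _ => 0) u v →
    ∀ t ∈ Icc a b, U t a x = x + ∫ r in a..t, v r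

/-- Uniqueness makes the solution map linear over 𝕜, and the orbit bound in the norm of X lets it
extend from the dense image of D. -/
lemma EvolWP.exists_extension (hP : 1 ≤ P) (hd : DenseRange ι)
    (hE : EvolWP (ι.restrictScalars ℝ) (realify A) P τ M C K)
    {u : ℝ → D → ℝ → D} {v : ℝ → D → ℝ → X} (huv : ∀ s ∈ Icc 0 τ, ∀ y,
      Sol (ι.restrictScalars ℝ) (realify A) P s τ (ι y) (fun _ => 0) (u s y) (v s y)) {s t : ℝ}
    (hs : 0 ≤ s) (hst : s ≤ t) (ht : t ≤ τ) :
    ∃ T : X →L[𝕜] X, (∀ y, T (ι y) = ι y + ∫ r in s..t, v s y r) ∧ ∀ x, ‖T x‖ ≤ K * ‖x‖ := by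
  have : SMulCommClass ℝ 𝕜 X := IsScalarTower.to_smulCommClass
  have hsτ : s ∈ Icc 0 τ := ⟨hs, hst.trans ht⟩
  have hint : ∀ y, IntervalIntegrable (v s y) volume s t := fun y =>
    (huv s hsτ y).intervalIntegrable hP ⟨le_rfl, hsτ.2⟩ ⟨hst, ht⟩
  have hadd : ∀ y y', (∫ r in s..t, v s (y + y') r)
      = (∫ r in s..t, v s y r) + ∫ r in s..t, v s y' r := by
    intro y y'
    have h1 := (huv s hsτ y).add hP (huv s hsτ y')
    rw [← map_add, add_zero] at h1
    rw [← intervalIntegral.integral_add (hint y) (hint y')]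
    exact integral_congr_iv hst ht (hE.unique hP hs le_rfl (huv s hsτ (y + y')) h1).2
  have hsmul : ∀ (k : 𝕜) y, (∫ r in s..t, v s (k • y) r) = k • ∫ r in s..t, v s y r := by
    intro k y
    have h1 := (huv s hsτ y).smul_rclike k
    rw [← map_smul, smul_zero] at h1
    rw [← intervalIntegral.integral_smul]
    exact integral_congr_iv hst ht (hE.unique hP hs le_rfl (huv s hsτ (k • y)) h1).2
  let L : D →ₗ[𝕜] X :=
    { toFun := fun y => ι y + ∫ r in s..t, v s y r
      map_add' := fun y y' => by rw [map_add, hadd]; abel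
      map_smul' := fun k y => by rw [map_smul, hsmul, RingHom.id_apply, smul_add] }
  have hL : ∀ y, ‖L y‖ ≤ K * ‖ι y‖ := fun y => by
    have h1 := hE.orbit s τ y _ _ hs hsτ.2 le_rfl (huv s hsτ y) t ⟨hst, ht⟩
    rw [← ofReal_norm, ← ofReal_norm, ← ENNReal.ofReal_coe_nnreal,
      ← ENNReal.ofReal_mul (by positivity)] at h1
    exact (ENNReal.ofReal_le_ofReal_iff (by positivity)).1 h1
  exact ⟨L.extendOfNorm (ι : D →ₗ[𝕜] X), fun y => LinearMap.extendOfNorm_eq hd ⟨K, hL⟩ y,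
    fun x => LinearMap.norm_extendOfNorm_apply_le hd K hL x⟩

/-- Well-posedness yields an evolution family. -/
theorem EvolWP.exists_propagator (hP : 1 < P) (hP' : P ≠ ∞) (hd : DenseRange ι)
    (hE : EvolWP (ι.restrictScalars ℝ) (realify A) P τ M C K) :
    ∃ U, IsPropagator ι A P τ U := by
  obtain ⟨u, v, huv⟩ := hE.exists_orbits hP.le
  have hex : ∀ t s, ∃ T : X →L[𝕜] X, 0 ≤ s → s ≤ t → t ≤ τ →
      (∀ y, T (ι y) = ι y + ∫ r in s..t, v s y r) ∧ ∀ x, ‖T x‖ ≤ K * ‖x‖ := by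
    intro t s
    by_cases h : 0 ≤ s ∧ s ≤ t ∧ t ≤ τ
    · obtain ⟨T, hT⟩ := hE.exists_extension hP.le hd huv h.1 h.2.1 h.2.2
      exact ⟨T, fun _ _ _ => hT⟩
    · exact ⟨0, fun h1 h2 h3 => absurd ⟨h1, h2, h3⟩ h⟩
  choose U hU using hex
  have hcont : ∀ x : X, ContinuousOn (fun z : ℝ × ℝ => U z.1 z.2 x)
      {z | 0 ≤ z.2 ∧ z.2 ≤ z.1 ∧ z.1 ≤ τ} := by
    intro x
    -- The operators are bounded by K uniformly on the triangle, so orbits from X are uniform limits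
    -- of the jointly continuous orbits from D.
    refine continuousOn_of_uniform_approx_of_continuousOn fun V hV => ?_
    obtain ⟨ε, hε, hεV⟩ := Metric.mem_uniformity_dist.1 hV
    obtain ⟨y, hy⟩ := hd.exists_dist_lt x (ε := ε / (K + 1)) (by positivity)
    refine ⟨_, hE.continuousOn_orbits hP hP' huv y, ?_⟩
    rintro ⟨t, s⟩ ⟨h1, h2, h3⟩
    refine hεV ?_
    have h4 := (hU t s h1 h2 h3).1 y
    have h5 := (hU t s h1 h2 h3).2 (x - ι y)
    rw [map_sub, h4, ← dist_eq_norm, ← dist_eq_norm] at h5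
    refine h5.trans_lt ?_
    rw [lt_div_iff₀ (by positivity)] at hy
    nlinarith [dist_nonneg (x := x) (y := ι y)]
  -- The propagator was defined from D only. A solution starting at any x in X passes through the
  -- image of D at almost every c > a; restart there and let c tend to a.
  have horb : ∀ a b x u v, 0 ≤ a → a ≤ b → b ≤ τ →
      Sol (ι.restrictScalars ℝ) (realify A) P a b x (fun _ => 0) u v →
      ∀ t ∈ Icc a b, a < t → U t a x = x + ∫ r in a..t, v r := by
    intro a b x u' v' ha hab hb hs t ht hat
    have htτ : t ≤ τ := ht.2.trans hb
    refine eq_of_tendsto_of_ae (g := fun c => U t c (x + ∫ r in a..c, v' r)) hat ?_ ?_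
    · have h1 : Tendsto (fun c => U t c x) (𝓝[Icc a t] a) (𝓝 (U t a x)) := by
        have h2 := hcont x (t, a) ⟨ha, hat.le, htτ⟩
        refine h2.tendsto.comp (f := fun c : ℝ => (t, c)) ?_
        refine tendsto_nhdsWithin_iff.2 ⟨?_, eventually_nhdsWithin_of_forall fun c hc =>
          ⟨ha.trans hc.1, hc.2, htτ⟩⟩
        exact ((continuous_const.prodMk continuous_id).tendsto a).mono_left nhdsWithin_le_nhds
      have h3 : Tendsto (fun c => U t c (∫ r in a..c, v' r)) (𝓝[Icc a t] a) (𝓝 0) := by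
        have h4 := (continuousOn_primitive hP.le hab hs.memV a ⟨le_rfl, hab⟩).mono
          (Icc_subset_Icc le_rfl ht.2)
        have h5 := h4.tendsto.norm.const_mul (K : ℝ)
        rw [intervalIntegral.integral_same, norm_zero, mul_zero] at h5
        refine squeeze_zero_norm' (eventually_nhdsWithin_of_forall fun c hc => ?_) h5
        exact (hU t c (ha.trans hc.1) hc.2 htτ).2 _
      have h6 := h1.add h3
      rw [add_zero] at h6
      simpa only [map_add] using h6
    · filter_upwards [ae_iv_mono le_rfl ht.2 hs.prim, ae_iv_mem a t] with c hcD hc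
      have hc0 : 0 ≤ c := ha.trans hc.1.le
      have h2 := hs.restrict hP.le (c := c) hc.1.le (by linarith [hc.2, ht.2]) le_rfl
      rw [← hcD] at h2
      have h3 := (huv c ⟨hc0, by linarith [hc.2]⟩ (u' c)).restrict_left hP.le
        (by linarith [hc.2, ht.2]) hb
      have h4 := integral_congr_iv hc.2.le ht.2 (hE.unique hP.le hc0 hb h3 h2).2
      have h5 := (hU t c hc0 hc.2.le htτ).1 (u' c)
      rw [h4] at h5
      rw [← hcD]
      refine h5.trans ?_
      have h6 : ι (u' c) = x + ∫ r in a..c, v' r := hcD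
      rw [h6, add_assoc, intervalIntegral.integral_add_adjacent_intervals
        (hs.intervalIntegrable hP.le ⟨le_rfl, hab⟩ ⟨hc.1.le, by linarith [hc.2, ht.2]⟩)
        (hs.intervalIntegrable hP.le ⟨hc.1.le, by linarith [hc.2, ht.2]⟩ ht)]
  have hrefl : ∀ s ∈ Icc 0 τ, U s s = ContinuousLinearMap.id 𝕜 X := by
    intro s hs
    refine ContinuousLinearMap.ext fun x => ?_
    refine congrFun (hd.equalizer (U s s).continuous continuous_id (funext fun y => ?_)) x
    simp [(hU s s hs.1 le_rfl hs.2).1 y]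
  have horb' : ∀ a b x u v, 0 ≤ a → a ≤ b → b ≤ τ →
      Sol (ι.restrictScalars ℝ) (realify A) P a b x (fun _ => 0) u v →
      ∀ t ∈ Icc a b, U t a x = x + ∫ r in a..t, v r := by
    intro a b x u v ha hab hb hs t ht
    rcases ht.1.eq_or_lt with rfl | hat
    · simp [hrefl a ⟨ha, hab.trans hb⟩]
    · exact horb a b x u v ha hab hb hs t ht hat
  refine ⟨U, ⟨hrefl, fun s r t hs hsr hrt ht => ?_, hcont⟩, horb'⟩
  refine ContinuousLinearMap.ext fun x => ?_
  refine congrFun (hd.equalizer (U t s).continuous ((U t r).comp (U r s)).continuous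
    (funext fun y => ?_)) x
  have hsτ : s ∈ Icc 0 τ := ⟨hs, by linarith⟩
  have h1 := huv s hsτ y
  have h2 := h1.restrict hP.le hsr (hrt.trans ht) le_rfl
  have h3 : U r s (ι y) = _ := horb' s τ _ _ _ hs hsτ.2 le_rfl h1 r ⟨hsr, by linarith⟩
  have h4 : U t s (ι y) = _ := horb' s τ _ _ _ hs hsτ.2 le_rfl h1 t ⟨by linarith, ht⟩
  have h5 := horb' r τ _ _ _ (by linarith) (by linarith) le_rfl h2 t ⟨hrt, ht⟩
  simp only [Function.comp_apply, ContinuousLinearMap.comp_apply]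
  rw [h3, h4]
  refine Eq.trans ?_ h5.symm
  rw [add_assoc, intervalIntegral.integral_add_adjacent_intervals
    (h1.intervalIntegrable hP.le ⟨le_rfl, hsτ.2⟩ ⟨hsr, by linarith⟩)
    (h1.intervalIntegrable hP.le ⟨hsr, by linarith⟩ ⟨by linarith, ht⟩)]

end Propagator

end NonAutonomous

namespace NonAutonomous

/-! ### Associated evolution families and transfer of admissibility. -/

section Association

set_option linter.unusedSectionVars false

open Filter Topology
open scoped NNReal

variable {𝕜 X D Y : Type*} [RCLike 𝕜] [NormedAddCommGroup X] [NormedAddCommGroup D]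
  [NormedAddCommGroup Y] [NormedSpace 𝕜 X] [NormedSpace 𝕜 D] [NormedSpace 𝕜 Y]
  [NormedSpace ℝ X] [NormedSpace ℝ D] [NormedSpace ℝ Y]
  [IsScalarTower ℝ 𝕜 X] [IsScalarTower ℝ 𝕜 D] [IsScalarTower ℝ 𝕜 Y]
  [CompleteSpace X] [CompleteSpace D]
  {ι : D →L[𝕜] X} {A A' R : ℝ → D →L[𝕜] X} {a b q τ : ℝ} {P : ℝ≥0∞} {C C' K K' M M' N γ c : ℝ≥0}
  {x : X} {y : D} {f v : ℝ → X} {u : ℝ → D} {U U' : ℝ → ℝ → X →L[𝕜] X}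

lemma apply_mem_traceSpace (hι : Function.Injective ι) (y : D) (p : ℝ) : ι y ∈ traceSpace ι p := by
  refine ⟨fun _ => ι y, ⟨⟨fun _ => 0, memLp_const 0, by simp⟩, ?_, ?_⟩, rfl⟩
  · exact Eventually.of_forall fun _ => mem_range_self y
  · simp only [toD_apply hι]
    exact memLp_const y

/-- Solvability of the homogeneous problem for initial values in the trace space. -/
lemma EvolWP.exists_sol_of_mem_traceSpace (hq : 1 < q)
    (hE : EvolWP (ι.restrictScalars ℝ) (realify A) (ENNReal.ofReal q) τ M C K) {s : ℝ}
    (hs : s ∈ Ico 0 τ) (hx : x ∈ traceSpace ι q) :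
    ∃ u v, Sol (ι.restrictScalars ℝ) (realify A) (ENNReal.ofReal q) s τ x (fun _ => 0) u v := by
  have hP : 1 ≤ ENNReal.ofReal q := by simpa using hq.le
  obtain ⟨w, ⟨⟨v, hv⟩, hw⟩, rfl⟩ := hx
  -- Viewing w as a solution for the zero operator, which is autonomous, allows it to be translated
  -- to start at s.
  have h0 : IsSolution ι (fun _ => 0) q 0 1 v w := ⟨hw, v, hv, by simp⟩
  obtain ⟨v₁, h1, -⟩ := h0.exists_sol
  have h2 := Sol.shift (B := (0 : D →L[𝕜] X).restrictScalars ℝ) h1 (-s)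
  simp only [zero_sub, neg_neg] at h2
  set e := min (1 - -s) τ with he
  have hse : s < e := lt_min (by linarith) hs.2
  have heτ : e ≤ τ := min_le_right _ _
  have h3 := h2.restrict_left hP hse.le (min_le_left _ _)
  set u₂ : ℝ → D := fun t => toD ι (w (t + -s))
  set v₂ : ℝ → X := fun t => v₁ (t + -s)
  have h4 : Sol (ι.restrictScalars ℝ) (realify A) (ENNReal.ofReal q) s e (w 0)
      (fun t => v₂ t + realify A t (u₂ t)) u₂ v₂ := h3.congr_op (by simp)
  have hf : MemLp (fun t => v₂ t + realify A t (u₂ t)) (ENNReal.ofReal q) (iv s e) :=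
    h4.memV.add ((hE.opBdd.mono hs.1 heτ).memLp h4.memU)
  -- Subtracting a solution with zero initial value removes the right-hand side on a short interval;
  -- after a time at which the value lies in the image of D, the homogeneous solution is continued
  -- up to τ.
  obtain ⟨u₃, v₃, h5⟩ := (hE.wp s e hs.1 hse heτ).exists_sol _ hf
  have h6 := (h4.sub hP h5).congr (f' := fun _ => 0) (by simp)
  rw [sub_zero] at h6
  obtain ⟨c, hc, hcD⟩ := h6.exists_mem_D le_rfl hse le_rfl
  obtain ⟨u₄, v₄, h7⟩ := hE.exists_iv hP (hs.1.trans hc.1.le) le_rfl (u₂ c - u₃ c)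
    (f := fun _ => 0) (memLp_const 0)
  rw [hcD] at h7
  exact ⟨_, _, (h6.restrict_left hP hc.1.le hc.2.le).concat hP hc.1.le h7⟩

lemma IsPropagator.isAssociated (hι : Function.Injective ι) (hq : 1 < q)
    (hE : EvolWP (ι.restrictScalars ℝ) (realify A) (ENNReal.ofReal q) τ M C K)
    (hU : IsPropagator ι A (ENNReal.ofReal q) τ U) : IsAssociated ι τ A U := by
  refine ⟨hU.isEvolutionFamily, q, hq, fun s hs x hx => ?_⟩
  obtain ⟨u, v, h⟩ := hE.exists_sol_of_mem_traceSpace hq hs hx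
  exact h.isSolution hι hs.2.le (hU.orbit s τ x u v hs.1 hs.2.le le_rfl h)

/-- Uniqueness of the associated evolution family. -/
lemma IsPropagator.eq_of_isAssociated (hι : Function.Injective ι) (hd : DenseRange ι)
    (hq : 1 < q) (hE : ∀ r, 1 < r → r ≤ q → ∃ M C K,
      EvolWP (ι.restrictScalars ℝ) (realify A) (ENNReal.ofReal r) τ M C K)
    (hU : IsPropagator ι A (ENNReal.ofReal q) τ U) (hU' : IsAssociated ι τ A U') (s t : ℝ)
    (hs : 0 ≤ s) (hst : s ≤ t) (ht : t ≤ τ) : U' t s = U t s := by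
  obtain ⟨hF, q', hq', h1⟩ := hU'
  rcases (hst.trans ht).eq_or_lt with rfl | hsτ
  · obtain rfl : s = t := le_antisymm hst ht
    rw [hF.refl s ⟨hs, le_rfl⟩, hU.isEvolutionFamily.refl s ⟨hs, le_rfl⟩]
  refine ContinuousLinearMap.ext fun x => ?_
  refine congrFun (hd.equalizer (U' t s).continuous (U t s).continuous (funext fun y => ?_)) x
  obtain ⟨v', h2, h3⟩ := (h1 s ⟨hs, hsτ⟩ (ι y) (apply_mem_traceSpace hι y q')).exists_sol
  have h0 : U' s s (ι y) = ι y := by rw [hF.refl s ⟨hs, hsτ.le⟩]; rfl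
  simp only [h0] at h2 h3
  obtain ⟨M, C, K, hEq⟩ := hE q hq le_rfl
  obtain ⟨u, v, h4⟩ := hEq.exists_iv (by simpa using hq.le) hs le_rfl y (f := fun _ => 0)
    (memLp_const 0)
  -- The exponent q' of the other family is unknown. Both orbits are solutions at the smaller
  -- exponent, where uniqueness holds; hence well-posedness is required for all exponents up to q.
  obtain ⟨M', C', K', hEr⟩ := hE (min q q') (lt_min hq hq') (min_le_left _ _)
  have h5 := (hEr.unique (by simpa using ⟨hq.le, hq'.le⟩) hs le_rfl
    (h2.mono_exponent (ENNReal.ofReal_le_ofReal (min_le_right _ _)))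
    (h4.mono_exponent (ENNReal.ofReal_le_ofReal (min_le_left _ _)))).2
  have h6 : U t s (ι y) = _ := hU.orbit s τ _ u v hs hsτ.le le_rfl h4 t ⟨hst, ht⟩
  simp only [Function.comp_apply]
  rw [h6, h3 t ⟨hst, ht⟩, integral_congr_iv hst ht h5]
  rfl

lemma IsPropagator.toD_apply (hι : Function.Injective ι) (hU : IsPropagator ι A P τ U)
    (ha : 0 ≤ a) (hb : b ≤ τ)
    (hs : Sol (ι.restrictScalars ℝ) (realify A) P a b (ι y) (fun _ => 0) u v) :
    ∀ᵐ t ∂(iv a b), toD ι (U t a (ι y)) = u t := by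
  filter_upwards [hs.prim, ae_iv_mem a b] with t h1 ht
  have h2 := hU.orbit a b _ u v ha (ht.1.trans ht.2).le hb hs t (Ioo_subset_Icc_self ht)
  rw [h2, ← h1]
  exact NonAutonomous.toD_apply hι (u t)

/-- Fatou, to pass from the estimates on (s,τ') with τ' < τ in (H2) to the whole interval (s,τ). -/
lemma eLpNorm_iv_le_of_lt {Z : Type*} [NormedAddCommGroup Z] {g : ℝ → Z} {κ : ℝ≥0∞}
    (hab : a < b) (hg : AEStronglyMeasurable g (iv a b))
    (h : ∀ d, a < d → d < b → eLpNorm g P (iv a d) ≤ κ) : eLpNorm g P (iv a b) ≤ κ := by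
  set d : ℕ → ℝ := fun n => b - (b - a) * (1 / ((n : ℝ) + 2)) with hd
  have hpos : 0 < b - a := by linarith
  have hd1 : ∀ n, a < d n := fun n => by
    have : (1 : ℝ) / ((n : ℝ) + 2) < 1 := by
      rw [div_lt_one (by positivity)]; linarith [(Nat.cast_nonneg n : (0 : ℝ) ≤ n)]
    simp only [hd]
    nlinarith
  have hd2 : ∀ n, d n < b := fun n => by
    have : 0 < (b - a) * (1 / ((n : ℝ) + 2)) := by positivity
    simp only [hd]
    linarith
  have hlim : Tendsto d atTop (𝓝 b) := by
    have h1 : Tendsto (fun n : ℕ => (1 : ℝ) / ((n : ℝ) + 2)) atTop (𝓝 0) := by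
      have := (tendsto_add_atTop_iff_nat 1).2 (tendsto_one_div_add_atTop_nhds_zero_nat (𝕜 := ℝ))
      refine this.congr fun n => ?_
      push_cast
      rw [add_assoc]; norm_num
    have h2 := (h1.const_mul (b - a)).const_sub b
    rwa [mul_zero, sub_zero] at h2
  refine (Lp.eLpNorm_lim_le_liminf_eLpNorm (f := fun n => (Ioo a (d n)).indicator g)
    (fun n => hg.indicator measurableSet_Ioo) g ?_).trans ?_
  · filter_upwards [ae_iv_mem a b] with t ht
    refine tendsto_const_nhds.congr' ?_
    filter_upwards [hlim.eventually_const_lt ht.2] with n hn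
    rw [indicator_of_mem (show t ∈ Ioo a (d n) from ⟨ht.1, hn⟩)]
  · refine (liminf_le_liminf (v := fun _ => κ) (Eventually.of_forall fun n =>
      (eLpNorm_extend_zero_le g).trans (h (d n) (hd1 n) (hd2 n)))).trans ?_
    simp

lemma ofReal_mul_norm {Z : Type*} [NormedAddCommGroup Z] {c : ℝ} (hc : 0 ≤ c) (z : Z) :
    ENNReal.ofReal (c * ‖z‖) = (c.toNNReal : ℝ≥0∞) * ‖z‖ₑ := by
  rw [ENNReal.ofReal_mul hc, ofReal_norm]; rfl

/-- The Miyadera–Voigt condition in terms of solutions. -/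
lemma MiyaderaVoigt.exists_obsBdd (hι : Function.Injective ι) {μ : ℝ}
    (h : MiyaderaVoigt ι τ A R μ) (hR : OpBdd (realify R) N 0 τ)
    (hass : IsAssociated ι τ A U) (hU : IsPropagator ι A P τ U) :
    ∃ γ, ObsBdd (ι.restrictScalars ℝ) (realify A) P (realify R) (ENNReal.ofReal μ) 0 τ γ := by
  obtain ⟨c, hc, h1⟩ := h U hass
  refine ⟨c.toNNReal, fun r y u v hr hrτ hs => ?_⟩
  refine eLpNorm_iv_le_of_lt hrτ ((hR.mono hr le_rfl).aestronglyMeasurable hs.memU.1)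
    fun d hrd hdτ => ?_
  have h2 := h1 r d hr hrd hdτ y
  rw [ofReal_mul_norm hc.le] at h2
  refine le_trans (le_of_eq (eLpNorm_congr_ae ?_)) h2
  filter_upwards [ae_iv_mono le_rfl hdτ.le (hU.toD_apply hι hr le_rfl hs)] with t ht
  rw [ht]; rfl

/-- Admissible observation operators of `A` are admissible for `A'`, if `A' - A` is bounded into
`L¹` on the orbits of `A'`. -/
lemma admissibleObs_subset (hι : Function.Injective ι) (hd : DenseRange ι) (hP : 1 ≤ P)
    (hP' : P ≠ ∞) (hE : EvolWP (ι.restrictScalars ℝ) (realify A) P τ M C K)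
    (hE' : EvolWP (ι.restrictScalars ℝ) (realify A') P τ M' C' K')
    (hU : IsPropagator ι A P τ U) (hU' : IsPropagator ι A' P τ U')
    (huniq : ∀ U₁, IsAssociated ι τ A U₁ → ∀ s t, 0 ≤ s → s ≤ t → t ≤ τ → U₁ t s = U t s)
    (hass : IsAssociated ι τ A' U') {θ : ℝ} (hθ : 1 ≤ θ)
    (hR : ObsBdd (ι.restrictScalars ℝ) (realify A') P (fun t => realify A' t - realify A t) 1 0 τ c) :
    admissibleObs Y ι τ A θ ⊆ admissibleObs Y ι τ A' θ := by
  rintro S ⟨U₁, hU₁, γ, α, hγ, hα, h⟩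
  -- The window length α is kept; the summand 1 only ensures that the constant is positive.
  refine ⟨U', hass, γ.toNNReal * (1 + c) + 1, α, by positivity, hα, fun s hs y => ?_⟩
  set e := min (s + α) τ with he
  have hse : s < e := lt_min (by linarith) hs.2
  have heτ : e ≤ τ := min_le_right _ _
  have hobs : ObsBdd (ι.restrictScalars ℝ) (realify A) P (fun _ => S.restrictScalars ℝ)
      (ENNReal.ofReal θ) s e γ.toNNReal := by
    intro r z u v hsr hre hs'
    have hr0 : 0 ≤ r := hs.1.trans hsr
    have h1 := h r ⟨hr0, hre.trans_le heτ⟩ z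
    rw [ofReal_mul_norm hγ.le] at h1
    -- An orbit starting at r in [s,e) is observed on (r,e), which lies inside its own admissibility
    -- window. Later starting times are needed by the convolution estimate.
    have hsub : e ≤ min (r + α) τ := min_le_min (by linarith) le_rfl
    refine le_trans (le_trans (le_of_eq (eLpNorm_congr_ae ?_)) (eLpNorm_iv_mono _ le_rfl hsub)) h1
    filter_upwards [hU.toD_apply hι hr0 heτ hs', ae_iv_mem r e] with t ht htm
    rw [huniq U₁ hU₁ r t hr0 htm.1.le (by linarith [htm.2]), ht]; rfl
  have h2 := hobs.of_perturb hd hP hP' (by simpa using hθ) hE hs.1 heτ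
    (OpBdd.const _ _ _) ((hR.mono_left hs.1).mono_right hP hE' hs.1 le_rfl heτ)
  obtain ⟨u, v, hs'⟩ := hE'.exists_iv hP hs.1 heτ y (f := fun _ => 0) (memLp_const 0)
  have h3 := h2 s y u v le_rfl hse hs'
  have h4 : eLpNorm (fun t => S (toD ι (U' t s (ι y)))) (ENNReal.ofReal θ) (iv s e)
      = eLpNorm (fun t => (S.restrictScalars ℝ) (u t)) (ENNReal.ofReal θ) (iv s e) :=
    eLpNorm_congr_ae (by
      filter_upwards [hU'.toD_apply hι hs.1 heτ hs'] with t ht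
      rw [ht]; rfl)
  rw [ofReal_mul_norm (by positivity)]
  refine (h4.le.trans h3).trans (mul_le_mul_left ?_ _)
  rw [ENNReal.coe_le_coe, ← NNReal.coe_le_coe, Real.coe_toNNReal _ (by positivity)]
  push_cast
  linarith

end Association

/-! ### From the stated hypotheses to uniform well-posedness. -/

section Hypotheses

set_option linter.unusedSectionVars false

open Filter Topology
open scoped NNReal

variable {𝕜 X D : Type*} [RCLike 𝕜] [NormedAddCommGroup X] [NormedAddCommGroup D]
  [NormedSpace 𝕜 X] [NormedSpace 𝕜 D] [NormedSpace ℝ X] [NormedSpace ℝ D]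
  [IsScalarTower ℝ 𝕜 X] [IsScalarTower ℝ 𝕜 D] [CompleteSpace X] [CompleteSpace D]
  {ι : D →L[𝕜] X} {A : ℝ → D →L[𝕜] X} {τ : ℝ}

lemma IsStronglyMeasBdd.exists_opBdd (hA : IsStronglyMeasBdd τ A) :
    ∃ M, OpBdd (realify A) M 0 τ := by
  obtain ⟨h1, M, h2⟩ := hA
  refine ⟨M.toNNReal, fun y => (h1 y).mono_measure (Measure.restrict_mono Ioo_subset_Icc_self le_rfl),
    fun t ht => ?_⟩
  rw [ContinuousLinearMap.norm_restrictScalars]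
  exact (h2 t (Ioo_subset_Icc_self ht)).trans (Real.le_coe_toNNReal _)

lemma memLp_div_of_integrableOn {ω : ℝ → ℝ} {ν : ℝ} (hν : 1 < ν) (hω : ContinuousOn ω (Icc 0 τ))
    (hω0 : ∀ t ∈ Icc 0 τ, 0 ≤ ω t) (hint : IntegrableOn (fun t => (ω t / t) ^ ν) (Ioc 0 τ)) :
    MemLp (fun t => ω t / t) (ENNReal.ofReal ν) (iv 0 τ) := by
  have hm : AEStronglyMeasurable (fun t => ω t / t) (iv 0 τ) := by
    refine AEStronglyMeasurable.div₀ ?_ measurable_id.aestronglyMeasurable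
    exact (hω.mono Ioo_subset_Icc_self).aestronglyMeasurable measurableSet_Ioo
  rw [← integrable_norm_rpow_iff hm (by simp; linarith) (by simp),
    ENNReal.toReal_ofReal (by linarith)]
  refine (hint.mono_set Ioo_subset_Ioc_self).congr ?_
  filter_upwards [ae_restrict_mem measurableSet_Ioo] with t ht
  rw [Real.norm_of_nonneg (div_nonneg (hω0 t (Ioo_subset_Icc_self ht)) ht.1.le)]

/-- Under `(H1)`, the problem is well-posed for all exponents close to `1`. -/
lemma CondH1.exists_evolWP (hι : Function.Injective ι) (hτ : 0 < τ) (hA : IsStronglyMeasBdd τ A)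
    (h : CondH1 ι τ A) : ∃ q, 1 < q ∧ ∀ r, 1 < r → r ≤ q → ∃ M C K,
      EvolWP (ι.restrictScalars ℝ) (realify A) (ENNReal.ofReal r) τ M C K := by
  obtain ⟨hmr, ν, hν, η, ω, hη, hωc, hω0, hωz, hωi, hb⟩ := h
  obtain ⟨M, hM⟩ := hA.exists_opBdd
  have hR : RelCont (ι.restrictScalars ℝ) (realify A) τ η ω := ⟨hη, hωc, hω0, hωz, hb⟩
  obtain ⟨p₀, hp₀, h1⟩ := hR.exists_exponent hι hτ hM (by
    intro s hs
    obtain ⟨p, hp, h2⟩ := hmr s hs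
    obtain ⟨C, hC⟩ := h2.exists_autWP hι hp one_pos
    exact ⟨p, C, hp, hC⟩)
  -- Below p₀ all frozen operators have maximal regularity; below ν the quotient ω(t)/t is
  -- r-integrable.
  refine ⟨min p₀ ν, lt_min hp₀ hν, fun r hr hrq => ?_⟩
  have hP : 1 ≤ ENNReal.ofReal r := by simpa using hr.le
  obtain ⟨h, C, hh, hW⟩ := hR.exists_uniform hτ hM hP (by simp)
    (h1 r hr (hrq.trans (min_le_left _ _)))
  have hωL := (memLp_div_of_integrableOn hν hωc hω0 hωi).mono_exponent
    (ENNReal.ofReal_le_ofReal (hrq.trans (min_le_right _ _)))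
  obtain ⟨K, hK⟩ := hR.exists_orbit_bound hP (by simp) hωL hh hW
  have hL : LocWP (ι.restrictScalars ℝ) (realify A) (ENNReal.ofReal r) τ h C :=
    fun a b ha hab hbh hbτ => (hW a ⟨ha, by linarith⟩).2 b hab hbh hbτ
  obtain ⟨C', K', hE⟩ := hL.exists_evolWP hP hτ hM hh hK
  exact ⟨M, C', K', hE⟩

end Hypotheses

end NonAutonomous

/-! ### The main theorem. -/

theorem mainTheorem1 {𝕜 X D Y : Type*} [RCLike 𝕜]
    [NormedAddCommGroup X] [NormedSpace 𝕜 X] [NormedSpace ℝ X] [IsScalarTower ℝ 𝕜 X]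
    [CompleteSpace X]
    [NormedAddCommGroup D] [NormedSpace 𝕜 D] [CompleteSpace D]
    [NormedAddCommGroup Y] [NormedSpace 𝕜 Y] [CompleteSpace Y]
    (ι : D →L[𝕜] X) (hι : Function.Injective ι) (hιd : DenseRange ι)
    (τ : ℝ) (hτ : 0 < τ) (A P : ℝ → D →L[𝕜] X)
    (hA : NonAutonomous.IsStronglyMeasBdd τ A) (hP : NonAutonomous.IsStronglyMeasBdd τ P)
    (H1 : NonAutonomous.CondH1 ι τ A)
    (μ : ℝ) (hμ : 1 < μ) (H2 : NonAutonomous.MiyaderaVoigt ι τ A P μ) :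
    NonAutonomous.HasUniqueEvolutionFamily ι τ A ∧
    NonAutonomous.HasUniqueEvolutionFamily ι τ (fun t => A t + P t) ∧
    ∀ θ : ℝ, 1 < θ → θ ≤ μ →
      NonAutonomous.admissibleObs Y ι τ A θ =
        NonAutonomous.admissibleObs Y ι τ (fun t => A t + P t) θ := by
  open NonAutonomous in
  let : NormedSpace ℝ D := NormedSpace.restrictScalars ℝ 𝕜 D
  have : IsScalarTower ℝ 𝕜 D := IsScalarTower.of_algebraMap_smul fun _ _ => rfl
  let : NormedSpace ℝ Y := NormedSpace.restrictScalars ℝ 𝕜 Y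
  have : IsScalarTower ℝ 𝕜 Y := IsScalarTower.of_algebraMap_smul fun _ _ => rfl
  obtain ⟨N, hN⟩ := hP.exists_opBdd
  obtain ⟨q₀, hq₀, hEA⟩ := H1.exists_evolWP hι hτ hA
  -- Exponents below μ are allowed because Hölder weakens the Miyadera–Voigt estimate on a bounded
  -- interval; the whole range is kept for uniqueness of the associated families.
  have key : ∀ r, 1 < r → r ≤ min q₀ μ → ∃ M C K M' C' K' γ γ',
      EvolWP (ι.restrictScalars ℝ) (realify A) (ENNReal.ofReal r) τ M C K ∧
      EvolWP (ι.restrictScalars ℝ) (realify fun t => A t + P t) (ENNReal.ofReal r) τ M' C' K' ∧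
      ObsBdd (ι.restrictScalars ℝ) (realify A) (ENNReal.ofReal r) (realify P) (ENNReal.ofReal r)
        0 τ γ ∧
      ObsBdd (ι.restrictScalars ℝ) (realify fun t => A t + P t) (ENNReal.ofReal r) (realify P)
        (ENNReal.ofReal r) 0 τ γ' := by
    intro r hr hrq
    have hr1 : 1 < ENNReal.ofReal r := by simpa using hr
    obtain ⟨M, C, K, hE⟩ := hEA r hr (hrq.trans (min_le_left _ _))
    obtain ⟨U, hU⟩ := hE.exists_propagator hr1 (by simp) hιd
    obtain ⟨γ₀, hγ₀⟩ := H2.exists_obsBdd hι hN (hU.isAssociated hι hr hE) hU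
    obtain ⟨γ, hγ⟩ := hγ₀.exists_mono_exponent hN hr1.le
      (ENNReal.ofReal_le_ofReal (hrq.trans (min_le_right _ _))) (by simp)
    obtain ⟨C', K', hE'⟩ := hE.exists_perturb hιd hr1 (by simp) hτ hN hγ
    exact ⟨M, C, K, _, C', K', γ, _, hE, hE', hγ, hγ.perturbed hr1.le hE hN hE'⟩
  obtain ⟨q, hq, hqle⟩ : ∃ q, 1 < q ∧ q ≤ min q₀ μ := ⟨_, lt_min hq₀ hμ, le_rfl⟩
  have hq1 : 1 < ENNReal.ofReal q := by simpa using hq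
  obtain ⟨M, C, K, M', C', K', γ, γ', hE, hE', hγ, hγ'⟩ := key q hq hqle
  obtain ⟨U, hU⟩ := hE.exists_propagator hq1 (by simp) hιd
  obtain ⟨V, hV⟩ := hE'.exists_propagator hq1 (by simp) hιd
  have hUa := hU.isAssociated hι hq hE
  have hVa := hV.isAssociated hι hq hE'
  have hUu : ∀ U₁, IsAssociated ι τ A U₁ → ∀ s t, 0 ≤ s → s ≤ t → t ≤ τ → U₁ t s = U t s :=
    fun U₁ h₁ s t => hU.eq_of_isAssociated hι hιd hq (fun r hr hrq => by
      obtain ⟨M, C, K, -, -, -, -, -, h, -⟩ := key r hr (hrq.trans hqle)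
      exact ⟨M, C, K, h⟩) h₁ s t
  have hVu : ∀ U₁, IsAssociated ι τ (fun t => A t + P t) U₁ →
      ∀ s t, 0 ≤ s → s ≤ t → t ≤ τ → U₁ t s = V t s :=
    fun U₁ h₁ s t => hV.eq_of_isAssociated hι hιd hq (fun r hr hrq => by
      obtain ⟨-, -, -, M, C, K, -, -, -, h, -⟩ := key r hr (hrq.trans hqle)
      exact ⟨M, C, K, h⟩) h₁ s t
  refine ⟨⟨U, hUa, hUu⟩, ⟨V, hVa, hVu⟩, fun θ hθ _ => Subset.antisymm ?_ ?_⟩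
  -- From A to A + P the perturbation must be bounded into L¹ along the orbits of V.
  · obtain ⟨c, hc⟩ := hγ'.exists_mono_exponent hN le_rfl hq1.le (by simp)
    refine admissibleObs_subset (c := c) hι hιd hq1.le (by simp) hE hE' hU hV hUu hVa hθ.le ?_
    have e : (fun t => realify (fun t => A t + P t) t - realify A t) = realify P := by
      ext t y
      simp
    rw [e]
    exact hc
  -- Conversely A is the perturbation of A + P by -P, which is bounded into L¹ along the orbits of
  -- U; the sign does not affect the norm.
  · obtain ⟨c, hc⟩ := hγ.exists_mono_exponent hN le_rfl hq1.le (by simp)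
    refine admissibleObs_subset (c := c) hι hιd hq1.le (by simp) hE' hE hV hU hVu hUa hθ.le ?_
    intro r y u v h0 hrτ hs
    refine le_trans (le_of_eq ?_) (hc r y u v h0 hrτ hs)
    rw [← eLpNorm_neg]
    congr 1
    ext t
    simp
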